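/- **Conventions.** Let $(U,\xi=\ker\alpha)$ be a contact manifold with a fixed contact form $\alpha$. Let $G$ be the identity component of the group of compactly supported contactomorphisms of $(U,\xi)$, i.e. the contactomorphisms joined to the identity by a smooth path of contactomorphisms supported in a common compact set. Its Lie algebra $\mathfrak g$ is identified via $\alpha$ with $C^\infty_c(U)$, ordered pointwise, with adjoint action $\mathrm{Ad}_gK=(c_gK)\circ g^{-1}$, where $g^*\alpha=c_g\alpha$. Let $\mathcal E(U,\xi)$ be the set of contact embeddings $\sigma:U\hookrightarrow U$ which are contactly isotopic to the identity and whose image has compact closure in $U$. The maximal dominating cone is $$\mathfrak g^+(U,\xi)=\{H\in\mathfrak g \mid H\ge 0,\ H|_{\sigma(U)}>0\text{ for some }\sigma\in\mathcal E(U,\xi)\}.$$ It is called *non-orderable up to conjugation* if the following two conditions hold (they are equivalent when $U$ is connected and $\mathcal E(U,\xi)\neq\varnothing$): 1. there are $H\in\mathfrak g^+$, $g\in G$ and $0<s<1$ with $\mathrm{Ad}_gH\le sH$; 2. for all $K_1,K_2\in\mathfrak g^+$ there is $h\in G$ with $\mathrm{Ad}_hK_1\le K_2$. A pair $(V,\lambda)$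 is the *completion of a Liouville domain* if $V$ is a manifold without boundary, $\lambda$ is a smooth one-form with $d\lambda$ symplectic, and there is a compact domain $W\subset V$ with smooth boundary such that the Liouville vector field $Z$ (defined by $\iota_Zd\lambda=\lambda$) points strictly outward along $\partial W$ and the flow of $Z$ identifies $[0,\infty)\times\partial W$ with $V\setminus\operatorname{int}W$. **Proposition 1.7.** (a) For the standard contact $\mathbb R^{2n+1}$, $n\ge0$, with contact form $dt+\sum_{j=1}^n(x_j\,dy_j-y_j\,dx_j)$, and for the one-jet space $J^1(M)=T^*M\times\mathbb R$ of any closed manifold $M$, with contact form $dz+p\,dq$, the cone $\mathfrak g^+$ is non-orderable up to conjugation. (b) More generally, let $(V,\lambda)$ be the completion of a Liouville domain. Then for its contactization $\bigl(U=V\times\mathbb R,\ \ker(\lambda+dt)\bigr)$ the cone $\mathfrak g^+(U,\xi)$ is non-orderable up to conjugation. -/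

import Mathlib

open Set Manifold
open scoped ContDiff Topology

noncomputable section

namespace ContactCone

/-! ### One-forms on manifolds without boundary -/

section Forms

variable {E : Type*} [NormedAddCommGroup E] [NormedSpace ℝ E]
  {H : Type*} [TopologicalSpace H] (I : ModelWithCorners ℝ E H)
  {V : Type*} [TopologicalSpace V] [ChartedSpace H V]

variable (V) in
/-- A (not necessarily smooth) differential one-form on `V`. -/
abbrev OneForm : Type _ := ∀ x : V, TangentSpace I x →L[ℝ] ℝ

/-- A one-form is smooth if it is a smooth section of the cotangent bundle. -/
def OneForm.IsSmooth [IsManifold I ∞ V] (lam : OneForm I V) : Prop :=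
  ContMDiff I (I.prod 𝓘(ℝ, E →L[ℝ] ℝ)) ∞
    (fun x : V ↦ (Bundle.TotalSpace.mk' (E →L[ℝ] ℝ) x (lam x) :
      Bundle.TotalSpace (E →L[ℝ] ℝ) (fun x : V ↦ TangentSpace I x →L[ℝ] ℝ)))

/-- The one-form `lam` written in the preferred chart around `x`, i.e. its pullback under
the inverse of that chart. -/
def OneForm.inChart (lam : OneForm I V) (x : V) (y : E) : E →L[ℝ] ℝ :=
  (lam ((extChartAt I x).symm y)).comp (mfderiv 𝓘(ℝ, E) I (extChartAt I x).symm y)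

/-- The exterior derivative `(dlam)_x (v, w)` of a smooth one-form on a manifold without boundary.
In the preferred chart around `x` (whose differential at `x` is the identification of the tangent
space at `x` with the model space) it is `D_v lam (w) - D_w lam (v)`. -/
def OneForm.d (lam : OneForm I V) (x : V) (v w : TangentSpace I x) : ℝ :=
  fderiv ℝ (lam.inChart I x) (extChartAt I x x) v w -
    fderiv ℝ (lam.inChart I x) (extChartAt I x x) w v

end Forms

/-! ### Liouville domains and their completions -/

section Liouville

variable {E : Type*} [NormedAddCommGroup E] [NormedSpace ℝ E]
  {H : Type*} [TopologicalSpace H] (I : ModelWithCorners ℝ E H)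
  {V : Type*} [TopologicalSpace V] [ChartedSpace H V]

/-- `dlam` is nondegenerate (hence `dlam` is a symplectic form when `lam` is smooth). -/
def IsExactSymplectic (lam : OneForm I V) : Prop :=
  ∀ (x : V) (v : TangentSpace I x), (∀ w : TangentSpace I x, lam.d I x v w = 0) → v = 0

/-- `Z` is the Liouville vector field of `lam`: the contraction of `dlam` with `Z` is `lam`.
It is unique when `dlam` is nondegenerate. -/
def IsLiouvilleField (lam : OneForm I V) (Z : ∀ x : V, TangentSpace I x) : Prop :=
  ∀ (x : V) (w : TangentSpace I x), lam.d I x (Z x) w = lam x w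

/-- `W` is a compact domain in `V` with smooth boundary, along which the Liouville vector field
`Z` points strictly outward: `W` is the compact sublevel set `{f ≤ 0}` of a smooth function `f`
with `df(Z) > 0` along the level set `{f = 0}`, which is the boundary of `W`.
Together with the restriction of the exact symplectic structure of `V` this is
a Liouville domain. -/
def IsLiouvilleDomain (Z : ∀ x : V, TangentSpace I x) (W : Set V) : Prop :=
  IsCompact W ∧
    ∃ f : V → ℝ, ContMDiff I 𝓘(ℝ, ℝ) ∞ f ∧ W = {x | f x ≤ 0} ∧
      ∀ x : V, f x = 0 → (0 : ℝ) < mfderiv I 𝓘(ℝ, ℝ) f x (Z x)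

/-- `(V, lam)` is the completion of a Liouville domain: `V` is an exact symplectic manifold
containing a Liouville domain `W` such that the complement of the interior of `W` is the
cylindrical end `[0, ∞) × ∂W`. The point `(r, y)` of the end is the point `κ r y` which the flow
of the Liouville vector field reaches from `y ∈ ∂W` at time `r`; since this flow rescales `lam`
exponentially, `lam` is the form `e ^ r * lam|∂W` on the end. -/
def IsCompletionOfLiouvilleDomain [IsManifold I ∞ V] (lam : OneForm I V) : Prop :=
  lam.IsSmooth I ∧ IsExactSymplectic I lam ∧
    ∃ (Z : ∀ x : V, TangentSpace I x) (W : Set V) (κ : ℝ → V → V),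
      IsLiouvilleField I lam Z ∧ IsLiouvilleDomain I Z W ∧
      (∀ y ∈ frontier W, κ 0 y = y ∧ IsMIntegralCurveOn (fun r ↦ κ r y) Z (Ici 0)) ∧
      BijOn (fun p : ℝ × V ↦ κ p.1 p.2) (Ici 0 ×ˢ frontier W) (interior W)ᶜ

/-- The one-form `lam + dt` on `V × ℝ`. -/
def contactization (lam : OneForm I V) : OneForm (I.prod 𝓘(ℝ, ℝ)) (V × ℝ) := fun p ↦
  let dt : TangentSpace (I.prod 𝓘(ℝ, ℝ)) p →L[ℝ] ℝ :=
    mfderiv (I.prod 𝓘(ℝ, ℝ)) 𝓘(ℝ, ℝ) (Prod.snd : V × ℝ → ℝ) p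
  (lam p.1).comp (mfderiv (I.prod 𝓘(ℝ, ℝ)) I (Prod.fst : V × ℝ → V) p) + dt

end Liouville

/-! ### Contact geometry of `(U, ker α)` for a fixed contact form `α` -/

section Contact

variable {E : Type*} [NormedAddCommGroup E] [NormedSpace ℝ E]
  {H : Type*} [TopologicalSpace H] (J : ModelWithCorners ℝ E H)
  {U : Type*} [TopologicalSpace U] [ChartedSpace H U] (α : OneForm J U)

/-- The positive number `c` is the conformal factor of `φ` at `x`: `(φ^* α)_x = c α_x`. -/
def IsConformalFactorAt (φ : U → U) (x : U) (c : ℝ) : Prop :=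
  0 < c ∧ (α (φ x)).comp (mfderiv J J φ x) = c • α x

/-- `φ` preserves the cooriented hyperplane field `ker α`. -/
def IsContactMap (φ : U → U) : Prop := ∀ x, ∃ c, IsConformalFactorAt J α φ x c

open Classical in
/-- The positive function `c_φ` with `φ^* α = c_φ α`, for a map `φ` preserving `ker α`. -/
def conformalFactor (φ : U → U) (x : U) : ℝ :=
  if h : ∃ c, IsConformalFactorAt J α φ x c then h.choose else 1

variable {J α} in
theorem conformalFactor_spec {φ : U → U} (hφ : IsContactMap J α φ) (x : U) :
    IsConformalFactorAt J α φ x (conformalFactor J α φ x) := by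
  rw [conformalFactor, dif_pos (hφ x)]
  exact (hφ x).choose_spec

variable {J α} in
theorem conformalFactor_eq {φ : U → U} {x : U} {c : ℝ} (hα : α x ≠ 0)
    (h : IsConformalFactorAt J α φ x c) : conformalFactor J α φ x = c := by
  have h' : ∃ c, IsConformalFactorAt J α φ x c := ⟨c, h⟩
  rw [conformalFactor, dif_pos h']
  exact smul_left_injective ℝ hα (h'.choose_spec.2.symm.trans h.2)

/-- A contact embedding of `U` into itself. An embedding between manifolds of equal dimension
is the same as an injective local diffeomorphism. -/
def IsContactEmbedding (σ : U → U) : Prop :=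
  IsLocalDiffeomorph J J ∞ σ ∧ Function.Injective σ ∧ IsContactMap J α σ

/-- The space of contact embeddings of `U` into itself which are contactly isotopic to
the identity and whose image has compact closure. The manifold is convex at infinity if and
only if this space is nonempty. -/
def contractingEmbeddings : Set (U → U) :=
  {σ | IsCompact (closure (range σ)) ∧
    ∃ S : ℝ → U → U,
      ContMDiffOn (𝓘(ℝ, ℝ).prod J) J ∞ (fun p : ℝ × U ↦ S p.1 p.2) (Icc 0 1 ×ˢ univ) ∧
      (∀ t ∈ Icc (0 : ℝ) 1, IsContactEmbedding J α (S t)) ∧ S 0 = id ∧ S 1 = σ}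

/-- The identity component `G` of the group of compactly supported contactomorphisms:
the contactomorphisms which are joined to the identity by a smooth path of contactomorphisms with
supports in a common compact set. -/
def contactomorphismGroup : Set (U ≃ₘ⟮J, J⟯ U) :=
  {g | ∃ (C : Set U) (S : ℝ → (U ≃ₘ⟮J, J⟯ U)), IsCompact C ∧
      ContMDiffOn (𝓘(ℝ, ℝ).prod J) J ∞ (fun p : ℝ × U ↦ S p.1 p.2) (Icc 0 1 ×ˢ univ) ∧
      (∀ t ∈ Icc (0 : ℝ) 1, IsContactMap J α (S t) ∧ ∀ x ∉ C, S t x = x) ∧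
      S 0 = Diffeomorph.refl J U ∞ ∧ S 1 = g}

variable (U) in
/-- The Lie algebra of compactly supported contact vector fields, identified through the contact
form with the space of smooth compactly supported functions. -/
def hamiltonians : Set (U → ℝ) := {K | ContMDiff J 𝓘(ℝ, ℝ) ∞ K ∧ HasCompactSupport K}

/-- The adjoint action `Ad_g K = (c_g K) ∘ g⁻¹`. -/
def adjoint (g : U ≃ₘ⟮J, J⟯ U) (K : U → ℝ) : U → ℝ := fun x ↦
  conformalFactor J α g (g.symm x) * K (g.symm x)

/-- The maximal dominating cone: the nonnegative Hamiltonians which are positive on the image of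
some contact embedding, contactly isotopic to the identity, with relatively compact image. -/
def maximalCone : Set (U → ℝ) :=
  {K | K ∈ hamiltonians J U ∧ (∀ x, 0 ≤ K x) ∧
    ∃ σ ∈ contractingEmbeddings J α, ∀ x ∈ range σ, 0 < K x}

/-- The maximal dominating cone is non-orderable up to conjugation: it contains an `H` with
`Ad_g H ≤ s H` for some `g` and some `0 < s < 1`, and any two of its elements `K₁`, `K₂` satisfy
`Ad_h K₁ ≤ K₂` for some `h`. -/
def NonOrderableUpToConjugation : Prop :=
  (∃ K ∈ maximalCone J α, ∃ g ∈ contactomorphismGroup J α, ∃ s : ℝ, 0 < s ∧ s < 1 ∧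
    ∀ x, adjoint J α g K x ≤ s * K x) ∧
  ∀ K₁ ∈ maximalCone J α, ∀ K₂ ∈ maximalCone J α, ∃ h ∈ contactomorphismGroup J α,
    ∀ x, adjoint J α h K₁ x ≤ K₂ x

end Contact

/-! ### Examples -/

/-- The one-form `∑ j, (x_j dy_j - y_j dx_j)` on `ℝ^{2n}`, with coordinates `x_j = p (inl j)` and
`y_j = p (inr j)`. Its contactization is the standard contact form on `ℝ^{2n+1}`. -/
def standardForm (n : ℕ) :
    OneForm 𝓘(ℝ, EuclideanSpace ℝ (Fin n ⊕ Fin n)) (EuclideanSpace ℝ (Fin n ⊕ Fin n)) := fun p ↦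
  (∑ j, (p (Sum.inl j) • EuclideanSpace.proj (Sum.inr j) -
    p (Sum.inr j) • EuclideanSpace.proj (Sum.inl j)) : EuclideanSpace ℝ (Fin n ⊕ Fin n) →L[ℝ] ℝ)

section Jet

variable {E : Type*} [NormedAddCommGroup E] [NormedSpace ℝ E]
  {H : Type*} [TopologicalSpace H] (I : ModelWithCorners ℝ E H)
  (M : Type*) [TopologicalSpace M] [ChartedSpace H M] [IsManifold I ∞ M]

/-- The total space `T^*M` of the cotangent bundle. -/
abbrev CotangentSpace : Type _ :=
  Bundle.TotalSpace (E →L[ℝ] ℝ) (fun x : M ↦ TangentSpace I x →L[ℝ] ℝ)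

/-- The canonical one-form `p dq` on `T^*M`, whose contactization is the standard contact form
`dz + p dq` on the one-jet space `J^1(M) = T^*M × ℝ`. -/
def canonicalForm : OneForm (I.prod 𝓘(ℝ, E →L[ℝ] ℝ)) (CotangentSpace I M) := fun p ↦
  (p.snd : TangentSpace I p.proj →L[ℝ] ℝ).comp
    (mfderiv (I.prod 𝓘(ℝ, E →L[ℝ] ℝ)) I
      (Bundle.TotalSpace.proj : CotangentSpace I M → M) p)

end Jet

end ContactCone

end

noncomputable section

namespace ContactCone


universe u

/-! ### Smoothness of composition operators on spaces of continuous curves -/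

section Nemytskii

variable {S : Type*} [TopologicalSpace S] [CompactSpace S]

variable (S) in
/-- The pointwise application of operators, as a continuous linear map. -/
def pointwiseApply (E F : Type*) [NormedAddCommGroup E] [NormedSpace ℝ E]
    [NormedAddCommGroup F] [NormedSpace ℝ F] :
    C(S, E →L[ℝ] F) →L[ℝ] C(S, E) →L[ℝ] C(S, F) :=
  LinearMap.mkContinuous₂
    (LinearMap.mk₂ ℝ
      (fun (A : C(S, E →L[ℝ] F)) (h : C(S, E)) ↦
        (⟨fun s ↦ A s (h s), A.continuous.clm_apply h.continuous⟩ : C(S, F)))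
      (fun A B h ↦ by ext s; simp)
      (fun c A h ↦ by ext s; simp)
      (fun A h k ↦ by ext s; simp)
      (fun c A h ↦ by ext s; simp))
    1
    (fun A h ↦ by
      rw [one_mul, ContinuousMap.norm_le _ (by positivity)]
      intro s
      exact ((A s).le_opNorm _).trans (mul_le_mul (A.norm_coe_le_norm s) (h.norm_coe_le_norm s)
        (norm_nonneg _) (norm_nonneg A)))

theorem hasFDerivAt_continuousMap_comp {E F : Type*} [NormedAddCommGroup E] [NormedSpace ℝ E]
    [NormedAddCommGroup F] [NormedSpace ℝ F] (f : C(E, F)) (f' : C(E, E →L[ℝ] F))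
    (hf : ∀ x, HasFDerivAt f (f' x) x) (γ : C(S, E)) :
    HasFDerivAt (fun γ : C(S, E) ↦ f.comp γ) (pointwiseApply S E F (f'.comp γ)) γ := by
  rw [hasFDerivAt_iff_isLittleO_nhds_zero, Asymptotics.isLittleO_iff]
  intro ε hε
  have hK : IsCompact (range γ) := isCompact_range γ.continuous
  have huc := hK.uniformContinuousAt_of_continuousAt f' (fun x _ ↦ f'.continuous.continuousAt)
    (Metric.dist_mem_uniformity hε)
  obtain ⟨δ, hδ, hδ'⟩ := Metric.mem_uniformity_dist.1 huc
  filter_upwards [Metric.ball_mem_nhds (0 : C(S, E)) hδ] with h hh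
  rw [mem_ball_zero_iff] at hh
  rw [ContinuousMap.norm_le _ (by positivity)]
  intro s
  have hs : ‖h s‖ ≤ ‖h‖ := h.norm_coe_le_norm s
  have hb : ∀ z ∈ Metric.ball (γ s) δ, ‖f' z - f' (γ s)‖ ≤ ε := by
    intro z hz
    have := hδ' (a := γ s) (b := z) (by rw [dist_comm]; exact hz) (mem_range_self s)
    have h2 : dist (f' (γ s)) (f' z) < ε := this
    rw [← dist_eq_norm, dist_comm]
    exact h2.le
  have := (convex_ball (γ s) δ).norm_image_sub_le_of_norm_hasFDerivWithin_le'
    (f := f) (f' := f') (φ := f' (γ s)) (C := ε) (x := γ s) (y := γ s + h s)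
    (fun z _ ↦ (hf z).hasFDerivWithinAt) hb (Metric.mem_ball_self hδ)
    (by simpa using hs.trans_lt hh)
  simp only [add_sub_cancel_left] at this
  exact this.trans (mul_le_mul_of_nonneg_left hs hε.le)

theorem contDiff_continuousMap_comp {E F : Type u} [NormedAddCommGroup E] [NormedSpace ℝ E]
    [NormedAddCommGroup F] [NormedSpace ℝ F] (f : C(E, F)) (hf : ContDiff ℝ ∞ f) (n : ℕ) :
    ContDiff ℝ n (fun γ : C(S, E) ↦ f.comp γ) := by
  induction n generalizing F with
  | zero =>
    exact contDiff_zero.2 (ContinuousMap.continuous_postcomp f)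
  | succ n ih =>
    set f' : C(E, E →L[ℝ] F) := ⟨fderiv ℝ f, hf.continuous_fderiv (by simp)⟩
    have hf' : ContDiff ℝ ∞ f' := hf.fderiv_right (m := ∞) (by simp)
    have hd : ∀ x, HasFDerivAt f (f' x) x := fun x ↦
      ((hf.differentiable (by simp)) x).hasFDerivAt
    rw [Nat.cast_succ, contDiff_succ_iff_hasFDerivAt]
    refine ⟨fun γ ↦ pointwiseApply S E F (f'.comp γ), ?_, hasFDerivAt_continuousMap_comp f f' hd⟩
    exact (pointwiseApply S E F).contDiff.comp (ih f' hf')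

end Nemytskii

/-! ### Smooth dependence of solutions of differential equations on the initial value -/

section LocalFlow

variable {E : Type*} [NormedAddCommGroup E] [NormedSpace ℝ E] 

/-- The primitive vanishing at zero of a continuous curve on `[-1, 1]`. -/
def primitive [CompleteSpace E] : C(Icc (-1 : ℝ) 1, E) →L[ℝ] C(Icc (-1 : ℝ) 1, E) :=
  LinearMap.mkContinuous
    { toFun := fun γ ↦ ⟨fun s ↦ ∫ r in (0 : ℝ)..s, IccExtend (by norm_num) γ r,
        (intervalIntegral.continuous_primitive
          (fun a b ↦ (γ.continuous.Icc_extend' (h := by norm_num)).intervalIntegrable a b) 0).comp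
          continuous_subtype_val⟩
      map_add' := fun γ η ↦ by
        ext s
        exact intervalIntegral.integral_add
          ((γ.continuous.Icc_extend' (h := by norm_num)).intervalIntegrable _ _)
          ((η.continuous.Icc_extend' (h := by norm_num)).intervalIntegrable _ _)
      map_smul' := fun c γ ↦ by
        ext s
        exact intervalIntegral.integral_smul c _ }
    1
    (fun γ ↦ by
      rw [one_mul, ContinuousMap.norm_le _ (norm_nonneg _)]
      intro s
      refine (intervalIntegral.norm_integral_le_of_norm_le_const
        (C := ‖γ‖) (fun x _ ↦ γ.norm_coe_le_norm _)).trans ?_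
      have : |(s : ℝ) - 0| ≤ 1 := by rw [sub_zero, abs_le]; exact s.2
      nlinarith [norm_nonneg γ])

theorem primitive_apply [CompleteSpace E] (γ : C(Icc (-1 : ℝ) 1, E)) (s : Icc (-1 : ℝ) 1) :
    primitive γ s = ∫ r in (0 : ℝ)..s, IccExtend (by norm_num : (-1 : ℝ) ≤ 1) γ r := rfl

theorem hasDerivAt_primitive [CompleteSpace E] (γ : C(Icc (-1 : ℝ) 1, E)) {s : ℝ}
    (hs : s ∈ Ioo (-1 : ℝ) 1) :
    HasDerivAt (IccExtend (by norm_num : (-1 : ℝ) ≤ 1) (primitive γ))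
      (IccExtend (by norm_num : (-1 : ℝ) ≤ 1) γ s) s := by
  have hc : Continuous (IccExtend (by norm_num : (-1 : ℝ) ≤ 1) γ) :=
    γ.continuous.Icc_extend' (h := by norm_num)
  refine (intervalIntegral.integral_hasDerivAt_right (hc.intervalIntegrable 0 s)
    (hc.stronglyMeasurableAtFilter _ _) hc.continuousAt).congr_of_eventuallyEq ?_
  filter_upwards [Ioo_mem_nhds hs.1 hs.2] with r hr
  rw [IccExtend_of_mem _ _ (Ioo_subset_Icc_self hr), primitive_apply]

/-- Near a point `x₀`, the solutions on `[-1, 1]` of `γ' = t • f γ` with `γ 0 = x` form a smooth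
family of curves, parametrised by `(t, x)` near `(0, x₀)`. -/
theorem exists_contDiffAt_solutions [CompleteSpace E] (f : C(E, E)) (hf : ContDiff ℝ ∞ f) (x₀ : E)
    (n : ℕ) :
    ∃ ψ : ℝ × E → C(Icc (-1 : ℝ) 1, E), ContDiffAt ℝ n ψ (0, x₀) ∧
      ψ (0, x₀) = ContinuousMap.const _ x₀ ∧
      ∀ᶠ p in 𝓝 ((0 : ℝ), x₀), ψ p ⟨0, by norm_num, by norm_num⟩ = p.2 ∧
        ∀ s ∈ Ioo (-1 : ℝ) 1, HasDerivAt (IccExtend (by norm_num : (-1 : ℝ) ≤ 1) (ψ p))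
          (p.1 • f (IccExtend (by norm_num : (-1 : ℝ) ≤ 1) (ψ p) s)) s := by
  set Cst : E →L[ℝ] C(Icc (-1 : ℝ) 1, E) := ContinuousLinearMap.const ℝ (Icc (-1 : ℝ) 1) with hC
  set G : (ℝ × E) × C(Icc (-1 : ℝ) 1, E) → C(Icc (-1 : ℝ) 1, E) :=
    fun q ↦ q.2 - Cst q.1.2 - q.1.1 • primitive (f.comp q.2) with hG
  set u : (ℝ × E) × C(Icc (-1 : ℝ) 1, E) := ((0, x₀), Cst x₀) with hu
  have hGd : ContDiff ℝ (n + 1 : ℕ) G := by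
    have h1 : ContDiff ℝ (n + 1 : ℕ) (fun q : (ℝ × E) × C(Icc (-1 : ℝ) 1, E) ↦ f.comp q.2) :=
      (contDiff_continuousMap_comp f hf (n + 1)).comp contDiff_snd
    exact (contDiff_snd.sub (Cst.contDiff.comp (contDiff_snd.comp contDiff_fst))).sub
      ((contDiff_fst.comp contDiff_fst).smul ((primitive (E := E)).contDiff.comp h1 :))
  have hn : ((n + 1 : ℕ) : WithTop ℕ∞) ≠ 0 := by exact_mod_cast n.succ_ne_zero
  have hinv : fderiv ℝ G u ∘L .inr ℝ (ℝ × E) C(Icc (-1 : ℝ) 1, E) = .id ℝ _ := by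
    have h1 : HasFDerivAt G (fderiv ℝ G u) ((u.1, u.2) : (ℝ × E) × C(Icc (-1 : ℝ) 1, E)) :=
      ((hGd.differentiable hn) u).hasFDerivAt
    have h2 := h1.comp u.2 (hasFDerivAt_prodMk_right u.1 u.2)
    have h3 : HasFDerivAt (G ∘ fun y ↦ (u.1, y)) (.id ℝ _ : _ →L[ℝ] C(Icc (-1 : ℝ) 1, E)) u.2 := by
      have : (G ∘ fun y ↦ (u.1, y)) = fun y ↦ y - Cst x₀ := by
        ext y; simp [hG, hu]
      rw [this]
      exact (hasFDerivAt_id u.2).sub_const _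
    exact h2.unique h3
  have hinv' : (fderiv ℝ G u ∘L .inr ℝ (ℝ × E) C(Icc (-1 : ℝ) 1, E)).IsInvertible := by
    rw [hinv]; exact ⟨.refl ℝ _, rfl⟩
  have hGu : ContDiffAt ℝ (n + 1 : ℕ) G u := hGd.contDiffAt
  refine ⟨hGu.implicitFunction hn hinv', ?_, ?_, ?_⟩
  · exact (hGu.contDiffAt_implicitFunction hn hinv').of_le (by exact_mod_cast n.le_succ)
  · exact hGu.implicitFunction_apply_self hn hinv'
  · filter_upwards [hGu.eventually_apply_implicitFunction hn hinv'] with p hp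
    set γ := hGu.implicitFunction hn hinv' p
    have hGu0 : G u = 0 := by simp [hG, hu]
    have hγ : γ = Cst p.2 + p.1 • primitive (f.comp γ) := by
      rw [hGu0] at hp
      have : γ - Cst p.2 - p.1 • primitive (f.comp γ) = 0 := hp
      rw [sub_sub, sub_eq_zero] at this
      exact this
    constructor
    · have := congrArg (fun γ : C(Icc (-1 : ℝ) 1, E) ↦ γ ⟨0, by norm_num, by norm_num⟩) hγ
      simpa [primitive_apply, hC] using this
    · intro s hs
      have h1 := ((hasDerivAt_primitive (f.comp γ) hs).const_smul p.1).const_add p.2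
      refine (h1.congr_of_eventuallyEq ?_)
      refine Filter.Eventually.of_forall fun r ↦ ?_
      exact congrArg (fun γ : C(Icc (-1 : ℝ) 1, E) ↦ γ (projIcc (-1) 1 (by norm_num) r)) hγ

end LocalFlow


/-! ### Flows of smooth vector fields on manifolds without boundary -/

section Flow

variable {E : Type*} [NormedAddCommGroup E] [NormedSpace ℝ E]
  {H : Type*} [TopologicalSpace H] (I : ModelWithCorners ℝ E H)
  {M : Type*} [TopologicalSpace M] [ChartedSpace H M] [IsManifold I ∞ M]

/-- Smooth vector fields. -/
def IsSmoothField (v : ∀ x : M, TangentSpace I x) : Prop :=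
  ContMDiff I I.tangent ∞ (fun x ↦ (⟨x, v x⟩ : TangentBundle I M))

/-- The representation of a vector field in the preferred chart around `x₀`. -/
def fieldInChart (v : ∀ x : M, TangentSpace I x) (x₀ : M) (y : E) : E :=
  (mfderiv 𝓘(ℝ, E) I (extChartAt I x₀).symm y).inverse (v ((extChartAt I x₀).symm y))

variable {I}

theorem IsSmoothField.const_smul {v : ∀ x : M, TangentSpace I x} (hv : IsSmoothField I v) (c : ℝ) :
    IsSmoothField I (c • v) :=
  ContMDiff.const_smul_section (a := c) hv

theorem mfderiv_extChartAt_symm_isInvertible [I.Boundaryless] {x₀ : M} {y : E}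
    (hy : y ∈ (extChartAt I x₀).target) :
    (mfderiv 𝓘(ℝ, E) I (extChartAt I x₀).symm y).IsInvertible := by
  have : IsManifold I 1 M := .of_le (n := ∞) (by simp)
  have := isInvertible_mfderivWithin_extChartAt_symm (I := I) hy
  rwa [I.range_eq_univ, mfderivWithin_univ] at this

theorem contMDiffAt_extChartAt_symm [I.Boundaryless] {x₀ : M} {y : E}
    (hy : y ∈ (extChartAt I x₀).target) :
    ContMDiffAt 𝓘(ℝ, E) I ∞ (extChartAt I x₀).symm y :=
  (contMDiffOn_extChartAt_symm x₀).contMDiffAt ((isOpen_extChartAt_target x₀).mem_nhds hy)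

theorem mfderiv_extChartAt_symm_fieldInChart [I.Boundaryless] (v : ∀ x : M, TangentSpace I x)
    {x₀ : M} {y : E} (hy : y ∈ (extChartAt I x₀).target) :
    mfderiv 𝓘(ℝ, E) I (extChartAt I x₀).symm y (fieldInChart (E := E) I v x₀ y) =
      v ((extChartAt I x₀).symm y) :=
  (mfderiv_extChartAt_symm_isInvertible hy).self_apply_inverse _

variable [I.Boundaryless] [FiniteDimensional ℝ E]

theorem IsSmoothField.contDiffAt_fieldInChart {v : ∀ x : M, TangentSpace I x}
    (hv : IsSmoothField I v) {x₀ : M} {y : E} (hy : y ∈ (extChartAt I x₀).target) :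
    ContDiffAt ℝ ∞ (fieldInChart I v x₀) y := by
  have : CompleteSpace E := FiniteDimensional.complete ℝ E
  refine contMDiffAt_vectorSpace_iff_contDiffAt.1 ?_
  exact ContMDiffAt.mpullback_vectorField_preimage (n := ∞) (hv.contMDiffAt)
    (contMDiffAt_extChartAt_symm hy) (mfderiv_extChartAt_symm_isInvertible hy) (by simp)

/-- A vector field in the model space which agrees near the centre of a chart with a given field. -/
theorem IsSmoothField.exists_local_model {v : ∀ x : M, TangentSpace I x}
    (hv : IsSmoothField I v) (x₀ : M) :
    ∃ f : C(E, E), ContDiff ℝ ∞ f ∧ ∀ᶠ y in 𝓝 (extChartAt I x₀ x₀), f y = fieldInChart I v x₀ y := by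
  obtain ⟨r, hr, hrs⟩ := Metric.nhds_basis_closedBall.mem_iff.1
    (extChartAt_target_mem_nhds (I := I) x₀)
  let b : ContDiffBump (extChartAt I x₀ x₀) := ⟨r / 2, r, by positivity, by linarith⟩
  have hs : ContDiff ℝ ∞ fun y ↦ b y • fieldInChart I v x₀ y := by
    rw [contDiff_iff_contDiffAt]
    intro y
    by_cases hy : y ∈ Metric.closedBall (extChartAt I x₀ x₀) r
    · exact b.contDiff.contDiffAt.smul (hv.contDiffAt_fieldInChart (hrs hy))
    · have : (fun y ↦ b y • fieldInChart I v x₀ y) =ᶠ[𝓝 y] fun _ ↦ 0 := by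
        filter_upwards [Metric.isClosed_closedBall.isOpen_compl.mem_nhds hy] with z hz
        rw [b.zero_of_le_dist, zero_smul]
        exact (not_le.1 (fun h ↦ hz h)).le
      exact contDiffAt_const.congr_of_eventuallyEq this
  refine ⟨⟨_, hs.continuous⟩, hs, ?_⟩
  filter_upwards [b.eventuallyEq_one] with y hy
  change b y • fieldInChart I v x₀ y = _
  rw [hy, Pi.one_apply, one_smul]

/-- Integral curves with initial value near `x₀` form a smooth family, parametrised by the
scaling `p.1` of the vector field and the initial value `p.2`. -/
theorem IsSmoothField.exists_local_solutions {v : ∀ x : M, TangentSpace I x}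
    (hv : IsSmoothField I v) (x₀ : M) (n : ℕ) :
    ∃ c : ℝ → ℝ × M → M, (∀ s ∈ Icc (-1 : ℝ) 1, ContMDiffAt (𝓘(ℝ, ℝ).prod I) I n (c s) (0, x₀)) ∧
      ∀ᶠ p in 𝓝 ((0 : ℝ), x₀), c 0 p = p.2 ∧
        IsMIntegralCurveOn (fun s ↦ c s p) (p.1 • v) (Ioo (-1) 1) := by
  have : CompleteSpace E := FiniteDimensional.complete ℝ E
  have : IsManifold I n M := .of_le (n := ∞) (by exact_mod_cast le_top)
  obtain ⟨f, hf, hfv⟩ := hv.exists_local_model x₀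
  set y₀ := extChartAt I x₀ x₀ with hy₀
  obtain ⟨ψ, hψ, hψ0, hψs⟩ := exists_contDiffAt_solutions f hf y₀ n
  have h11 : (-1 : ℝ) ≤ 1 := by norm_num
  set χ : ℝ × M → ℝ × E := fun p ↦ (p.1, extChartAt I x₀ p.2) with hχ
  have hχs : ContMDiffAt (𝓘(ℝ, ℝ).prod I) 𝓘(ℝ, ℝ × E) n χ (0, x₀) := by
    rw [modelWithCornersSelf_prod, ← chartedSpaceSelf_prod]
    exact contMDiffAt_fst.prodMk ((contMDiffAt_extChartAt (n := n)).comp ((0 : ℝ), x₀)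
      contMDiffAt_snd)
  have hχ0 : χ (0, x₀) = (0, y₀) := rfl
  refine ⟨fun s p ↦ (extChartAt I x₀).symm (IccExtend h11 (ψ (χ p)) s), ?_, ?_⟩
  · intro s hs
    have h1 : ContDiffAt ℝ n (fun q ↦ IccExtend h11 (ψ q) s) (0, y₀) :=
      (ContinuousMap.evalCLM (M := E) ℝ (projIcc (-1) 1 h11 s)).contDiff.contDiffAt.comp _ hψ
    have h2 : ContMDiffAt (𝓘(ℝ, ℝ).prod I) 𝓘(ℝ, E) n (fun p ↦ IccExtend h11 (ψ (χ p)) s) (0, x₀) :=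
      ContMDiffAt.comp (g := fun q ↦ IccExtend h11 (ψ q) s) ((0 : ℝ), x₀) h1.contMDiffAt hχs
    have h3 : IccExtend h11 (ψ (χ (0, x₀))) s = y₀ := by
      rw [hχ0, hψ0]; rfl
    refine ContMDiffAt.comp ((0 : ℝ), x₀) ?_ h2
    rw [h3]
    exact (contMDiffAt_extChartAt_symm (mem_extChartAt_target x₀)).of_le (by exact_mod_cast le_top)
  · have hev : ∀ᶠ y in 𝓝 y₀, f y = fieldInChart I v x₀ y ∧ y ∈ (extChartAt I x₀).target :=
      hfv.and (extChartAt_target_mem_nhds (I := I) x₀)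
    obtain ⟨δ, hδ, hδs⟩ := Metric.eventually_nhds_iff_ball.1 hev
    have hχt : Filter.Tendsto χ (𝓝 (0, x₀)) (𝓝 (0, y₀)) := hχs.continuousAt
    have hnear : ∀ᶠ q in 𝓝 ((0 : ℝ), y₀), ‖ψ q - ContinuousMap.const _ y₀‖ < δ := by
      have : ∀ᶠ q in 𝓝 ((0 : ℝ), y₀), dist (ψ q) (ψ (0, y₀)) < δ :=
        hψ.continuousAt.eventually (Metric.ball_mem_nhds _ hδ)
      simpa [hψ0, dist_eq_norm] using this
    have hsrc : ∀ᶠ p in 𝓝 ((0 : ℝ), x₀), p.2 ∈ (extChartAt I x₀).source :=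
      continuous_snd.continuousAt.eventually (extChartAt_source_mem_nhds (I := I) x₀)
    filter_upwards [hχt.eventually hψs, hχt.eventually hnear, hsrc] with p hp hp2 hp3
    have hmem : ∀ s, IccExtend h11 (ψ (χ p)) s ∈ Metric.ball y₀ δ := by
      intro s
      rw [mem_ball_iff_norm]
      exact ((ψ (χ p) - ContinuousMap.const _ y₀).norm_coe_le_norm (projIcc (-1) 1 h11 s)).trans_lt
        hp2
    constructor
    · change (extChartAt I x₀).symm (IccExtend h11 (ψ (χ p)) 0) = p.2
      rw [IccExtend_of_mem _ _ (by norm_num : (0 : ℝ) ∈ Icc (-1 : ℝ) 1), hp.1]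
      exact (extChartAt I x₀).left_inv hp3
    · intro s hs
      have h1 := hp.2 s hs
      obtain ⟨hfs, hts⟩ := hδs _ (hmem s)
      have h2 := ((contMDiffAt_extChartAt_symm hts).mdifferentiableAt (by simp)).hasMFDerivAt
      have h3 := HasMFDerivAt.comp s h2 h1.hasFDerivAt.hasMFDerivAt
      refine (h3.congr_mfderiv ?_).hasMFDerivWithinAt
      have h4 := mfderiv_extChartAt_symm_fieldInChart v hts
      rw [← hfs] at h4
      set L := mfderiv 𝓘(ℝ, E) I (extChartAt I x₀).symm (IccExtend h11 (ψ (χ p)) s)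
      refine ContinuousLinearMap.ext fun (r : ℝ) ↦ ?_
      change L ((r : ℝ) • p.1 • (f (IccExtend h11 (ψ (χ p)) s) : E)) = (r : ℝ) • p.1 • v _
      exact (L.map_smul r _).trans (congrArg (r • ·) ((L.map_smul p.1 _).trans
        (congrArg (p.1 • ·) h4)))

/-- The time for which integral curves exist is bounded below on compact sets. -/
theorem IsSmoothField.exists_uniform_time {v : ∀ x : M, TangentSpace I x}
    (hv : IsSmoothField I v) {D : Set M} (hD : IsCompact D) :
    ∃ ε > 0, ∀ x ∈ D, ∃ γ : ℝ → M, γ 0 = x ∧ IsMIntegralCurveOn γ v (Ioo (-ε) ε) := by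
  refine hD.induction_on (p := fun D ↦ ∃ ε > 0, ∀ x ∈ D, ∃ γ : ℝ → M, γ 0 = x ∧
    IsMIntegralCurveOn γ v (Ioo (-ε) ε)) ⟨1, one_pos, by simp⟩ ?_ ?_ ?_
  · rintro s t hst ⟨ε, hε, h⟩
    exact ⟨ε, hε, fun x hx ↦ h x (hst hx)⟩
  · rintro s t ⟨ε, hε, h⟩ ⟨ε', hε', h'⟩
    refine ⟨min ε ε', lt_min hε hε', ?_⟩
    rintro x (hx | hx)
    · obtain ⟨γ, h0, hγ⟩ := h x hx
      exact ⟨γ, h0, hγ.mono (Ioo_subset_Ioo (neg_le_neg (min_le_left _ _)) (min_le_left _ _))⟩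
    · obtain ⟨γ, h0, hγ⟩ := h' x hx
      exact ⟨γ, h0, hγ.mono (Ioo_subset_Ioo (neg_le_neg (min_le_right _ _)) (min_le_right _ _))⟩
  · intro x₀ _
    obtain ⟨c, -, hc⟩ := hv.exists_local_solutions x₀ 0
    rw [nhds_prod_eq, Filter.eventually_prod_iff] at hc
    obtain ⟨pa, hpa, pb, hpb, hab⟩ := hc
    obtain ⟨δ, hδ, hδs⟩ := Metric.eventually_nhds_iff_ball.1 hpa
    refine ⟨{x | pb x}, mem_nhdsWithin_of_mem_nhds hpb, δ / 2, by positivity, fun x hx ↦ ?_⟩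
    obtain ⟨h0, h1⟩ := hab (hδs (δ / 2) (by simp [abs_of_pos hδ, hδ])) hx
    have h2 := h1.comp_mul (δ / 2)⁻¹
    have hδ2 : (0 : ℝ) < δ / 2 := by positivity
    rw [smul_smul, inv_mul_cancel₀ hδ2.ne', one_smul] at h2
    refine ⟨_, ?_, h2.mono ?_⟩
    · simpa using h0
    · intro t ht
      rw [mem_ofPred_eq, ← div_eq_mul_inv, mem_Ioo, lt_div_iff₀ hδ2, div_lt_iff₀ hδ2]
      simpa using ht

/-- A smooth vector field whose integral curves exist for all times has a smooth flow. -/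
theorem IsSmoothField.exists_flow [T2Space M] {v : ∀ x : M, TangentSpace I x}
    (hv : IsSmoothField I v) (hc : ∀ x, ∃ γ : ℝ → M, γ 0 = x ∧ IsMIntegralCurve γ v) :
    ∃ φ : ℝ → M → M, ContMDiff (𝓘(ℝ, ℝ).prod I) I ∞ (fun p : ℝ × M ↦ φ p.1 p.2) ∧
      (∀ x, φ 0 x = x) ∧ (∀ x, IsMIntegralCurve (fun t ↦ φ t x) v) ∧
      ∀ s t x, φ (s + t) x = φ s (φ t x) := by
  have : IsManifold I 1 M := .of_le (n := ∞) (by simp)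
  have hv1 : ContMDiff I I.tangent 1 (fun x ↦ (⟨x, v x⟩ : TangentBundle I M)) := hv.of_le (by simp)
  choose γ hγ0 hγ using hc
  have hgroup : ∀ s t x, γ x (s + t) = γ (γ x t) s := by
    intro s t x
    have := isMIntegralCurve_Ioo_eq_of_contMDiff_boundaryless (t₀ := 0) hv1
      ((hγ x).comp_add t) (hγ (γ x t)) (by simp [hγ0])
    exact congrFun this s
  have hlocal : ∀ (n : ℕ) (x₀ : M), ContMDiffAt (𝓘(ℝ, ℝ).prod I) I n
      (fun p : ℝ × M ↦ γ p.2 p.1) (0, x₀) := by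
    intro n x₀
    obtain ⟨c, hcs, hc⟩ := hv.exists_local_solutions x₀ n
    have ht : Filter.Tendsto (fun p : ℝ × M ↦ (2 * p.1, p.2)) (𝓝 (0, x₀)) (𝓝 (0, x₀)) := by
      have : Continuous (fun p : ℝ × M ↦ (2 * p.1, p.2)) := by fun_prop
      simpa using this.tendsto (0, x₀)
    have h1 : ContMDiffAt (𝓘(ℝ, ℝ).prod I) I n
        (fun p : ℝ × M ↦ c 2⁻¹ (2 * p.1, p.2)) (0, x₀) := by
      refine ContMDiffAt.comp (g := c 2⁻¹) ((0 : ℝ), x₀) (I' := 𝓘(ℝ, ℝ).prod I)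
        (f := fun p : ℝ × M ↦ (2 * p.1, p.2)) ?_ ?_
      · simpa using hcs 2⁻¹ (by norm_num)
      · exact (contMDiffAt_const.mul contMDiffAt_fst).prodMk contMDiffAt_snd
    refine h1.congr_of_eventuallyEq ?_
    filter_upwards [ht.eventually hc] with p hp
    have hvs : ContMDiff I I.tangent 1 (fun x ↦ (⟨x, ((2 * p.1) • v) x⟩ : TangentBundle I M)) :=
      (hv.const_smul (2 * p.1)).of_le (by simp)
    have h2 := isMIntegralCurveOn_Ioo_eqOn_of_contMDiff_boundaryless (t₀ := 0) (a := -1) (b := 1)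
      (by norm_num) hvs (((hγ p.2).comp_mul (2 * p.1)).isMIntegralCurveOn _) hp.2
      (by simp [hγ0, hp.1])
    have h3 := h2 (x := 2⁻¹) (by norm_num)
    simp only [Function.comp_apply] at h3
    rw [← h3]
    congr 1
    ring
  refine ⟨fun t x ↦ γ x t, ?_, hγ0, hγ, hgroup⟩
  suffices H : ∀ (n : ℕ) (x : M) (t : ℝ), ContMDiffAt (𝓘(ℝ, ℝ).prod I) I n
      (fun p : ℝ × M ↦ γ p.2 p.1) (t, x) by
    intro p
    exact contMDiffAt_infty.2 fun n ↦ H n p.2 p.1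
  intro n x
  have hkey : ∀ t₁ : ℝ, ∀ᶠ s in 𝓝 t₁, ∀ᶠ t in 𝓝 t₁,
      ContMDiffAt (𝓘(ℝ, ℝ).prod I) I n (fun p : ℝ × M ↦ γ p.2 p.1) (s, x) →
      ContMDiffAt (𝓘(ℝ, ℝ).prod I) I n (fun p : ℝ × M ↦ γ p.2 p.1) (t, x) := by
    intro t₁
    have h1 : ∀ᶠ q in 𝓝 ((0 : ℝ), γ x t₁), ContMDiffAt (𝓘(ℝ, ℝ).prod I) I n
      (fun p : ℝ × M ↦ γ p.2 p.1) q := (contMDiffAt_iff_contMDiffAt_nhds (by simp)).1 (hlocal n (γ x t₁))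
    have h2 : Filter.Tendsto (fun q : ℝ × ℝ ↦ (q.2 - q.1, γ x q.1)) (𝓝 (t₁, t₁))
        (𝓝 (0, γ x t₁)) := by
      have : Continuous (fun q : ℝ × ℝ ↦ (q.2 - q.1, γ x q.1)) := by
        have := (hγ x).continuous
        fun_prop
      simpa using this.tendsto (t₁, t₁)
    have h3 := h2.eventually h1
    rw [nhds_prod_eq] at h3
    refine h3.curry.mono fun s hs ↦ hs.mono fun t ht hsx ↦ ?_
    have h4 : (fun p : ℝ × M ↦ γ p.2 p.1) =
        (fun p : ℝ × M ↦ γ p.2 p.1) ∘ fun p ↦ (p.1 - s, γ p.2 s) := by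
      ext p
      simp [← hgroup]
    rw [h4]
    refine ContMDiffAt.comp (t, x) (I' := 𝓘(ℝ, ℝ).prod I) ht ?_
    refine (contMDiffAt_fst.sub contMDiffAt_const).prodMk ?_
    exact ContMDiffAt.comp (t, x) (I' := 𝓘(ℝ, ℝ).prod I)
      (f := fun p : ℝ × M ↦ (s, p.2)) (g := fun p : ℝ × M ↦ γ p.2 p.1) hsx
      (contMDiffAt_const.prodMk contMDiffAt_snd)
  set T := {t | ContMDiffAt (𝓘(ℝ, ℝ).prod I) I n (fun p : ℝ × M ↦ γ p.2 p.1) (t, x)} with hT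
  have hmem : ∀ t₁ : ℝ, (t₁ ∈ T → T ∈ 𝓝 t₁) ∧ (t₁ ∉ T → Tᶜ ∈ 𝓝 t₁) := by
    intro t₁
    refine ⟨fun h ↦ ?_, fun h ↦ ?_⟩
    · exact (hkey t₁).self_of_nhds.mono fun t ht ↦ ht h
    · exact (hkey t₁).mono fun s hs hsT ↦ h (hs.self_of_nhds hsT)
  have hclopen : IsClopen T := by
    refine ⟨⟨isOpen_iff_mem_nhds.2 fun t ht ↦ (hmem t).2 ht⟩,
      isOpen_iff_mem_nhds.2 fun t ht ↦ (hmem t).1 ht⟩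
  intro t
  have : T = univ := hclopen.eq_univ ⟨0, hlocal n x⟩
  have : t ∈ T := this ▸ mem_univ t
  exact this

end Flow


/-! ### Smooth one-forms in charts and the exterior derivative of a pullback -/

section SmoothForms

variable {E : Type*} [NormedAddCommGroup E] [NormedSpace ℝ E]
  {H : Type*} [TopologicalSpace H] (J : ModelWithCorners ℝ E H)
  {U : Type*} [TopologicalSpace U] [ChartedSpace H U]
  {P : Type*} [NormedAddCommGroup P] [NormedSpace ℝ P]
  {Q : Type*} [NormedAddCommGroup Q] [NormedSpace ℝ Q]

/-- A one-form all of whose chart representations are smooth. -/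
def OneForm.IsSmoothInCharts (α : OneForm J U) : Prop :=
  ∀ x : U, ContDiffOn ℝ ∞ (α.inChart J x) (extChartAt J x).target

/-- The pullback of a one-form by a map from a normed space. -/
def OneForm.pull (α : OneForm J U) (u : P → U) (p : P) : P →L[ℝ] ℝ :=
  (α (u p)).comp (mfderiv 𝓘(ℝ, P) J u p)

variable {J} {α : OneForm J U}

theorem OneForm.pull_apply (u : P → U) (p v : P) :
    α.pull J u p v = α (u p) (mfderiv 𝓘(ℝ, P) J u p v) := rfl

theorem OneForm.pull_congr {u u' : P → U} {p : P} (h : u =ᶠ[𝓝 p] u') :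
    α.pull J u p = α.pull J u' p := by
  rw [OneForm.pull, OneForm.pull, h.mfderiv_eq, h.self_of_nhds]

theorem OneForm.pull_comp {u : P → U} {τ : Q → P} {q : Q}
    (hu : MDifferentiableAt 𝓘(ℝ, P) J u (τ q)) (hτ : DifferentiableAt ℝ τ q) :
    α.pull J (u ∘ τ) q = (α.pull J u (τ q)).comp (fderiv ℝ τ q) := by
  rw [OneForm.pull, mfderiv_comp q hu hτ.mdifferentiableAt, mfderiv_eq_fderiv]
  rfl

variable [IsManifold J ∞ U] [J.Boundaryless]

theorem contDiffAt_extChartAt_comp {u : P → U} {p₀ : P} {n : WithTop ℕ∞} (hn : n ≤ ∞)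
    (hu : ContMDiffAt 𝓘(ℝ, P) J n u p₀)
    {x₀ : U} (hx : u p₀ ∈ (extChartAt J x₀).source) :
    ContDiffAt ℝ n (fun p ↦ extChartAt J x₀ (u p)) p₀ := by
  have : IsManifold J n U := .of_le hn
  refine contMDiffAt_iff_contDiffAt.1 ?_
  rw [extChartAt_source] at hx
  exact (contMDiffAt_extChartAt' hx).comp p₀ hu

theorem OneForm.pull_eq_inChart {u : P → U} {p : P}
    (hu : ContMDiffAt 𝓘(ℝ, P) J 1 u p) {x₀ : U} (hx : u p ∈ (extChartAt J x₀).source) :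
    α.pull J u p = (α.inChart J x₀ (extChartAt J x₀ (u p))).comp
      (fderiv ℝ (fun p ↦ extChartAt J x₀ (u p)) p) := by
  have h1 : DifferentiableAt ℝ (fun p ↦ extChartAt J x₀ (u p)) p :=
    (contDiffAt_extChartAt_comp (by simp) hu hx).differentiableAt (by simp)
  have hmem := (extChartAt J x₀).map_source hx
  have h2 := OneForm.pull_comp (α := α) (u := (extChartAt J x₀).symm)
    (τ := fun p ↦ extChartAt J x₀ (u p)) (q := p)
    ((contMDiffAt_extChartAt_symm hmem).mdifferentiableAt (by simp)) h1
  refine Eq.trans (OneForm.pull_congr ?_) h2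
  filter_upwards [hu.continuousAt.preimage_mem_nhds
    ((isOpen_extChartAt_source (I := J) x₀).mem_nhds hx)] with q hq
  exact ((extChartAt J x₀).left_inv hq).symm

theorem OneForm.eventually_pull_eq_inChart {u : P → U} {p₀ : P}
    (hu : ContMDiffAt 𝓘(ℝ, P) J ∞ u p₀) {x₀ : U} (hx : u p₀ ∈ (extChartAt J x₀).source) :
    ∀ᶠ p in 𝓝 p₀, α.pull J u p = (α.inChart J x₀ (extChartAt J x₀ (u p))).comp
      (fderiv ℝ (fun p ↦ extChartAt J x₀ (u p)) p) := by
  have : IsManifold J 1 U := .of_le (n := ∞) (by simp)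
  filter_upwards [(contMDiffAt_iff_contMDiffAt_nhds (n := 1) (by simp)).1 (hu.of_le (by simp)),
    hu.continuousAt.preimage_mem_nhds
      ((isOpen_extChartAt_source (I := J) x₀).mem_nhds hx)] with p hp hp'
  exact OneForm.pull_eq_inChart hp hp'

theorem OneForm.IsSmoothInCharts.contDiffAt_inChart (hα : α.IsSmoothInCharts J) {x₀ : U} {y : E}
    (hy : y ∈ (extChartAt J x₀).target) : ContDiffAt ℝ ∞ (α.inChart J x₀) y :=
  (hα x₀).contDiffAt ((isOpen_extChartAt_target x₀).mem_nhds hy)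

theorem OneForm.IsSmoothInCharts.contDiffAt_pull (hα : α.IsSmoothInCharts J) {u : P → U} {p₀ : P}
    (hu : ContMDiffAt 𝓘(ℝ, P) J ∞ u p₀) : ContDiffAt ℝ ∞ (α.pull J u) p₀ := by
  have hx : u p₀ ∈ (extChartAt J (u p₀)).source := mem_extChartAt_source _
  refine ContDiffAt.congr_of_eventuallyEq ?_ (OneForm.eventually_pull_eq_inChart hu hx)
  have h1 := contDiffAt_extChartAt_comp le_rfl hu hx
  exact ((hα.contDiffAt_inChart ((extChartAt J (u p₀)).map_source hx)).comp p₀ h1).clm_comp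
    (h1.fderiv_right (m := ∞) (by simp))

theorem mfderiv_eq_fderiv_extChartAt_comp {u : P → U} {p : P}
    (hu : MDifferentiableAt 𝓘(ℝ, P) J u p) :
    (mfderiv 𝓘(ℝ, P) J u p : P →L[ℝ] E) = fderiv ℝ (fun q ↦ extChartAt J (u p) (u q)) p := by
  refine hu.mfderiv.trans ?_
  rw [modelWithCornersSelf_coe, range_id, fderivWithin_univ]
  rfl

/-- The exterior derivative commutes with pullbacks. -/
theorem OneForm.IsSmoothInCharts.fderiv_pull_sub (hα : α.IsSmoothInCharts J) {u : P → U} {p₀ : P}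
    (hu : ContMDiffAt 𝓘(ℝ, P) J ∞ u p₀) (v w : P) :
    fderiv ℝ (α.pull J u) p₀ v w - fderiv ℝ (α.pull J u) p₀ w v =
      α.d J (u p₀) (mfderiv 𝓘(ℝ, P) J u p₀ v) (mfderiv 𝓘(ℝ, P) J u p₀ w) := by
  have hx : u p₀ ∈ (extChartAt J (u p₀)).source := mem_extChartAt_source _
  set ũ := fun p ↦ extChartAt J (u p₀) (u p) with hũ
  have h1 : ContDiffAt ℝ ∞ ũ p₀ := contDiffAt_extChartAt_comp le_rfl hu hx
  have hd : (mfderiv 𝓘(ℝ, P) J u p₀ : P →L[ℝ] E) = fderiv ℝ ũ p₀ :=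
    mfderiv_eq_fderiv_extChartAt_comp (hu.mdifferentiableAt (by simp))
  have ha : HasFDerivAt (α.inChart J (u p₀)) (fderiv ℝ (α.inChart J (u p₀)) (ũ p₀)) (ũ p₀) :=
    ((hα.contDiffAt_inChart ((extChartAt J (u p₀)).map_source hx)).differentiableAt
      (by simp)).hasFDerivAt
  have hu1 : HasFDerivAt ũ (fderiv ℝ ũ p₀) p₀ := (h1.differentiableAt (by simp)).hasFDerivAt
  have hu2 : HasFDerivAt (fderiv ℝ ũ) (fderiv ℝ (fderiv ℝ ũ) p₀) p₀ :=
    ((h1.fderiv_right (m := ∞) (by simp)).differentiableAt (by simp)).hasFDerivAt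
  have hsymm : IsSymmSndFDerivAt ℝ ũ p₀ := h1.isSymmSndFDerivAt
    (by simpa using (by norm_cast : (2 : WithTop ℕ∞) ≤ ∞))
  have h3 := ((ha.comp p₀ hu1).clm_comp hu2).congr_of_eventuallyEq
    (OneForm.eventually_pull_eq_inChart (α := α) hu hx)
  have h4 : ∀ v w : P, fderiv ℝ (α.pull J u) p₀ v w =
      fderiv ℝ (α.inChart J (u p₀)) (ũ p₀) (fderiv ℝ ũ p₀ v) (fderiv ℝ ũ p₀ w) +
        α.inChart J (u p₀) (ũ p₀) (fderiv ℝ (fderiv ℝ ũ) p₀ v w) := by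
    intro v w
    rw [h3.fderiv]
    simp [add_comm]
  rw [h4, h4, hsymm v w, add_sub_add_right_eq_sub]
  have hd' : ∀ v, (mfderiv 𝓘(ℝ, P) J u p₀ v : E) = fderiv ℝ ũ p₀ v := fun v ↦ congrArg (· v) hd
  rw [OneForm.d]
  exact (congrArg₂ (fun a b : E ↦ fderiv ℝ (α.inChart J (u p₀)) (ũ p₀) a b -
    fderiv ℝ (α.inChart J (u p₀)) (ũ p₀) b a) (hd' v) (hd' w)).symm

theorem OneForm.IsSmoothInCharts.d_mfderiv_extChartAt_symm (hα : α.IsSmoothInCharts J) {x₀ : U}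
    {y : E} (hy : y ∈ (extChartAt J x₀).target) (v w : E) :
    α.d J ((extChartAt J x₀).symm y) (mfderiv 𝓘(ℝ, E) J (extChartAt J x₀).symm y v)
      (mfderiv 𝓘(ℝ, E) J (extChartAt J x₀).symm y w) =
    fderiv ℝ (α.inChart J x₀) y v w - fderiv ℝ (α.inChart J x₀) y w v :=
  (hα.fderiv_pull_sub (contMDiffAt_extChartAt_symm hy) v w).symm

end SmoothForms

/-! ### Smooth vector fields in charts -/

section Fields

variable {E : Type*} [NormedAddCommGroup E] [NormedSpace ℝ E]
  {H : Type*} [TopologicalSpace H] {J : ModelWithCorners ℝ E H}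
  {U : Type*} [TopologicalSpace U] [ChartedSpace H U] [IsManifold J ∞ U] [J.Boundaryless]

theorem fieldInChart_extChartAt (X : ∀ x : U, TangentSpace J x) {x₀ x : U}
    (hx : x ∈ (extChartAt J x₀).source) :
    fieldInChart J X x₀ (extChartAt J x₀ x) = mfderiv J 𝓘(ℝ, E) (extChartAt J x₀) x (X x) := by
  have : IsManifold J 1 U := .of_le (n := ∞) (by simp)
  have hy := (extChartAt J x₀).map_source hx
  have h1 := mfderiv_extChartAt_symm_fieldInChart X hy
  have h2 := mfderiv_extChartAt_comp_mfderivWithin_extChartAt_symm (I := J) hy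
  rw [J.range_eq_univ, mfderivWithin_univ] at h2
  have h3 := congrArg (fun L : E →L[ℝ] E ↦ L (fieldInChart J X x₀ (extChartAt J x₀ x))) h2
  have h4 : (extChartAt J x₀).symm (extChartAt J x₀ x) = x := (extChartAt J x₀).left_inv hx
  refine h3.symm.trans ?_
  change mfderiv J 𝓘(ℝ, E) (extChartAt J x₀) ((extChartAt J x₀).symm (extChartAt J x₀ x))
    (mfderiv 𝓘(ℝ, E) J (extChartAt J x₀).symm (extChartAt J x₀ x)
      (fieldInChart (E := E) J X x₀ (extChartAt J x₀ x))) = _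
  rw [h1, h4]

/-- A time-dependent vector field is smooth if its chart representations are smooth. -/
theorem contMDiff_field_of_inChart {X : ℝ → ∀ x : U, TangentSpace J x}
    (hX : ∀ x₀ : U, ContDiffOn ℝ ∞ (fun q : ℝ × E ↦ fieldInChart J (X q.1) x₀ q.2)
      (univ ×ˢ (extChartAt J x₀).target)) :
    ContMDiff (𝓘(ℝ, ℝ).prod J) J.tangent ∞
      (fun p : ℝ × U ↦ (⟨p.2, X p.1 p.2⟩ : TangentBundle J U)) := by
  intro p₀
  rw [Bundle.contMDiffAt_totalSpace]
  refine ⟨contMDiffAt_snd, ?_⟩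
  set χ : ℝ × U → ℝ × E := fun p ↦ (p.1, extChartAt J p₀.2 p.2) with hχ
  have hχs : ContMDiffAt (𝓘(ℝ, ℝ).prod J) 𝓘(ℝ, ℝ × E) ∞ χ p₀ := by
    rw [modelWithCornersSelf_prod, ← chartedSpaceSelf_prod]
    exact contMDiffAt_fst.prodMk ((contMDiffAt_extChartAt (n := ∞)).comp p₀ contMDiffAt_snd)
  have h1 : ContDiffAt ℝ ∞ (fun q : ℝ × E ↦ fieldInChart J (X q.1) p₀.2 q.2) (χ p₀) :=
    (hX p₀.2).contDiffAt ((isOpen_univ.prod (isOpen_extChartAt_target p₀.2)).mem_nhds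
      ⟨mem_univ _, mem_extChartAt_target p₀.2⟩)
  refine (ContMDiffAt.comp p₀ h1.contMDiffAt hχs).congr_of_eventuallyEq ?_
  filter_upwards [continuous_snd.continuousAt.preimage_mem_nhds
    (extChartAt_source_mem_nhds (I := J) p₀.2)] with p hp
  have h2 := TangentBundle.continuousLinearMapAt_trivializationAt (I := J) (x₀ := p₀.2) (x := p.2)
    (by rw [← extChartAt_source J]; exact hp)
  have h3 := fieldInChart_extChartAt (X p.1) hp
  refine Eq.trans ?_ h3.symm
  rw [← h2]
  exact (Bundle.Trivialization.continuousLinearMapAt_apply_of_mem (R := ℝ)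
    (trivializationAt E (TangentSpace J) p₀.2) (b := p.2) (by
      rw [TangentBundle.trivializationAt_baseSet, ← extChartAt_source J]; exact hp) (X p.1 p.2)).symm

theorem isSmoothField_of_inChart {X : ∀ x : U, TangentSpace J x}
    (hX : ∀ x₀ : U, ContDiffOn ℝ ∞ (fieldInChart J X x₀) (extChartAt J x₀).target) :
    IsSmoothField J X := by
  have := contMDiff_field_of_inChart (X := fun _ ↦ X) fun x₀ ↦
    (hX x₀).comp contDiffOn_snd (fun p hp ↦ hp.2)
  exact this.comp (contMDiff_const (c := (0 : ℝ)).prodMk contMDiff_id)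

theorem isSmoothField_suspension {X : ℝ → ∀ x : U, TangentSpace J x}
    (hX : ContMDiff (𝓘(ℝ, ℝ).prod J) J.tangent ∞
      (fun p : ℝ × U ↦ (⟨p.2, X p.1 p.2⟩ : TangentBundle J U))) :
    IsSmoothField (𝓘(ℝ, ℝ).prod J) (M := ℝ × U) (fun p ↦ ((1 : ℝ), (X p.1 p.2 : E))) := by
  have h1 : ContMDiff 𝓘(ℝ, ℝ) 𝓘(ℝ, ℝ).tangent ∞
      (fun t : ℝ ↦ (⟨t, (1 : ℝ)⟩ : TangentBundle 𝓘(ℝ, ℝ) ℝ)) := by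
    intro t
    exact contMDiffAt_vectorSpace_iff_contDiffAt.2 (contDiffAt_const (c := (1 : ℝ)))
  exact (contMDiff_equivTangentBundleProd_symm (I := 𝓘(ℝ, ℝ)) (I' := J) (M := ℝ) (M' := U)).comp
    ((h1.comp contMDiff_fst).prodMk hX)

end Fields


/-! ### Linear equations for vector fields defined by a one-form and its exterior derivative -/

section Flat

variable {E : Type*} [NormedAddCommGroup E] [NormedSpace ℝ E]

/-- The bilinear form `(v, w) ↦ D v w - D w v + c * ℓ v * ℓ w`, as an operator. -/
def flatOperator (c : ℝ) (D : E →L[ℝ] E →L[ℝ] ℝ) (ℓ : E →L[ℝ] ℝ) : E →L[ℝ] E →L[ℝ] ℝ :=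
  D - D.flip + c • ℓ.smulRight ℓ

theorem flatOperator_apply (c : ℝ) (D : E →L[ℝ] E →L[ℝ] ℝ) (ℓ : E →L[ℝ] ℝ) (v w : E) :
    flatOperator c D ℓ v w = D v w - D w v + c * (ℓ v * ℓ w) := by
  simp [flatOperator]

theorem contDiff_flip : ContDiff ℝ ∞ (fun L : E →L[ℝ] E →L[ℝ] ℝ ↦ L.flip) :=
  IsBoundedLinearMap.contDiff ⟨⟨fun _ _ ↦ rfl, fun _ _ ↦ rfl⟩, 1, one_pos, fun L ↦ by
    rw [one_mul, ContinuousLinearMap.opNorm_flip]⟩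

theorem isInvertible_of_injective [FiniteDimensional ℝ E] (A : E →L[ℝ] E →L[ℝ] ℝ)
    (hA : Function.Injective A) : A.IsInvertible := by
  have hdim : Module.finrank ℝ E = Module.finrank ℝ (E →L[ℝ] ℝ) := by
    rw [← (LinearMap.toContinuousLinearMap (𝕜 := ℝ) (E := E) (F' := ℝ)).finrank_eq]
    exact Subspace.dual_finrank_eq.symm
  exact ⟨((A : E →ₗ[ℝ] E →L[ℝ] ℝ).linearEquivOfInjective hA hdim).toContinuousLinearEquiv, by
    ext v w; rfl⟩

variable {H : Type*} [TopologicalSpace H] (J : ModelWithCorners ℝ E H)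
  {U : Type*} [TopologicalSpace U] [ChartedSpace H U]

/-- The bilinear form `dα + c α ⊗ α`. -/
def OneForm.flat (α : OneForm J U) (c : ℝ) (x : U) (v w : TangentSpace J x) : ℝ :=
  α.d J x v w + c * (α x v * α x w)

/-- The bilinear form `dα + c α ⊗ α` is nondegenerate. -/
def OneForm.IsNondegenerate (α : OneForm J U) (c : ℝ) : Prop :=
  ∀ (x : U) (v : TangentSpace J x), (∀ w, α.flat J c x v w = 0) → v = 0

variable {J} {α : OneForm J U} {c : ℝ}

theorem OneForm.d_swap (x : U) (v w : TangentSpace J x) : α.d J x v w = - α.d J x w v := by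
  rw [OneForm.d, OneForm.d, neg_sub]

theorem OneForm.d_self (x : U) (v : TangentSpace J x) : α.d J x v v = 0 := sub_self _

theorem OneForm.flat_eq_flatOperator (x : U) (v w : E) :
    α.flat J c x v w =
      flatOperator c (fderiv ℝ (α.inChart J x) (extChartAt J x x)) (α x : E →L[ℝ] ℝ) v w :=
  (flatOperator_apply _ _ _ _ _).symm

theorem OneForm.IsNondegenerate.exists_flat_eq [FiniteDimensional ℝ E]
    (h : α.IsNondegenerate J c) (x : U) (β : TangentSpace J x →L[ℝ] ℝ) :
    ∃ v, ∀ w, α.flat J c x v w = β w := by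
  set A := flatOperator c (fderiv ℝ (α.inChart J x) (extChartAt J x x)) (α x : E →L[ℝ] ℝ) with hA
  have hinj : Function.Injective A := by
    refine (injective_iff_map_eq_zero A).2 fun v hv ↦ h x v fun w ↦ ?_
    exact (OneForm.flat_eq_flatOperator x v w).trans (congrArg (fun L : E →L[ℝ] ℝ ↦ L w) hv)
  obtain ⟨v, hv⟩ := (isInvertible_of_injective A hinj).bijective.2 (β : E →L[ℝ] ℝ)
  exact ⟨v, fun w ↦ (OneForm.flat_eq_flatOperator x v w).trans
    (congrArg (fun L : E →L[ℝ] ℝ ↦ L w) hv)⟩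

variable [IsManifold J ∞ U] [J.Boundaryless]

theorem OneForm.IsSmoothInCharts.flatOperator_inChart (hα : α.IsSmoothInCharts J) {x₀ : U} {y : E}
    (hy : y ∈ (extChartAt J x₀).target) (v w : E) :
    flatOperator c (fderiv ℝ (α.inChart J x₀) y) (α.inChart J x₀ y) v w =
      α.flat J c ((extChartAt J x₀).symm y) (mfderiv 𝓘(ℝ, E) J (extChartAt J x₀).symm y v)
        (mfderiv 𝓘(ℝ, E) J (extChartAt J x₀).symm y w) := by
  rw [flatOperator_apply, ← hα.d_mfderiv_extChartAt_symm hy]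
  rfl

variable [FiniteDimensional ℝ E]

theorem OneForm.IsSmoothInCharts.contDiffOn_of_flat_eq (hα : α.IsSmoothInCharts J)
    (h : α.IsNondegenerate J c) {X : ℝ → ∀ x : U, TangentSpace J x} {β : ℝ → OneForm J U}
    (hX : ∀ t x w, α.flat J c x (X t x) w = β t x w) {x₀ : U}
    (hβ : ContDiffOn ℝ ∞ (fun q : ℝ × E ↦ (β q.1).inChart J x₀ q.2)
      (univ ×ˢ (extChartAt J x₀).target)) :
    ContDiffOn ℝ ∞ (fun q : ℝ × E ↦ fieldInChart J (X q.1) x₀ q.2)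
      (univ ×ˢ (extChartAt J x₀).target) := by
  have : CompleteSpace E := FiniteDimensional.complete ℝ E
  set A : E → E →L[ℝ] E →L[ℝ] ℝ := fun y ↦
    flatOperator c (fderiv ℝ (α.inChart J x₀) y) (α.inChart J x₀ y) with hA
  have hinv : ∀ y ∈ (extChartAt J x₀).target, (A y).IsInvertible := by
    intro y hy
    refine isInvertible_of_injective _ ((injective_iff_map_eq_zero _).2 fun v hv ↦ ?_)
    have hb := (mfderiv_extChartAt_symm_isInvertible hy).bijective
    refine hb.1 (Eq.trans (h _ _ fun w ↦ ?_) (map_zero _).symm)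
    obtain ⟨w, rfl⟩ := hb.2 w
    exact (hα.flatOperator_inChart hy v w).symm.trans (congrArg (fun L : E →L[ℝ] ℝ ↦ L w) hv)
  have hAs : ∀ y ∈ (extChartAt J x₀).target, ContDiffAt ℝ ∞ A y := by
    intro y hy
    have h1 := hα.contDiffAt_inChart hy
    have h2 : ContDiffAt ℝ ∞ (fderiv ℝ (α.inChart J x₀)) y := h1.fderiv_right (by simp)
    have h3 : ContDiffAt ℝ ∞ (fun y ↦ (fderiv ℝ (α.inChart J x₀) y).flip) y :=
      ContDiffAt.comp (g := fun L : E →L[ℝ] E →L[ℝ] ℝ ↦ L.flip) y contDiff_flip.contDiffAt h2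
    exact (h2.sub h3).add ((h1.smulRight h1).const_smul c)
  have hsol : ∀ (t : ℝ), ∀ y ∈ (extChartAt J x₀).target,
      fieldInChart J (X t) x₀ y = (A y).inverse ((β t).inChart J x₀ y) := by
    intro t y hy
    refine ((hinv y hy).inverse_apply_eq.2 ?_).symm
    ext w
    have h1 := mfderiv_extChartAt_symm_fieldInChart (X t) hy
    refine Eq.trans ?_ (hα.flatOperator_inChart hy _ w).symm
    rw [h1, hX]
    rfl
  intro q hq
  have h1 : ContDiffAt ℝ ∞ (fun q : ℝ × E ↦ A q.2) q := (hAs q.2 hq.2).comp q contDiffAt_snd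
  have h2 : ContDiffAt ℝ ∞ (fun q : ℝ × E ↦ (A q.2).inverse) q :=
    ContDiffAt.comp (g := ContinuousLinearMap.inverse) q (hinv q.2 hq.2).contDiffAt_map_inverse h1
  have h3 := h2.contDiffWithinAt.clm_apply (hβ q hq)
  exact h3.congr (fun p hp ↦ hsol p.1 p.2 hp.2) (hsol q.1 q.2 hq.2)

end Flat

/-! ### Hamiltonian vector fields of a contact form -/

section Hamiltonian

variable {E : Type*} [NormedAddCommGroup E] [NormedSpace ℝ E]
  {H : Type*} [TopologicalSpace H] (J : ModelWithCorners ℝ E H)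
  {U : Type*} [TopologicalSpace U] [ChartedSpace H U]

/-- `α` is a contact form with Reeb field `R`. -/
structure IsContactForm (α : OneForm J U) (R : ∀ x : U, TangentSpace J x) : Prop where
  smooth : α.IsSmoothInCharts J
  apply_reeb : ∀ x, α x (R x) = 1
  d_reeb : ∀ x w, α.d J x (R x) w = 0
  nondegenerate : ∀ (x : U) (v : TangentSpace J x), α x v = 0 → (∀ w, α.d J x v w = 0) → v = 0

/-- The differential of a function, as a one-form. -/
def differential (k : U → ℝ) : OneForm J U := fun x ↦
  (mfderiv J 𝓘(ℝ, ℝ) k x : TangentSpace J x →L[ℝ] TangentSpace 𝓘(ℝ, ℝ) (k x))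

/-- `v` is the value at `x` of the contact Hamiltonian vector field of `k`. -/
def IsHamiltonianAt (α : OneForm J U) (R : ∀ x : U, TangentSpace J x) (k : U → ℝ) (x : U)
    (v : TangentSpace J x) : Prop :=
  α x v = k x ∧ ∀ w, α.d J x v w + differential J k x w = differential J k x (R x) * α x w

variable {J} {α : OneForm J U} {R : ∀ x : U, TangentSpace J x}

theorem differential_inChart [IsManifold J ∞ U] [J.Boundaryless] {k : U → ℝ} {x₀ : U} {y : E}
    (hy : y ∈ (extChartAt J x₀).target)
    (hk : MDifferentiableAt J 𝓘(ℝ, ℝ) k ((extChartAt J x₀).symm y)) :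
    (differential J k).inChart J x₀ y = fderiv ℝ (k ∘ (extChartAt J x₀).symm) y := by
  rw [← mfderiv_eq_fderiv, mfderiv_comp y hk
    ((contMDiffAt_extChartAt_symm hy).mdifferentiableAt (by simp))]
  rfl

theorem differential_congr {k k' : U → ℝ} {x : U} (h : k =ᶠ[𝓝 x] k') :
    differential J k x = differential J k' x := h.mfderiv_eq

theorem IsHamiltonianAt.congr {k k' : U → ℝ} {x : U} {v : TangentSpace J x}
    (hv : IsHamiltonianAt J α R k x v) (h : k =ᶠ[𝓝 x] k') : IsHamiltonianAt J α R k' x v := by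
  rw [IsHamiltonianAt, ← differential_congr h, ← h.self_of_nhds]
  exact hv

theorem IsContactForm.d_reeb_right (h : IsContactForm J α R) (x : U) (w : TangentSpace J x) :
    α.d J x w (R x) = 0 := by
  rw [OneForm.d_swap, h.d_reeb, neg_zero]

theorem IsContactForm.isNondegenerate (h : IsContactForm J α R) : α.IsNondegenerate J 1 := by
  intro x v hv
  have h1 : α x v = 0 := by
    have := hv (R x)
    rwa [OneForm.flat, h.d_reeb_right, h.apply_reeb, zero_add, one_mul, mul_one] at this
  refine h.nondegenerate x v h1 fun w ↦ ?_
  have := hv w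
  rwa [OneForm.flat, h1, zero_mul, mul_zero, add_zero] at this

theorem IsContactForm.isHamiltonianAt_iff (h : IsContactForm J α R) {k : U → ℝ} {x : U}
    {v : TangentSpace J x} : IsHamiltonianAt J α R k x v ↔
      ∀ w, α.flat J 1 x v w =
        (differential J k x (R x) + k x) * α x w - differential J k x w := by
  constructor
  · rintro ⟨h1, h2⟩ w
    rw [OneForm.flat, h1]
    linear_combination h2 w
  · intro hv
    have h1 : α x v = k x := by
      have := hv (R x)
      rw [OneForm.flat, h.d_reeb_right, h.apply_reeb] at this
      linear_combination this
    refine ⟨h1, fun w ↦ ?_⟩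
    have := hv w
    rw [OneForm.flat, h1] at this
    linear_combination this

theorem OneForm.flat_sub (c : ℝ) (x : U) (v v' w : TangentSpace J x) :
    α.flat J c x (v - v') w = α.flat J c x v w - α.flat J c x v' w :=
  (OneForm.flat_eq_flatOperator (J := J) x (v - v') w).trans
    ((congrArg (fun L : E →L[ℝ] ℝ ↦ L w) (map_sub (flatOperator c
      (fderiv ℝ (α.inChart J x) (extChartAt J x x)) (α x : E →L[ℝ] ℝ)) (v : E) (v' : E))).trans
    (congrArg₂ (· - ·) (OneForm.flat_eq_flatOperator (J := J) x v w).symm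
      (OneForm.flat_eq_flatOperator (J := J) x v' w).symm))

theorem IsContactForm.isHamiltonianAt_unique (h : IsContactForm J α R) {k : U → ℝ} {x : U}
    {v v' : TangentSpace J x} (hv : IsHamiltonianAt J α R k x v)
    (hv' : IsHamiltonianAt J α R k x v') : v = v' := by
  rw [h.isHamiltonianAt_iff] at hv hv'
  refine sub_eq_zero.1 (h.isNondegenerate x _ fun w ↦ ?_)
  rw [OneForm.flat_sub, hv, hv', sub_self]

variable [IsManifold J ∞ U] [J.Boundaryless] [FiniteDimensional ℝ E]

theorem IsContactForm.contDiffOn_reeb (h : IsContactForm J α R) (x₀ : U) :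
    ContDiffOn ℝ ∞ (fieldInChart J R x₀) (extChartAt J x₀).target := by
  have := h.smooth.contDiffOn_of_flat_eq h.isNondegenerate (X := fun _ ↦ R) (β := fun _ ↦ α)
    (x₀ := x₀) (fun _ x w ↦ by rw [OneForm.flat, h.d_reeb, h.apply_reeb]; ring)
    ((h.smooth x₀).comp contDiffOn_snd fun q hq ↦ hq.2)
  exact ContDiffOn.comp (g := fun q : ℝ × E ↦ (fieldInChart J R x₀ q.2 : E))
    (f := fun y ↦ ((0 : ℝ), y)) this (contDiffOn_const.prodMk contDiffOn_id)
    fun y hy ↦ ⟨mem_univ _, hy⟩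

theorem contDiffOn_comp_extChartAt_symm {k : ℝ → U → ℝ}
    (hk : ContMDiff (𝓘(ℝ, ℝ).prod J) 𝓘(ℝ, ℝ) ∞ fun p : ℝ × U ↦ k p.1 p.2) (x₀ : U) :
    ContDiffOn ℝ ∞ (fun q : ℝ × E ↦ k q.1 ((extChartAt J x₀).symm q.2))
      (univ ×ˢ (extChartAt J x₀).target) := by
  rw [← contMDiffOn_iff_contDiffOn, modelWithCornersSelf_prod, ← chartedSpaceSelf_prod]
  exact hk.comp_contMDiffOn (contMDiffOn_fst.prodMk ((contMDiffOn_extChartAt_symm x₀).comp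
    contMDiffOn_snd fun q hq ↦ hq.2))

theorem contDiffOn_differential_inChart {k : ℝ → U → ℝ}
    (hk : ContMDiff (𝓘(ℝ, ℝ).prod J) 𝓘(ℝ, ℝ) ∞ fun p : ℝ × U ↦ k p.1 p.2) (x₀ : U) :
    ContDiffOn ℝ ∞ (fun q : ℝ × E ↦ (differential J (k q.1)).inChart J x₀ q.2)
      (univ ×ˢ (extChartAt J x₀).target) := by
  have ho : IsOpen ((univ : Set ℝ) ×ˢ (extChartAt J x₀).target) :=
    isOpen_univ.prod (isOpen_extChartAt_target x₀)
  have h1 := contDiffOn_comp_extChartAt_symm hk x₀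
  have h2 := ((h1.fderiv_of_isOpen ho (m := ∞) (by simp)).clm_comp
    (contDiffOn_const (c := ContinuousLinearMap.inr ℝ ℝ E)))
  refine h2.congr fun q hq ↦ ?_
  have hkq : ContMDiff J 𝓘(ℝ, ℝ) ∞ (k q.1) := hk.comp (contMDiff_const.prodMk contMDiff_id)
  rw [differential_inChart hq.2 (hkq.mdifferentiableAt (by simp))]
  have h3 : DifferentiableAt ℝ (fun q : ℝ × E ↦ k q.1 ((extChartAt J x₀).symm q.2)) (q.1, q.2) :=
    (h1.contDiffAt (ho.mem_nhds hq)).differentiableAt (by simp)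
  exact (h3.hasFDerivAt.comp q.2 (hasFDerivAt_prodMk_right q.1 q.2)).fderiv

theorem IsContactForm.contDiffOn_differential_reeb (h : IsContactForm J α R) {k : ℝ → U → ℝ}
    (hk : ContMDiff (𝓘(ℝ, ℝ).prod J) 𝓘(ℝ, ℝ) ∞ fun p : ℝ × U ↦ k p.1 p.2) (x₀ : U) :
    ContDiffOn ℝ ∞ (fun q : ℝ × E ↦ differential J (k q.1) ((extChartAt J x₀).symm q.2)
      (R ((extChartAt J x₀).symm q.2))) (univ ×ˢ (extChartAt J x₀).target) := by
  refine ((contDiffOn_differential_inChart hk x₀).clm_apply ((h.contDiffOn_reeb x₀).comp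
    contDiffOn_snd fun q hq ↦ hq.2)).congr fun q hq ↦ ?_
  rw [← mfderiv_extChartAt_symm_fieldInChart R hq.2]
  rfl

theorem IsContactForm.continuous_differential_reeb (h : IsContactForm J α R) {k : ℝ → U → ℝ}
    (hk : ContMDiff (𝓘(ℝ, ℝ).prod J) 𝓘(ℝ, ℝ) ∞ fun p : ℝ × U ↦ k p.1 p.2) :
    Continuous fun p : ℝ × U ↦ differential J (k p.1) p.2 (R p.2) := by
  rw [continuous_iff_continuousAt]
  intro p
  have ho : IsOpen ((univ : Set ℝ) ×ˢ (extChartAt J p.2).target) :=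
    isOpen_univ.prod (isOpen_extChartAt_target p.2)
  have h1 := (h.contDiffOn_differential_reeb hk p.2).continuousOn.continuousAt
    (x := (p.1, extChartAt J p.2 p.2)) (ho.mem_nhds ⟨mem_univ _, mem_extChartAt_target p.2⟩)
  have h2 : ContinuousAt (fun q : ℝ × U ↦ (q.1, extChartAt J p.2 q.2)) p :=
    continuousAt_fst.prodMk ((continuousAt_extChartAt (I := J) p.2).comp continuousAt_snd)
  refine (ContinuousAt.comp (x := p) h1 h2).congr ?_
  filter_upwards [continuous_snd.continuousAt.preimage_mem_nhds
    (extChartAt_source_mem_nhds (I := J) p.2)] with q hq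
  exact congrArg (fun x ↦ differential J (k q.1) x (R x)) ((extChartAt J p.2).left_inv hq)

/-- Every smooth time-dependent function has a smooth time-dependent Hamiltonian vector field. -/
theorem IsContactForm.exists_hamiltonianField (h : IsContactForm J α R) {k : ℝ → U → ℝ}
    (hk : ContMDiff (𝓘(ℝ, ℝ).prod J) 𝓘(ℝ, ℝ) ∞ fun p : ℝ × U ↦ k p.1 p.2) :
    ∃ X : ℝ → ∀ x : U, TangentSpace J x, (∀ t x, IsHamiltonianAt J α R (k t) x (X t x)) ∧
      ContMDiff (𝓘(ℝ, ℝ).prod J) J.tangent ∞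
        (fun p : ℝ × U ↦ (⟨p.2, X p.1 p.2⟩ : TangentBundle J U)) := by
  set β : ℝ → OneForm J U := fun t x ↦
    (differential J (k t) x (R x) + k t x) • α x - differential J (k t) x with hβ
  choose X hX using fun t x ↦ h.isNondegenerate.exists_flat_eq x (β t x)
  refine ⟨X, fun t x ↦ h.isHamiltonianAt_iff.2 fun w ↦ hX t x w,
    contMDiff_field_of_inChart fun x₀ ↦
      h.smooth.contDiffOn_of_flat_eq h.isNondegenerate hX ?_⟩
  have h1 : ContDiffOn ℝ ∞ (fun q : ℝ × E ↦ α.inChart J x₀ q.2)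
      (univ ×ˢ (extChartAt J x₀).target) := (h.smooth x₀).comp contDiffOn_snd fun q hq ↦ hq.2
  exact (((h.contDiffOn_differential_reeb hk x₀).add (contDiffOn_comp_extChartAt_symm hk x₀)).smul
    h1).sub (contDiffOn_differential_inChart hk x₀)

end Hamiltonian


/-! ### Hamiltonian flows preserve the contact structure -/

theorem eq_exp_mul_of_hasDerivAt {y m : ℝ → ℝ} {s : ℝ} (hs : 0 ≤ s)
    (hm : ContinuousOn m (Icc 0 s)) (hy : ∀ a ∈ Icc 0 s, HasDerivAt y (m a * y a) a) :
    y s = Real.exp (∫ a in (0 : ℝ)..s, m a) * y 0 := by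
  set m' : ℝ → ℝ := IccExtend hs ((Icc 0 s).restrict m) with hm'
  have hc : Continuous m' := (continuousOn_iff_continuous_restrict.1 hm).Icc_extend'
  have heq : ∀ a ∈ Icc 0 s, m' a = m a := fun a ha ↦ IccExtend_of_mem _ _ ha
  have hM : ∀ a, HasDerivAt (fun a ↦ ∫ r in (0 : ℝ)..a, m' r) (m' a) a := fun a ↦
    intervalIntegral.integral_hasDerivAt_right (hc.intervalIntegrable 0 a)
      (hc.stronglyMeasurableAtFilter _ _) hc.continuousAt
  set z : ℝ → ℝ := fun a ↦ Real.exp (-∫ r in (0 : ℝ)..a, m' r) * y a with hz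
  have hzd : ∀ a ∈ Icc 0 s, HasDerivAt z 0 a := by
    intro a ha
    convert! ((hM a).neg.exp).mul (hy a ha) using 1
    rw [heq a ha]
    ring
  have hconst := constant_of_has_deriv_right_zero (f := z) (a := 0) (b := s)
    (fun a ha ↦ (hzd a ha).continuousAt.continuousWithinAt)
    (fun a ha ↦ (hzd a ⟨ha.1, ha.2.le⟩).hasDerivWithinAt) s ⟨hs, le_rfl⟩
  have hint : ∫ r in (0 : ℝ)..s, m' r = ∫ r in (0 : ℝ)..s, m r :=
    intervalIntegral.integral_congr fun r hr ↦ heq r (by rwa [uIcc_of_le hs] at hr)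
  simp only [hz, intervalIntegral.integral_same, neg_zero, Real.exp_zero, one_mul] at hconst
  rw [← hint, ← hconst, ← mul_assoc, ← Real.exp_add, add_neg_cancel, Real.exp_zero, one_mul]

section ContactFlow

variable {E : Type*} [NormedAddCommGroup E] [NormedSpace ℝ E]
  {H : Type*} [TopologicalSpace H] {J : ModelWithCorners ℝ E H}
  {U : Type*} [TopologicalSpace U] [ChartedSpace H U]
  {α : OneForm J U} {R : ∀ x : U, TangentSpace J x}
  [IsManifold J ∞ U] [J.Boundaryless]

theorem fderiv_clm_apply_const {P : Type*} [NormedAddCommGroup P] [NormedSpace ℝ P]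
    {β : P → P →L[ℝ] ℝ} {p : P} (h : DifferentiableAt ℝ β p) (v w : P) :
    fderiv ℝ (fun q ↦ β q w) p v = fderiv ℝ β p v w := by
  rw [fderiv_clm_apply h (differentiableAt_const w)]
  simp

theorem mfderiv_comp_prodMk_left {u : ℝ × E → U} {a : ℝ} {y : E}
    (hu : MDifferentiableAt 𝓘(ℝ, ℝ × E) J u (a, y)) (e : E) :
    mfderiv 𝓘(ℝ, E) J (fun y ↦ u (a, y)) y e = mfderiv 𝓘(ℝ, ℝ × E) J u (a, y) ((0 : ℝ), e) := by
  have h1 : HasMFDerivAt 𝓘(ℝ, E) 𝓘(ℝ, ℝ × E) (fun y : E ↦ (a, y)) y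
    (ContinuousLinearMap.inr ℝ ℝ E) := (hasFDerivAt_prodMk_right a y).hasMFDerivAt
  have h2 := (HasMFDerivAt.comp (g := u) y hu.hasMFDerivAt h1).mfderiv
  exact congrArg (fun L : E →L[ℝ] E ↦ L e) h2

theorem fderiv_comp_prod_apply {u : ℝ × E → U} {k : ℝ → U → ℝ} {a : ℝ} {y : E}
    (hu : MDifferentiableAt 𝓘(ℝ, ℝ × E) J u (a, y))
    (hk : MDifferentiableAt J 𝓘(ℝ, ℝ) (k a) (u (a, y)))
    (hku : DifferentiableAt ℝ (fun p : ℝ × E ↦ k p.1 (u p)) (a, y)) (e : E) :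
    fderiv ℝ (fun p : ℝ × E ↦ k p.1 (u p)) (a, y) ((0 : ℝ), e) =
      differential J (k a) (u (a, y)) (mfderiv 𝓘(ℝ, ℝ × E) J u (a, y) ((0 : ℝ), e)) := by
  have h1 := (hku.hasFDerivAt.comp y (hasFDerivAt_prodMk_right a y)).fderiv
  have hu' : MDifferentiableAt 𝓘(ℝ, E) J (fun y ↦ u (a, y)) y :=
    MDifferentiableAt.comp y hu (hasFDerivAt_prodMk_right a y).differentiableAt.mdifferentiableAt
  have h2 := mfderiv_comp y hk hu'
  rw [mfderiv_eq_fderiv] at h2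
  rw [← mfderiv_comp_prodMk_left hu]
  have h3 := congrArg (fun L : E →L[ℝ] ℝ ↦ L e) h1
  have h4 := congrArg (fun L : E →L[ℝ] ℝ ↦ L e) h2
  exact h3.symm.trans h4

/-- Along trajectories of a Hamiltonian vector field of `k`, the form `α` is rescaled by the
exponential of the integral of the derivative of `k` along the Reeb field. -/
theorem IsContactForm.pull_eq_of_hamiltonian [FiniteDimensional ℝ E] (h : IsContactForm J α R)
    {k : ℝ → U → ℝ} (hk : ContMDiff (𝓘(ℝ, ℝ).prod J) 𝓘(ℝ, ℝ) ∞ fun p : ℝ × U ↦ k p.1 p.2)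
    {u : ℝ × E → U} {s : ℝ} (hs : 0 ≤ s) {y : E}
    (hu : ∀ a ∈ Icc 0 s, ContMDiffAt 𝓘(ℝ, ℝ × E) J ∞ u (a, y))
    (hd : ∀ a ∈ Icc 0 s, ∀ᶠ p in 𝓝 (a, y), IsHamiltonianAt J α R (k p.1) (u p)
      (mfderiv 𝓘(ℝ, ℝ × E) J u p ((1 : ℝ), (0 : E)))) (e : E) :
    α.pull J u (s, y) ((0 : ℝ), e) = Real.exp (∫ a in (0 : ℝ)..s,
      differential J (k a) (u (a, y)) (R (u (a, y)))) * α.pull J u (0, y) ((0 : ℝ), e) := by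
  refine eq_exp_mul_of_hasDerivAt (y := fun a ↦ α.pull J u (a, y) ((0 : ℝ), e))
    (m := fun a ↦ differential J (k a) (u (a, y)) (R (u (a, y)))) hs ?_ ?_
  · intro a ha
    have h1 : ContinuousAt (fun a ↦ (a, u (a, y))) a :=
      continuousAt_id.prodMk (ContinuousAt.comp (g := u) (f := fun a ↦ (a, y))
        (hu a ha).continuousAt (Continuous.prodMk_left y).continuousAt)
    exact ((h.continuous_differential_reeb hk).continuousAt.comp
      (f := fun a ↦ (a, u (a, y))) h1).continuousWithinAt
  · intro a ha
    have hβ : DifferentiableAt ℝ (α.pull J u) (a, y) :=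
      (h.smooth.contDiffAt_pull (hu a ha)).differentiableAt (by simp)
    have hmd := (hu a ha).mdifferentiableAt (by simp)
    have hka : ContMDiff J 𝓘(ℝ, ℝ) ∞ (k a) := hk.comp (contMDiff_const.prodMk contMDiff_id)
    have h1 := h.smooth.fderiv_pull_sub (hu a ha) ((1 : ℝ), (0 : E)) ((0 : ℝ), e)
    have h2 := (hd a ha).self_of_nhds
    have h3 : (fun p ↦ α.pull J u p ((1 : ℝ), (0 : E))) =ᶠ[𝓝 (a, y)] fun p ↦ k p.1 (u p) :=
      (hd a ha).mono fun p hp ↦ hp.1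
    have hku : DifferentiableAt ℝ (fun p : ℝ × E ↦ k p.1 (u p)) (a, y) :=
      (hβ.clm_apply (differentiableAt_const ((1 : ℝ), (0 : E)))).congr_of_eventuallyEq h3.symm
    have h4 := fderiv_clm_apply_const hβ ((0 : ℝ), e) ((1 : ℝ), (0 : E))
    rw [h3.fderiv_eq, fderiv_comp_prod_apply hmd (hka.mdifferentiableAt (by simp)) hku] at h4
    have h5 : fderiv ℝ (α.pull J u) (a, y) ((1 : ℝ), (0 : E)) ((0 : ℝ), e) =
        differential J (k a) (u (a, y)) (R (u (a, y))) * α.pull J u (a, y) ((0 : ℝ), e) := by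
      rw [OneForm.pull_apply, ← h2.2]
      linear_combination h1 - h4
    rw [← h5, ← fderiv_clm_apply_const hβ]
    have h6 : DifferentiableAt ℝ (fun p ↦ α.pull J u p ((0 : ℝ), e)) (a, y) :=
      hβ.clm_apply (differentiableAt_const _)
    have h7 : HasDerivAt (fun a : ℝ ↦ (a, y)) ((1 : ℝ), (0 : E)) a :=
      (hasDerivAt_id a).prodMk (hasDerivAt_const a y)
    exact h6.hasFDerivAt.comp_hasDerivAt a h7

/-- The velocity of a family of maps which rescale `α` is a Hamiltonian vector field. -/
theorem IsContactForm.isHamiltonianAt_of_isotopy (h : IsContactForm J α R)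
    {u : ℝ × E → U} {t : ℝ} {y : E} (hu : ContMDiffAt 𝓘(ℝ, ℝ × E) J ∞ u (t, y))
    {ℓ : E → ℝ} (hc : ∀ᶠ a in 𝓝 t, ∃ c > 0, ∀ e, α.pull J u (a, y) ((0 : ℝ), e) = c * ℓ e)
    (hsurj : ∀ w : TangentSpace J (u (t, y)), ∃ e : E,
      mfderiv 𝓘(ℝ, ℝ × E) J u (t, y) ((0 : ℝ), e) = w)
    {k : U → ℝ} (hk : MDifferentiableAt J 𝓘(ℝ, ℝ) k (u (t, y)))
    (hku : ∀ᶠ y' in 𝓝 y, k (u (t, y')) = α.pull J u (t, y') ((1 : ℝ), (0 : E))) :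
    IsHamiltonianAt J α R k (u (t, y)) (mfderiv 𝓘(ℝ, ℝ × E) J u (t, y) ((1 : ℝ), (0 : E))) := by
  have hβ : DifferentiableAt ℝ (α.pull J u) (t, y) :=
    (h.smooth.contDiffAt_pull hu).differentiableAt (by simp)
  have hmd := hu.mdifferentiableAt (by simp)
  set X := mfderiv 𝓘(ℝ, ℝ × E) J u (t, y) ((1 : ℝ), (0 : E)) with hX
  have h1 : α (u (t, y)) X = k (u (t, y)) := hku.self_of_nhds.symm
  obtain ⟨c, hc0, hct⟩ := hc.self_of_nhds
  obtain ⟨e₀, he₀⟩ := hsurj (R (u (t, y)))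
  have hℓ : ℓ e₀ ≠ 0 := by
    intro h0
    have := hct e₀
    rw [OneForm.pull_apply, he₀, h.apply_reeb, h0, mul_zero] at this
    exact one_ne_zero this
  have h7 : HasDerivAt (fun a : ℝ ↦ (a, y)) ((1 : ℝ), (0 : E)) t :=
    (hasDerivAt_id t).prodMk (hasDerivAt_const t y)
  have hder : ∀ e, HasDerivAt (fun a ↦ α.pull J u (a, y) ((0 : ℝ), e))
      (fderiv ℝ (α.pull J u) (t, y) ((1 : ℝ), (0 : E)) ((0 : ℝ), e)) t := by
    intro e
    rw [← fderiv_clm_apply_const hβ]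
    exact (hβ.clm_apply (differentiableAt_const _)).hasFDerivAt.comp_hasDerivAt t h7
  set μ := fderiv ℝ (α.pull J u) (t, y) ((1 : ℝ), (0 : E)) ((0 : ℝ), e₀) / ℓ e₀ / c with hμ
  have hA : ∀ e, fderiv ℝ (α.pull J u) (t, y) ((1 : ℝ), (0 : E)) ((0 : ℝ), e) =
      μ * α.pull J u (t, y) ((0 : ℝ), e) := by
    intro e
    have h8 : HasDerivAt (fun a ↦ α.pull J u (a, y) ((0 : ℝ), e)) _ t :=
      (((hder e₀).div_const (ℓ e₀)).mul_const (ℓ e)).congr_of_eventuallyEq (by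
        filter_upwards [hc] with a ⟨c, _, ha⟩
        rw [ha, ha]
        field_simp)
    rw [(hder e).unique h8, hct, hμ]
    field_simp
  have hu' : MDifferentiableAt 𝓘(ℝ, E) J (fun y ↦ u (t, y)) y :=
    MDifferentiableAt.comp y hmd (hasFDerivAt_prodMk_right t y).differentiableAt.mdifferentiableAt
  have hB : ∀ e, fderiv ℝ (α.pull J u) (t, y) ((0 : ℝ), e) ((1 : ℝ), (0 : E)) =
      differential J k (u (t, y)) (mfderiv 𝓘(ℝ, ℝ × E) J u (t, y) ((0 : ℝ), e)) := by
    intro e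
    have h2 := mfderiv_comp y hk hu'
    rw [mfderiv_eq_fderiv] at h2
    have h3 : fderiv ℝ (k ∘ fun y ↦ u (t, y)) y e =
        differential J k (u (t, y)) (mfderiv 𝓘(ℝ, E) J (fun y ↦ u (t, y)) y e) :=
      congrArg (fun L : E →L[ℝ] ℝ ↦ L e) h2
    rw [mfderiv_comp_prodMk_left hmd] at h3
    rw [← h3, ← fderiv_clm_apply_const hβ]
    have h4 : (k ∘ fun y ↦ u (t, y)) =ᶠ[𝓝 y]
        (fun p ↦ α.pull J u p ((1 : ℝ), (0 : E))) ∘ fun y ↦ (t, y) := hku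
    rw [h4.fderiv_eq, ((hβ.clm_apply (differentiableAt_const _)).hasFDerivAt.comp y
      (hasFDerivAt_prodMk_right t y)).fderiv]
    rfl
  have hmain : ∀ w, α.d J (u (t, y)) X w + differential J k (u (t, y)) w =
      μ * α (u (t, y)) w := by
    intro w
    obtain ⟨e, rfl⟩ := hsurj w
    have h9 := h.smooth.fderiv_pull_sub hu ((1 : ℝ), (0 : E)) ((0 : ℝ), e)
    rw [hA, hB, OneForm.pull_apply] at h9
    linear_combination -h9
  have hμR : differential J k (u (t, y)) (R (u (t, y))) = μ := by
    have := hmain (R (u (t, y)))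
    rwa [h.d_reeb_right, h.apply_reeb, zero_add, mul_one] at this
  refine ⟨h1, fun w ↦ ?_⟩
  rw [hμR]
  exact hmain w

end ContactFlow


section Auxiliary

variable {E : Type*} [NormedAddCommGroup E] [NormedSpace ℝ E] [FiniteDimensional ℝ E]
  {H : Type*} [TopologicalSpace H] {I : ModelWithCorners ℝ E H}
  {M : Type*} [TopologicalSpace M] [ChartedSpace H M] [IsManifold I ∞ M] [T2Space M]

/-- If all integral curves starting outside some compact set exist for a fixed time, then all
integral curves exist for all times. -/
theorem IsSmoothField.exists_integralCurve_of_isCompact [I.Boundaryless]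
    {v : ∀ x : M, TangentSpace I x} (hv : IsSmoothField I v) {D : Set M} (hD : IsCompact D)
    (h : ∀ x ∉ D, ∃ γ : ℝ → M, γ 0 = x ∧ IsMIntegralCurveOn γ v (Ioo (-1) 1)) (x : M) :
    ∃ γ : ℝ → M, γ 0 = x ∧ IsMIntegralCurve γ v := by
  have : IsManifold I 1 M := .of_le (n := ∞) (by simp)
  obtain ⟨ε, hε, hεD⟩ := hv.exists_uniform_time hD
  refine exists_isMIntegralCurve_of_isMIntegralCurveOn (hv.of_le (by simp)) (ε := min ε 1)
    (lt_min hε one_pos) (fun x ↦ ?_) x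
  by_cases hx : x ∈ D
  · obtain ⟨γ, h0, hγ⟩ := hεD x hx
    exact ⟨γ, h0, hγ.mono (Ioo_subset_Ioo (neg_le_neg (min_le_left _ _)) (min_le_left _ _))⟩
  · obtain ⟨γ, h0, hγ⟩ := h x hx
    exact ⟨γ, h0, hγ.mono (Ioo_subset_Ioo (neg_le_neg (min_le_right _ _)) (min_le_right _ _))⟩

variable (I) in
theorem exists_contMDiff_bump [SigmaCompactSpace M] {K Ω : Set M} (hK : IsCompact K)
    (hΩ : IsOpen Ω) (h : K ⊆ Ω) :
    ∃ ρ : M → ℝ, ContMDiff I 𝓘(ℝ, ℝ) ∞ ρ ∧ (∀ᶠ x in 𝓝ˢ K, ρ x = 1) ∧ HasCompactSupport ρ ∧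
      tsupport ρ ⊆ Ω ∧ ∀ x, ρ x ∈ Icc (0 : ℝ) 1 := by
  have : LocallyCompactSpace M := Manifold.locallyCompact_of_finiteDimensional I
  obtain ⟨K', hK', hKK', hK'Ω⟩ := exists_compact_between hK hΩ h
  obtain ⟨f, h1, h0, hf⟩ := exists_contMDiffMap_one_nhds_of_subset_interior I (n := ⊤)
    hK.isClosed hKK'
  have hsupp : tsupport f ⊆ K' := by
    refine closure_minimal (fun x hx ↦ ?_) hK'.isClosed
    by_contra hxK
    exact hx (h0 x hxK)
  exact ⟨f, f.contMDiff, h1, HasCompactSupport.of_support_subset_isCompact hK'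
    ((subset_tsupport _).trans hsupp), hsupp.trans hK'Ω, hf⟩

/-- A smooth map with invertible derivative at a point has a smooth local right inverse. -/
theorem exists_contMDiffAt_rightInverse [I.Boundaryless] {f : M → M} {x : M}
    (hf : ContMDiffAt I I ∞ f x) (hinv : (mfderiv I I f x).IsInvertible) :
    ∃ g : M → M, ContMDiffAt I I ∞ g (f x) ∧ g (f x) = x ∧ ∀ᶠ y in 𝓝 (f x), f (g y) = y := by
  have : CompleteSpace E := FiniteDimensional.complete ℝ E
  set f' : E → E := writtenInExtChartAt I I x f with hf'
  set y₀ := extChartAt I x x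
  have h1 : ContDiffAt ℝ ∞ f' y₀ := by
    have := (contMDiffAt_iff.1 hf).2
    rwa [I.range_eq_univ, contDiffWithinAt_univ] at this
  have h2 : (mfderiv I I f x : E →L[ℝ] E) = fderiv ℝ f' y₀ := by
    have := (hf.mdifferentiableAt (by simp)).mfderiv
    rw [I.range_eq_univ, fderivWithin_univ] at this
    exact this
  obtain ⟨e, he⟩ : (fderiv ℝ f' y₀).IsInvertible := h2 ▸ hinv
  have h3 : HasFDerivAt f' (e : E →L[ℝ] E) y₀ := by
    rw [he]; exact (h1.differentiableAt (by simp)).hasFDerivAt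
  set g' := h1.localInverse h3 (by simp) with hg'
  have hf'y : f' y₀ = extChartAt I (f x) (f x) := by
    simp [hf', y₀, writtenInExtChartAt]
  have h4 : ContDiffAt ℝ ∞ g' (f' y₀) := h1.to_localInverse h3 (by simp)
  have h5 : g' (f' y₀) = y₀ := h1.localInverse_apply_image h3 (by simp)
  have h6 : ∀ᶠ z in 𝓝 (f' y₀), f' (g' z) = z :=
    ((h1.hasStrictFDerivAt' h3 (by simp)).eventually_right_inverse)
  rw [hf'y] at h4 h5 h6
  have hχ : ContMDiffAt I 𝓘(ℝ, E) ∞ (extChartAt I (f x)) (f x) := contMDiffAt_extChartAt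
  refine ⟨fun y ↦ (extChartAt I x).symm (g' (extChartAt I (f x) y)), ?_, ?_, ?_⟩
  · refine ContMDiffAt.comp (I' := 𝓘(ℝ, E)) (g := (extChartAt I x).symm)
      (f := fun y ↦ g' (extChartAt I (f x) y)) (f x) ?_ (h4.contMDiffAt.comp (f x) hχ)
    rw [h5]
    exact contMDiffAt_extChartAt_symm (mem_extChartAt_target x)
  · change (extChartAt I x).symm (g' (extChartAt I (f x) (f x))) = x
    rw [h5]
    exact extChartAt_to_inv x
  · have hsymm : ContinuousAt (fun y ↦ (extChartAt I x).symm (g' (extChartAt I (f x) y))) (f x) := by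
      refine ContinuousAt.comp (g := (extChartAt I x).symm)
        (f := fun y ↦ g' (extChartAt I (f x) y)) ?_ (ContinuousAt.comp (g := g')
          h4.continuousAt hχ.continuousAt)
      rw [h5]
      exact continuousAt_extChartAt_symm x
    have hx0 : (extChartAt I x).symm (g' (extChartAt I (f x) (f x))) = x := by
      rw [h5]; exact extChartAt_to_inv x
    have h7 : ∀ᶠ y in 𝓝 (f x),
        f ((extChartAt I x).symm (g' (extChartAt I (f x) y))) ∈ (extChartAt I (f x)).source := by
      refine ContinuousAt.eventually_mem (f := fun y ↦
        f ((extChartAt I x).symm (g' (extChartAt I (f x) y)))) ?_ ?_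
      · exact ContinuousAt.comp (g := f) (by rw [hx0]; exact hf.continuousAt) hsymm
      · rw [hx0]
        exact extChartAt_source_mem_nhds (I := I) (f x)
    filter_upwards [hχ.continuousAt.eventually h6, h7,
      extChartAt_source_mem_nhds (I := I) (f x)] with y hy6 hy7 hy8
    exact (extChartAt I (f x)).injOn hy7 hy8 hy6

end Auxiliary

section Conformal

variable {E : Type*} [NormedAddCommGroup E] [NormedSpace ℝ E] [FiniteDimensional ℝ E]
  {H : Type*} [TopologicalSpace H] {J : ModelWithCorners ℝ E H}
  {U : Type*} [TopologicalSpace U] [ChartedSpace H U] [IsManifold J ∞ U] [J.Boundaryless]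
  {α : OneForm J U} {R : ∀ x : U, TangentSpace J x}

/-- The map `(t, y) ↦ F t y`, with `y` in the preferred chart around `x`. -/
def inSpaceChart (J : ModelWithCorners ℝ E H) (F : ℝ → U → U) (x : U) (p : ℝ × E) : U :=
  F p.1 ((extChartAt J x).symm p.2)

theorem contMDiffAt_inSpaceChart {F : ℝ → U → U} {a : ℝ} {x : U} {y : E}
    (hy : y ∈ (extChartAt J x).target)
    (hF : ContMDiffAt (𝓘(ℝ, ℝ).prod J) J ∞ (fun p : ℝ × U ↦ F p.1 p.2)
      (a, (extChartAt J x).symm y)) :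
    ContMDiffAt 𝓘(ℝ, ℝ × E) J ∞ (inSpaceChart J F x) (a, y) := by
  exact ContMDiffAt.comp (I' := 𝓘(ℝ, ℝ).prod J) (g := fun p : ℝ × U ↦ F p.1 p.2)
    (f := fun p : ℝ × E ↦ (p.1, (extChartAt J x).symm p.2)) (a, y) hF
    (contDiffAt_fst.contMDiffAt.prodMk ((contMDiffAt_extChartAt_symm hy).comp (a, y)
      contDiffAt_snd.contMDiffAt))

theorem mfderiv_inSpaceChart_time {F : ℝ → U → U} {a : ℝ} {x : U} {y : E}
    (hF : MDifferentiableAt 𝓘(ℝ, ℝ × E) J (inSpaceChart J F x) (a, y)) :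
    HasMFDerivAt 𝓘(ℝ, ℝ) J (fun r ↦ F r ((extChartAt J x).symm y)) a
      ((1 : ℝ →L[ℝ] ℝ).smulRight (mfderiv 𝓘(ℝ, ℝ × E) J (inSpaceChart J F x) (a, y)
        ((1 : ℝ), (0 : E)))) := by
  have h1 : HasMFDerivAt 𝓘(ℝ, ℝ) 𝓘(ℝ, ℝ × E) (fun r : ℝ ↦ (r, y)) a
    (ContinuousLinearMap.inl ℝ ℝ E) := (hasFDerivAt_prodMk_left a y).hasMFDerivAt
  refine (HasMFDerivAt.comp (g := inSpaceChart J F x) a hF.hasMFDerivAt h1).congr_mfderiv ?_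
  refine ContinuousLinearMap.ext_ring ?_
  set L : ℝ × E →L[ℝ] E := mfderiv 𝓘(ℝ, ℝ × E) J (inSpaceChart J F x) (a, y)
  change L ((1 : ℝ), (0 : E)) = (1 : ℝ) • L ((1 : ℝ), (0 : E))
  rw [one_smul]

theorem mfderiv_inSpaceChart_space {F : ℝ → U → U} {a : ℝ} {x : U} {y : E}
    (hy : y ∈ (extChartAt J x).target)
    (hF : ContMDiffAt (𝓘(ℝ, ℝ).prod J) J ∞ (fun p : ℝ × U ↦ F p.1 p.2)
      (a, (extChartAt J x).symm y)) (e : E) :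
    mfderiv 𝓘(ℝ, ℝ × E) J (inSpaceChart J F x) (a, y) ((0 : ℝ), e) =
      mfderiv J J (F a) ((extChartAt J x).symm y)
        (mfderiv 𝓘(ℝ, E) J (extChartAt J x).symm y e) := by
  rw [← mfderiv_comp_prodMk_left
    ((contMDiffAt_inSpaceChart hy hF).mdifferentiableAt (by simp))]
  have h1 : ContMDiffAt J J ∞ (F a) ((extChartAt J x).symm y) :=
    ContMDiffAt.comp (I' := 𝓘(ℝ, ℝ).prod J) (g := fun p : ℝ × U ↦ F p.1 p.2)
      (f := fun z ↦ (a, z)) _ hF (contMDiffAt_const.prodMk contMDiffAt_id)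
  have h2 := mfderiv_comp y (h1.mdifferentiableAt (by simp))
    ((contMDiffAt_extChartAt_symm hy).mdifferentiableAt (by simp))
  exact congrArg (fun L : E →L[ℝ] E ↦ L e) h2

theorem hasMFDerivAt_curve_unique {γ : ℝ → U} {a : ℝ} {v w : TangentSpace J (γ a)}
    (hv : HasMFDerivAt 𝓘(ℝ, ℝ) J γ a ((1 : ℝ →L[ℝ] ℝ).smulRight v))
    (hw : HasMFDerivAt 𝓘(ℝ, ℝ) J γ a ((1 : ℝ →L[ℝ] ℝ).smulRight w)) : v = w := by
  have h := congrArg (fun L : ℝ →L[ℝ] E ↦ L 1) (hasMFDerivAt_unique hv hw)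
  have h1 : (1 : ℝ) • (v : E) = (1 : ℝ) • (w : E) := h
  rwa [one_smul, one_smul] at h1

/-- The time-`s` map of a Hamiltonian isotopy rescales `α`. -/
theorem IsContactForm.isConformalFactorAt_of_hamiltonian (h : IsContactForm J α R)
    {k : ℝ → U → ℝ} (hk : ContMDiff (𝓘(ℝ, ℝ).prod J) 𝓘(ℝ, ℝ) ∞ fun p : ℝ × U ↦ k p.1 p.2)
    {F : ℝ → U → U} {s : ℝ} (hs : 0 ≤ s) {x : U}
    (hF : ∀ a ∈ Icc 0 s, ∀ᶠ p in 𝓝 (a, x),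
      ContMDiffAt (𝓘(ℝ, ℝ).prod J) J ∞ (fun p : ℝ × U ↦ F p.1 p.2) p)
    (hF0 : ∀ᶠ z in 𝓝 x, F 0 z = z)
    (hd : ∀ a ∈ Icc 0 s, ∀ᶠ p in 𝓝 (a, x), ∃ v : TangentSpace J (F p.1 p.2),
      HasMFDerivAt 𝓘(ℝ, ℝ) J (fun r ↦ F r p.2) p.1 ((1 : ℝ →L[ℝ] ℝ).smulRight v) ∧
      IsHamiltonianAt J α R (k p.1) (F p.1 p.2) v) :
    IsConformalFactorAt J α (F s) x
      (Real.exp (∫ a in (0 : ℝ)..s, differential J (k a) (F a x) (R (F a x)))) := by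
  set y := extChartAt J x x with hy
  have hyt : y ∈ (extChartAt J x).target := mem_extChartAt_target x
  have hyx : (extChartAt J x).symm y = x := extChartAt_to_inv x
  set u := inSpaceChart J F x with hu
  have hux : ∀ a, u (a, y) = F a x := fun a ↦ congrArg (F a) hyx
  have htend : ∀ a, Filter.Tendsto (fun p : ℝ × E ↦ (p.1, (extChartAt J x).symm p.2))
      (𝓝 (a, y)) (𝓝 (a, x)) := by
    intro a
    have h1 : ContinuousAt (fun p : ℝ × E ↦ (p.1, (extChartAt J x).symm p.2)) (a, y) :=
      continuousAt_fst.prodMk (ContinuousAt.comp (f := Prod.snd) (continuousAt_extChartAt_symm x)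
        continuousAt_snd)
    have h2 := h1.tendsto
    rwa [hyx] at h2
  have hev : ∀ a : ℝ, ∀ᶠ p in 𝓝 (a, y), p.2 ∈ (extChartAt J x).target := fun a ↦
    continuousAt_snd.eventually (extChartAt_target_mem_nhds (I := J) x)
  have hF' : ∀ a ∈ Icc 0 s, ContMDiffAt (𝓘(ℝ, ℝ).prod J) J ∞ (fun p : ℝ × U ↦ F p.1 p.2)
      (a, (extChartAt J x).symm y) := fun a ha ↦ by rw [hyx]; exact (hF a ha).self_of_nhds
  have husm : ∀ a ∈ Icc 0 s, ContMDiffAt 𝓘(ℝ, ℝ × E) J ∞ u (a, y) := fun a ha ↦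
    contMDiffAt_inSpaceChart hyt (hF' a ha)
  have hham : ∀ a ∈ Icc 0 s, ∀ᶠ p in 𝓝 (a, y), IsHamiltonianAt J α R (k p.1) (u p)
      (mfderiv 𝓘(ℝ, ℝ × E) J u p ((1 : ℝ), (0 : E))) := by
    intro a ha
    filter_upwards [(htend a).eventually (hF a ha), (htend a).eventually (hd a ha), hev a]
      with p hp1 hp2 hp3
    obtain ⟨v, hv, hvk⟩ := hp2
    have h3 := mfderiv_inSpaceChart_time
      ((contMDiffAt_inSpaceChart hp3 hp1).mdifferentiableAt (by simp))
    have h4 := hasMFDerivAt_curve_unique h3 hv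
    rw [show u p = F p.1 ((extChartAt J x).symm p.2) from rfl]
    exact h4 ▸ hvk
  have hmain := h.pull_eq_of_hamiltonian hk hs husm hham
  have hint : (fun a ↦ differential J (k a) (u (a, y)) (R (u (a, y)))) =
      fun a ↦ differential J (k a) (F a x) (R (F a x)) :=
    funext fun a ↦ congrArg (fun z ↦ differential J (k a) z (R z)) (hux a)
  rw [hint] at hmain
  have hb := (mfderiv_extChartAt_symm_isInvertible (I := J) hyt).bijective
  refine ⟨Real.exp_pos _, ?_⟩
  have hF0' : F 0 =ᶠ[𝓝 ((extChartAt J x).symm y)] id := by rw [hyx]; exact hF0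
  have key₀ : ∀ e : E, α (F s ((extChartAt J x).symm y))
      (mfderiv J J (F s) ((extChartAt J x).symm y) (mfderiv 𝓘(ℝ, E) J (extChartAt J x).symm y e)) =
      Real.exp (∫ a in (0 : ℝ)..s, differential J (k a) (F a x) (R (F a x))) *
        α ((extChartAt J x).symm y) (mfderiv 𝓘(ℝ, E) J (extChartAt J x).symm y e) := by
    intro e
    have h5 := hmain e
    rw [OneForm.pull_apply, OneForm.pull_apply, hu, mfderiv_inSpaceChart_space hyt (hF' s ⟨hs, le_rfl⟩),
      mfderiv_inSpaceChart_space hyt (hF' 0 ⟨le_rfl, hs⟩), hF0'.mfderiv_eq, mfderiv_id] at h5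
    have h6 : inSpaceChart J F x (0, y) = (extChartAt J x).symm y := hF0'.self_of_nhds
    rw [h6] at h5
    exact h5
  have key : (α (F s ((extChartAt J x).symm y))).comp (mfderiv J J (F s) ((extChartAt J x).symm y))
      = Real.exp (∫ a in (0 : ℝ)..s, differential J (k a) (F a x) (R (F a x))) •
        α ((extChartAt J x).symm y) := by
    refine ContinuousLinearMap.ext fun w ↦ ?_
    obtain ⟨e, rfl⟩ := hb.2 w
    exact key₀ e
  rwa [hyx] at key

end Conformal


/-! ### Flows of time-dependent vector fields of compact support -/

section TimeDependent

variable {E : Type*} [NormedAddCommGroup E] [NormedSpace ℝ E]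
  {H : Type*} [TopologicalSpace H] {J : ModelWithCorners ℝ E H}
  {U : Type*} [TopologicalSpace U] [ChartedSpace H U]

variable (J) in
/-- The curve `γ` has velocity `v` at time `t`. -/
abbrev HasVelocityAt (γ : ℝ → U) (t : ℝ) (v : TangentSpace J (γ t)) : Prop :=
  HasMFDerivAt 𝓘(ℝ, ℝ) J γ t ((1 : ℝ →L[ℝ] ℝ).smulRight v)

/-- The vector field `(1, X)` on `ℝ × U`. -/
def suspension (X : ℝ → ∀ x : U, TangentSpace J x) (p : ℝ × U) :
    TangentSpace (𝓘(ℝ, ℝ).prod J) p := ((1 : ℝ), (X p.1 p.2 : E))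

theorem HasVelocityAt.prodMk {γ : ℝ → U} {t c : ℝ} {v : TangentSpace J (γ t)}
    (h : HasVelocityAt J γ t v) :
    HasVelocityAt (𝓘(ℝ, ℝ).prod J) (fun r ↦ (c + r, γ r)) t ((1 : ℝ), (v : E)) := by
  have h1 : HasMFDerivAt 𝓘(ℝ, ℝ) 𝓘(ℝ, ℝ) (fun r : ℝ ↦ c + r) t (1 : ℝ →L[ℝ] ℝ) :=
    ((hasFDerivAt_id t).const_add c).hasMFDerivAt
  refine (h1.prodMk h).congr_mfderiv ?_
  refine ContinuousLinearMap.ext_ring ?_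
  change (((1 : ℝ), (1 : ℝ) • (v : E)) : ℝ × E) = (1 : ℝ) • ((1 : ℝ), (v : E))
  rw [Prod.smul_mk, smul_eq_mul, mul_one]
  rfl

theorem HasVelocityAt.snd {γ : ℝ → ℝ × U} {t : ℝ} {v : TangentSpace (𝓘(ℝ, ℝ).prod J) (γ t)}
    (h : HasVelocityAt (𝓘(ℝ, ℝ).prod J) γ t v) :
    HasVelocityAt J (fun r ↦ (γ r).2) t (v.2 : E) :=
  (HasMFDerivAt.comp t (hasMFDerivAt_snd (γ t)) h).congr_mfderiv rfl

theorem HasVelocityAt.fst {γ : ℝ → ℝ × U} {t : ℝ} {v : TangentSpace (𝓘(ℝ, ℝ).prod J) (γ t)}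
    (h : HasVelocityAt (𝓘(ℝ, ℝ).prod J) γ t v) :
    HasDerivAt (fun r ↦ (γ r).1) (v.1 : ℝ) t := by
  have h1 : ∀ c : ℝ, c = v.1 → HasFDerivAt (fun r ↦ (γ r).1) ((1 : ℝ →L[ℝ] ℝ).smulRight c) t := by
    rintro c rfl
    exact ((HasMFDerivAt.comp t (hasMFDerivAt_fst (γ t)) h).congr_mfderiv rfl).hasFDerivAt
  have h2 : ∀ c : ℝ, c = v.1 → HasDerivAt (fun r ↦ (γ r).1) c t := fun c hc ↦
    (h1 c hc).hasDerivAt.congr_deriv (one_mul c)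
  exact h2 _ rfl

theorem hasVelocityAt_const (x : U) (t : ℝ) : HasVelocityAt J (fun _ ↦ x) t (0 : E) :=
  (hasMFDerivAt_const x t).congr_mfderiv (by
    refine ContinuousLinearMap.ext_ring ?_
    change (0 : E) = (1 : ℝ) • (0 : E)
    rw [smul_zero])

variable [IsManifold J ∞ U] [J.Boundaryless] [FiniteDimensional ℝ E] [T2Space U]

/-- A smooth time-dependent vector field of compact support generates a smooth family of
diffeomorphisms. -/
theorem exists_timeDependent_flow {X : ℝ → ∀ x : U, TangentSpace J x}
    (hX : ContMDiff (𝓘(ℝ, ℝ).prod J) J.tangent ∞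
      (fun p : ℝ × U ↦ (⟨p.2, X p.1 p.2⟩ : TangentBundle J U)))
    {D : Set U} (hD : IsCompact D) {a b : ℝ}
    (hX0 : ∀ t x, (x ∉ D ∨ t ∉ Icc a b) → X t x = 0) :
    ∃ S : ℝ → (U ≃ₘ⟮J, J⟯ U), ContMDiff (𝓘(ℝ, ℝ).prod J) J ∞ (fun p : ℝ × U ↦ S p.1 p.2) ∧
      S 0 = Diffeomorph.refl J U ∞ ∧ (∀ t, ∀ x ∉ D, S t x = x) ∧
      (∀ t x, HasVelocityAt J (fun r ↦ S r x) t (X t (S t x))) ∧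
      ∀ (c d : ℝ) (γ : ℝ → U), (0 : ℝ) ∈ Ioo c d →
        (∀ t ∈ Ioo c d, HasVelocityAt J γ t (X t (γ t))) →
        ∀ t ∈ Ioo c d, S t (γ 0) = γ t := by
  have : IsManifold (𝓘(ℝ, ℝ).prod J) 1 (ℝ × U) := .of_le (n := ∞) (by simp)
  have hY : IsSmoothField (𝓘(ℝ, ℝ).prod J) (suspension X) := isSmoothField_suspension hX
  have hconst : ∀ (p : ℝ × U) (r : ℝ), (p.2 ∉ D ∨ p.1 + r ∉ Icc a b) →
      HasVelocityAt (𝓘(ℝ, ℝ).prod J) (fun r ↦ (p.1 + r, p.2)) r (suspension X (p.1 + r, p.2)) := by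
    intro p r h
    have h0 := (hasVelocityAt_const (J := J) p.2 r).prodMk (c := p.1)
    have h1 : suspension X (p.1 + r, p.2) = ((1 : ℝ), (0 : E)) :=
      congrArg (fun v : E ↦ ((1 : ℝ), v)) (hX0 (p.1 + r) p.2 h)
    rw [h1]
    exact h0
  obtain ⟨φ, hφ, hφ0, hφint, hφadd⟩ := hY.exists_flow fun p ↦
    hY.exists_integralCurve_of_isCompact
      ((isCompact_Icc (a := a - 1) (b := b + 1)).prod hD) (fun p hp ↦ by
        refine ⟨fun r ↦ (p.1 + r, p.2), by simp, fun r hr ↦ (hconst p r ?_).hasMFDerivWithinAt⟩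
        by_contra! hcon
        exact hp ⟨⟨by linarith [hcon.2.1, hr.1, hr.2], by linarith [hcon.2.2, hr.1, hr.2]⟩,
          hcon.1⟩) p
  have hfst : ∀ s p, (φ s p).1 = p.1 + s := by
    intro s p
    have h1 : ∀ r, HasDerivAt (fun r ↦ (φ r p).1 - r) 0 r := by
      intro r
      have := (HasVelocityAt.fst (hφint p r)).sub (hasDerivAt_id r)
      rwa [show ((suspension X (φ r p)).1 : ℝ) = 1 from rfl, sub_self] at this
    have h2 := is_const_of_deriv_eq_zero (fun r ↦ (h1 r).differentiableAt)
      (fun r ↦ (h1 r).deriv) s 0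
    simp only [hφ0, sub_zero] at h2
    linarith
  have hφt : ∀ t x, φ t (0, x) = (t, (φ t (0, x)).2) := fun t x ↦
    Prod.ext (by rw [hfst, zero_add]) rfl
  have hφt' : ∀ t x, φ (-t) (t, x) = (0, (φ (-t) (t, x)).2) := fun t x ↦
    Prod.ext (by rw [hfst, add_neg_cancel]) rfl
  have hsm : ∀ f : ℝ → ℝ, ∀ g : ℝ → ℝ, ContDiff ℝ ∞ f → ContDiff ℝ ∞ g →
      ContMDiff (𝓘(ℝ, ℝ).prod J) J ∞ (fun p : ℝ × U ↦ (φ (f p.1) (g p.1, p.2)).2) := by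
    intro f g hf hg
    have h1 : ContMDiff (𝓘(ℝ, ℝ).prod J) 𝓘(ℝ, ℝ) ∞ (fun p : ℝ × U ↦ f p.1) :=
      hf.contMDiff.comp contMDiff_fst
    have h2 : ContMDiff (𝓘(ℝ, ℝ).prod J) 𝓘(ℝ, ℝ) ∞ (fun p : ℝ × U ↦ g p.1) :=
      hg.contMDiff.comp contMDiff_fst
    exact contMDiff_snd.comp (hφ.comp (h1.prodMk (h2.prodMk contMDiff_snd)))
  have hslice : ∀ t : ℝ, ContMDiff J (𝓘(ℝ, ℝ).prod J) ∞ (fun x : U ↦ (t, x)) := fun t ↦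
    contMDiff_const.prodMk contMDiff_id
  have huniq : ∀ (c d : ℝ) (γ : ℝ → U), (0 : ℝ) ∈ Ioo c d →
      (∀ t ∈ Ioo c d, HasVelocityAt J γ t (X t (γ t))) →
      ∀ t ∈ Ioo c d, (φ t (0, γ 0)).2 = γ t := by
    intro c d γ h0 hγ t ht
    have h1 : IsMIntegralCurveOn (fun r ↦ (0 + r, γ r)) (suspension X) (Ioo c d) := by
      intro r hr
      have h2 := (hγ r hr).prodMk (c := 0)
      have h3 : suspension X (0 + r, γ r) = ((1 : ℝ), (X r (γ r) : E)) := by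
        rw [zero_add]; rfl
      rw [h3]
      exact h2.hasMFDerivWithinAt
    have h2 := isMIntegralCurveOn_Ioo_eqOn_of_contMDiff_boundaryless h0 (hY.of_le (by simp))
      ((hφint (0, γ 0)).isMIntegralCurveOn _) h1 (by simp [hφ0]) ht
    exact congrArg Prod.snd h2
  refine ⟨fun t ↦
    { toFun := fun x ↦ (φ t (0, x)).2
      invFun := fun x ↦ (φ (-t) (t, x)).2
      left_inv := fun x ↦ ?_
      right_inv := fun x ↦ ?_
      contMDiff_toFun := (hsm id (fun _ ↦ 0) contDiff_id contDiff_const).comp (hslice t)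
      contMDiff_invFun := (hsm (fun t ↦ -t) id contDiff_neg contDiff_id).comp (hslice t) },
    hsm id (fun _ ↦ 0) contDiff_id contDiff_const, ?_, ?_, ?_, huniq⟩
  · change (φ (-t) (t, (φ t (0, x)).2)).2 = x
    rw [← hφt, ← hφadd, neg_add_cancel, hφ0]
  · change (φ t (0, (φ (-t) (t, x)).2)).2 = x
    rw [← hφt', ← hφadd, add_neg_cancel, hφ0]
  · refine Diffeomorph.ext fun x ↦ ?_
    change (φ 0 (0, x)).2 = x
    rw [hφ0]
  · intro t x hx
    refine huniq (-(|t| + 1)) (|t| + 1) (fun _ ↦ x) ⟨by linarith [abs_nonneg t],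
      by linarith [abs_nonneg t]⟩ (fun r _ ↦ ?_) t ⟨by linarith [neg_abs_le t],
      by linarith [le_abs_self t]⟩
    rw [hX0 r x (.inl hx)]
    exact hasVelocityAt_const x r
  · intro t x
    have h1 := HasVelocityAt.snd (hφint (0, x) t)
    have h2 : (suspension X (φ t (0, x))).2 = X t (φ t (0, x)).2 := by
      rw [hφt t x]; rfl
    rw [h2] at h1
    exact h1

end TimeDependent


/-! ### Extending contact isotopies to compactly supported contact isotopies -/

section Extension

variable {E : Type*} [NormedAddCommGroup E] [NormedSpace ℝ E]
  {H : Type*} [TopologicalSpace H] {J : ModelWithCorners ℝ E H}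
  {U : Type*} [TopologicalSpace U] [ChartedSpace H U]

theorem isInvertible_of_injective_endo {F : Type*} [NormedAddCommGroup F] [NormedSpace ℝ F]
    [FiniteDimensional ℝ F] {L : F →L[ℝ] F} (h : Function.Injective L) : L.IsInvertible :=
  ⟨(LinearEquiv.ofInjectiveEndo (L : F →ₗ[ℝ] F) h).toContinuousLinearEquiv, by ext; rfl⟩

theorem IsContactEmbedding.bijective_mfderiv {α : OneForm J U} {σ : U → U}
    (h : IsContactEmbedding J α σ) (x : U) : Function.Bijective (mfderiv J J σ x) := by
  have h1 := h.1 x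
  have h2 := h1.mfderivToContinuousLinearEquiv_coe (by simp)
  rw [← h2]
  exact (h1.mfderivToContinuousLinearEquiv (by simp)).bijective

variable (T : ℝ → U → U)

/-- The map `(t, x) ↦ (t, T t x)`. -/
def trackMap (p : ℝ × U) : ℝ × U := (p.1, T p.1 p.2)

variable (J) in
/-- The contact Hamiltonian of an isotopy, as a function on its domain. -/
def isotopyHamiltonian (α : OneForm J U) (p : ℝ × U) : ℝ :=
  α (T p.1 p.2) (mfderiv 𝓘(ℝ, ℝ) J (fun r ↦ T r p.2) p.1 (1 : ℝ))

variable {T}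

theorem HasVelocityAt.isotopyHamiltonian {α : OneForm J U} {p : ℝ × U}
    {v : TangentSpace J (T p.1 p.2)} (h : HasVelocityAt J (fun r ↦ T r p.2) p.1 v) :
    isotopyHamiltonian J T α p = α (T p.1 p.2) v := by
  rw [ContactCone.isotopyHamiltonian, h.mfderiv]
  exact congrArg (α (T p.1 p.2)) (one_smul ℝ (v : E))

theorem contMDiff_trackMap (hT : ContMDiff (𝓘(ℝ, ℝ).prod J) J ∞ (fun p : ℝ × U ↦ T p.1 p.2)) :
    ContMDiff (𝓘(ℝ, ℝ).prod J) (𝓘(ℝ, ℝ).prod J) ∞ (trackMap T) :=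
  contMDiff_fst.prodMk hT

theorem isInvertible_mfderiv_trackMap [FiniteDimensional ℝ E] [IsManifold J ∞ U]
    (hT : ContMDiff (𝓘(ℝ, ℝ).prod J) J ∞ (fun p : ℝ × U ↦ T p.1 p.2)) (p : ℝ × U)
    (hp : Function.Injective (mfderiv J J (T p.1) p.2)) :
    (mfderiv (𝓘(ℝ, ℝ).prod J) (𝓘(ℝ, ℝ).prod J) (trackMap T) p).IsInvertible := by
  have hd := hT.mdifferentiableAt (x := p) (by simp)
  have h1 : mfderiv (𝓘(ℝ, ℝ).prod J) (𝓘(ℝ, ℝ).prod J) (trackMap T) p =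
      (mfderiv (𝓘(ℝ, ℝ).prod J) 𝓘(ℝ, ℝ) Prod.fst p).prod
        (mfderiv (𝓘(ℝ, ℝ).prod J) J (fun p : ℝ × U ↦ T p.1 p.2) p) :=
    mfderiv_prodMk (contMDiff_fst.mdifferentiableAt (n := ∞) (by simp)) hd
  rw [mfderiv_fst] at h1
  refine isInvertible_of_injective_endo (F := ℝ × E) ((injective_iff_map_eq_zero _).2 ?_)
  rintro ⟨a, w⟩ hv
  have h2 : ((a, mfderiv (𝓘(ℝ, ℝ).prod J) J (fun p : ℝ × U ↦ T p.1 p.2) p (a, w)) : ℝ × E) = 0 :=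
    (congrArg (fun L : ℝ × E →L[ℝ] ℝ × E ↦ L (a, w)) h1).symm.trans hv
  obtain ⟨rfl, h3⟩ := Prod.mk.inj h2
  have h4 := mfderiv_prod_eq_add_apply (v := ((0 : ℝ), w)) hd
  have h5 : mfderiv J J (T p.1) p.2 w = 0 := by
    refine Eq.trans ?_ (h4.symm.trans h3)
    refine ((congrArg₂ (· + ·) ?_ rfl).trans (zero_add _)).symm
    exact map_zero (mfderiv 𝓘(ℝ, ℝ) J (fun z : ℝ ↦ T z p.2) p.1)
  rw [(injective_iff_map_eq_zero _).1 hp w h5]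
  rfl

theorem isotopyHamiltonian_inSpaceChart [FiniteDimensional ℝ E] [IsManifold J ∞ U] [J.Boundaryless] {α : OneForm J U}
    (hT : ContMDiff (𝓘(ℝ, ℝ).prod J) J ∞ (fun p : ℝ × U ↦ T p.1 p.2)) {x : U} {t : ℝ} {y : E}
    (hy : y ∈ (extChartAt J x).target) :
    isotopyHamiltonian J T α (t, (extChartAt J x).symm y) =
      α.pull J (inSpaceChart J T x) (t, y) ((1 : ℝ), (0 : E)) :=
  HasVelocityAt.isotopyHamiltonian (mfderiv_inSpaceChart_time ((contMDiffAt_inSpaceChart hy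
    hT.contMDiffAt).mdifferentiableAt (by simp)))

theorem contMDiff_isotopyHamiltonian [FiniteDimensional ℝ E] [IsManifold J ∞ U] [J.Boundaryless] {α : OneForm J U}
    (hα : α.IsSmoothInCharts J)
    (hT : ContMDiff (𝓘(ℝ, ℝ).prod J) J ∞ (fun p : ℝ × U ↦ T p.1 p.2)) :
    ContMDiff (𝓘(ℝ, ℝ).prod J) 𝓘(ℝ, ℝ) ∞ (isotopyHamiltonian J T α) := by
  intro p
  have hy := mem_extChartAt_target (I := J) p.2
  have h1 : ContDiffAt ℝ ∞ (fun q ↦ α.pull J (inSpaceChart J T p.2) q ((1 : ℝ), (0 : E)))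
      (p.1, extChartAt J p.2 p.2) :=
    (hα.contDiffAt_pull (contMDiffAt_inSpaceChart hy hT.contMDiffAt)).clm_apply contDiffAt_const
  have h2 : ContMDiffAt (𝓘(ℝ, ℝ).prod J) 𝓘(ℝ, ℝ × E) ∞
      (fun q : ℝ × U ↦ (q.1, extChartAt J p.2 q.2)) p := by
    rw [modelWithCornersSelf_prod, ← chartedSpaceSelf_prod]
    exact contMDiffAt_fst.prodMk (contMDiffAt_extChartAt.comp p contMDiffAt_snd)
  refine (ContMDiffAt.comp p h1.contMDiffAt h2).congr_of_eventuallyEq ?_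
  filter_upwards [continuousAt_snd.preimage_mem_nhds
    (extChartAt_source_mem_nhds (I := J) p.2)] with q hq
  have h3 := isotopyHamiltonian_inSpaceChart (α := α) hT (t := q.1)
    ((extChartAt J p.2).map_source hq)
  rw [(extChartAt J p.2).left_inv hq] at h3
  exact h3

/-- The time-dependent Hamiltonian of an isotopy, cut off in space-time. -/
theorem exists_cutoff_isotopyHamiltonian [FiniteDimensional ℝ E] [IsManifold J ∞ U]
    [J.Boundaryless] [T2Space U] [SigmaCompactSpace U] {α : OneForm J U}
    (hα : α.IsSmoothInCharts J)
    (hT : ContMDiff (𝓘(ℝ, ℝ).prod J) J ∞ (fun p : ℝ × U ↦ T p.1 p.2))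
    (hinj : ∀ t, Function.Injective (T t))
    (hder : ∀ t x, Function.Injective (mfderiv J J (T t) x)) {K : Set (ℝ × U)} (hK : IsCompact K) :
    ∃ k : ℝ → U → ℝ, ContMDiff (𝓘(ℝ, ℝ).prod J) 𝓘(ℝ, ℝ) ∞ (fun p : ℝ × U ↦ k p.1 p.2) ∧
      (∃ D : Set U, IsCompact D ∧ ∃ a b : ℝ, ∀ t x, (x ∉ D ∨ t ∉ Icc a b) → k t x = 0) ∧
      ∀ p ∈ K, ∀ᶠ q in 𝓝 p, k q.1 (T q.1 q.2) = isotopyHamiltonian J T α q := by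
  set Φ := trackMap T with hΦ
  set κ := isotopyHamiltonian J T α with hκ
  have hΦs := contMDiff_trackMap hT
  have hΦinj : Function.Injective Φ := by
    rintro ⟨t, x⟩ ⟨t', x'⟩ h
    obtain ⟨rfl, h2⟩ := Prod.mk.inj h
    exact congrArg (Prod.mk t) (hinj t h2)
  have hloc : ∀ p, ∃ g : ℝ × U → ℝ × U, ContMDiffAt (𝓘(ℝ, ℝ).prod J) (𝓘(ℝ, ℝ).prod J) ∞ g (Φ p) ∧
      g (Φ p) = p ∧ ∀ᶠ q in 𝓝 (Φ p), Φ (g q) = q := fun p ↦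
    exists_contMDiffAt_rightInverse hΦs.contMDiffAt
      (isInvertible_mfderiv_trackMap hT p (hder _ _))
  have hopen : IsOpen (range Φ) := by
    rw [isOpen_iff_mem_nhds]
    rintro _ ⟨p, rfl⟩
    obtain ⟨g, -, -, hg⟩ := hloc p
    filter_upwards [hg] with q hq using ⟨_, hq⟩
  have hext : ∀ p, Function.extend Φ κ 0 (Φ p) = κ p := hΦinj.extend_apply κ 0
  have hsm : ∀ q ∈ range Φ, ContMDiffAt (𝓘(ℝ, ℝ).prod J) 𝓘(ℝ, ℝ) ∞ (Function.extend Φ κ 0) q := by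
    rintro _ ⟨p, rfl⟩
    obtain ⟨g, hg, -, hgΦ⟩ := hloc p
    refine (ContMDiffAt.comp (Φ p) (contMDiff_isotopyHamiltonian hα hT).contMDiffAt
      hg).congr_of_eventuallyEq ?_
    filter_upwards [hgΦ] with q hq
    conv_lhs => rw [← hq]
    exact hext _
  obtain ⟨ρ, hρ, hρ1, hρc, hρs, -⟩ := exists_contMDiff_bump (𝓘(ℝ, ℝ).prod J)
    (hK.image hΦs.continuous) hopen (image_subset_range _ _)
  have hρ0 : ∀ q ∉ tsupport ρ, ρ q = 0 := fun q hq ↦ image_eq_zero_of_notMem_tsupport hq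
  refine ⟨fun t x ↦ ρ (t, x) * Function.extend Φ κ 0 (t, x), ?_, ?_, ?_⟩
  · intro q
    by_cases hq : q ∈ range Φ
    · exact hρ.contMDiffAt.mul (hsm q hq)
    · refine (contMDiffAt_const (c := (0 : ℝ))).congr_of_eventuallyEq ?_
      filter_upwards [(isClosed_tsupport ρ).isOpen_compl.mem_nhds fun h ↦ hq (hρs h)] with r hr
      exact (congrArg (· * _) (hρ0 r hr)).trans (zero_mul _)
  · obtain ⟨a, b, hab⟩ : ∃ a b, Prod.fst '' tsupport ρ ⊆ Icc a b := by
      have hb := (hρc.isCompact.image continuous_fst).isBounded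
      exact ⟨_, _, hb.subset_Icc_sInf_sSup⟩
    refine ⟨Prod.snd '' tsupport ρ, hρc.isCompact.image continuous_snd, a, b, fun t x h ↦ ?_⟩
    have h1 : ρ (t, x) = 0 := hρ0 _ fun hm ↦
      h.elim (fun h ↦ h ⟨_, hm, rfl⟩) fun h ↦ h (hab ⟨_, hm, rfl⟩)
    change ρ (t, x) * _ = 0
    rw [h1, zero_mul]
  · intro p hp
    have h1 : ∀ᶠ q in 𝓝 (Φ p), ρ q = 1 :=
      Filter.Eventually.filter_mono (nhds_le_nhdsSet (mem_image_of_mem Φ hp)) hρ1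
    filter_upwards [hΦs.continuous.continuousAt.eventually h1] with q hq
    change ρ (Φ q) * Function.extend Φ κ 0 (Φ q) = κ q
    rw [hq, hext, one_mul]

/-- The trajectories of a contact isotopy follow the Hamiltonian field of its Hamiltonian. -/
theorem IsContactForm.isHamiltonianAt_isotopyHamiltonian [FiniteDimensional ℝ E]
    [IsManifold J ∞ U] [J.Boundaryless] {α : OneForm J U} {R : ∀ x : U, TangentSpace J x}
    (h : IsContactForm J α R)
    (hT : ContMDiff (𝓘(ℝ, ℝ).prod J) J ∞ (fun p : ℝ × U ↦ T p.1 p.2))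
    (hc : ∀ t, IsContactMap J α (T t))
    (hder : ∀ t x, Function.Bijective (mfderiv J J (T t) x)) {k : ℝ → U → ℝ} {t : ℝ} {x : U}
    (hk : MDifferentiableAt J 𝓘(ℝ, ℝ) (k t) (T t x))
    (hkT : ∀ᶠ q in 𝓝 (t, x), k q.1 (T q.1 q.2) = isotopyHamiltonian J T α q) :
    ∃ v : TangentSpace J (T t x), HasVelocityAt J (fun r ↦ T r x) t v ∧
      IsHamiltonianAt J α R (k t) (T t x) v := by
  set y := extChartAt J x x with hy
  have hyt : y ∈ (extChartAt J x).target := mem_extChartAt_target x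
  have hyx : (extChartAt J x).symm y = x := extChartAt_to_inv x
  set u := inSpaceChart J T x with hu
  have hus : ContMDiffAt 𝓘(ℝ, ℝ × E) J ∞ u (t, y) := contMDiffAt_inSpaceChart hyt hT.contMDiffAt
  have hux : u (t, y) = T t x := congrArg (T t) hyx
  have hvel := mfderiv_inSpaceChart_time (hus.mdifferentiableAt (by simp))
  have hham : IsHamiltonianAt J α R (k t) (u (t, y))
      (mfderiv 𝓘(ℝ, ℝ × E) J u (t, y) ((1 : ℝ), (0 : E))) := by
    refine h.isHamiltonianAt_of_isotopy hus (ℓ := fun e ↦ α ((extChartAt J x).symm y)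
      (mfderiv 𝓘(ℝ, E) J (extChartAt J x).symm y e)) (.of_forall fun a ↦ ?_) (fun w ↦ ?_)
      (hux ▸ hk) ?_
    · obtain ⟨c, hc0, hca⟩ := hc a ((extChartAt J x).symm y)
      refine ⟨c, hc0, fun e ↦ ?_⟩
      rw [OneForm.pull_apply, mfderiv_inSpaceChart_space hyt hT.contMDiffAt]
      exact congrArg (fun L : E →L[ℝ] ℝ ↦ L (mfderiv 𝓘(ℝ, E) J (extChartAt J x).symm y e)) hca
    · obtain ⟨w', rfl⟩ := (hder t ((extChartAt J x).symm y)).2 w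
      obtain ⟨e, rfl⟩ := (mfderiv_extChartAt_symm_isInvertible (I := J) hyt).bijective.2 w'
      exact ⟨e, mfderiv_inSpaceChart_space hyt hT.contMDiffAt e⟩
    · have h1 : ContinuousAt (fun y' ↦ (t, (extChartAt J x).symm y')) y :=
        continuousAt_const.prodMk (continuousAt_extChartAt_symm x)
      have h2 : Filter.Tendsto (fun y' ↦ (t, (extChartAt J x).symm y')) (𝓝 y) (𝓝 (t, x)) := by
        have := h1.tendsto
        rwa [hyx] at this
      filter_upwards [h2.eventually hkT, extChartAt_target_mem_nhds (I := J) x] with y' h3 h4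
      exact h3.trans (isotopyHamiltonian_inSpaceChart hT h4)
  have key : ∃ v : TangentSpace J (T t ((extChartAt J x).symm y)),
      HasVelocityAt J (fun r ↦ T r ((extChartAt J x).symm y)) t v ∧
      IsHamiltonianAt J α R (k t) (T t ((extChartAt J x).symm y)) v := ⟨_, hvel, hham⟩
  rwa [hyx] at key

/-- A compactly supported smooth Hamiltonian generates elements of the contactomorphism group. -/
theorem IsContactForm.exists_hamiltonian_flow [FiniteDimensional ℝ E]
    [IsManifold J ∞ U] [J.Boundaryless] [T2Space U] {α : OneForm J U}
    {R : ∀ x : U, TangentSpace J x} (h : IsContactForm J α R) {k : ℝ → U → ℝ}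
    (hk : ContMDiff (𝓘(ℝ, ℝ).prod J) 𝓘(ℝ, ℝ) ∞ (fun p : ℝ × U ↦ k p.1 p.2))
    {D : Set U} (hD : IsCompact D) {a b : ℝ}
    (hk0 : ∀ t x, (x ∉ D ∨ t ∉ Icc a b) → k t x = 0) :
    ∃ g ∈ contactomorphismGroup J α, ∀ (c d : ℝ) (γ : ℝ → U), (0 : ℝ) ∈ Ioo c d → 1 ∈ Ioo c d →
      (∀ t ∈ Ioo c d, ∃ v, HasVelocityAt J γ t v ∧ IsHamiltonianAt J α R (k t) (γ t) v) →
      g (γ 0) = γ 1 := by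
  obtain ⟨X, hX, hXs⟩ := h.exists_hamiltonianField hk
  have hX0 : ∀ t x, (x ∉ D ∨ t ∉ Icc a b) → X t x = 0 := by
    intro t x htx
    have h1 : (fun _ ↦ (0 : ℝ)) =ᶠ[𝓝 x] k t := by
      rcases htx with hx | ht
      · filter_upwards [hD.isClosed.isOpen_compl.mem_nhds hx] with y hy
        exact (hk0 t y (.inl hy)).symm
      · exact .of_forall fun y ↦ (hk0 t y (.inr ht)).symm
    have h2 : IsHamiltonianAt J α R (fun _ ↦ (0 : ℝ)) x 0 := by
      have h3 : differential J (fun _ : U ↦ (0 : ℝ)) x = 0 := mfderiv_const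
      refine ⟨map_zero (α x), fun w ↦ ?_⟩
      rw [h3]
      have h4 : α.d J x 0 w = 0 := by
        have h5 : ∀ e : E, fderiv ℝ (α.inChart J x) (extChartAt J x x) (0 : E) e -
          fderiv ℝ (α.inChart J x) (extChartAt J x x) e (0 : E) = 0 := fun e ↦ by simp
        exact h5 w
      rw [h4]
      simp
    exact h.isHamiltonianAt_unique (hX t x) (h2.congr h1)
  obtain ⟨S, hS, hS0, hSD, hSX, hSu⟩ := exists_timeDependent_flow hXs hD hX0
  refine ⟨S 1, ⟨D, S, hD, hS.contMDiffOn, fun t ht ↦ ⟨fun x ↦ ?_, hSD t⟩, hS0, rfl⟩, ?_⟩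
  · refine ⟨_, h.isConformalFactorAt_of_hamiltonian hk (F := fun t x ↦ S t x) ht.1
      (fun a _ ↦ .of_forall fun p ↦ hS.contMDiffAt) (.of_forall fun z ↦ ?_)
      (fun a _ ↦ .of_forall fun p ↦ ⟨_, hSX p.1 p.2, hX _ _⟩)⟩
    change S 0 z = z
    rw [hS0]
    rfl
  · intro c d γ h0 h1 hγ
    refine hSu c d γ h0 (fun t ht ↦ ?_) 1 h1
    obtain ⟨v, hv, hvk⟩ := hγ t ht
    rw [h.isHamiltonianAt_unique (hX t (γ t)) hvk]
    exact hv

/-- Isotopy extension: near a compact set, the end of a contact isotopy agrees with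
a compactly supported contactomorphism which is isotopic to the identity. -/
theorem IsContactForm.exists_mem_contactomorphismGroup_eq [FiniteDimensional ℝ E]
    [IsManifold J ∞ U] [J.Boundaryless] [T2Space U] [SigmaCompactSpace U] {α : OneForm J U}
    {R : ∀ x : U, TangentSpace J x} (h : IsContactForm J α R) {S : ℝ → U → U}
    (hS : ContMDiffOn (𝓘(ℝ, ℝ).prod J) J ∞ (fun p : ℝ × U ↦ S p.1 p.2) (Icc 0 1 ×ˢ univ))
    (hSc : ∀ t ∈ Icc (0 : ℝ) 1, IsContactEmbedding J α (S t)) (hS0 : S 0 = id)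
    {C : Set U} (hC : IsCompact C) :
    ∃ g ∈ contactomorphismGroup J α, ∀ᶠ x in 𝓝ˢ C, g x = S 1 x := by
  have : LocallyCompactSpace U := Manifold.locallyCompact_of_finiteDimensional J
  obtain ⟨C', hC', hCC'⟩ := exists_compact_superset hC
  set T : ℝ → U → U := fun t ↦ S (Real.smoothTransition t) with hTdef
  have hmem : ∀ t, Real.smoothTransition t ∈ Icc (0 : ℝ) 1 := fun t ↦
    ⟨Real.smoothTransition.nonneg t, Real.smoothTransition.le_one t⟩
  have hT : ContMDiff (𝓘(ℝ, ℝ).prod J) J ∞ (fun p : ℝ × U ↦ T p.1 p.2) := by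
    have h1 : ContMDiff (𝓘(ℝ, ℝ).prod J) 𝓘(ℝ, ℝ) ∞
        (fun p : ℝ × U ↦ Real.smoothTransition p.1) :=
      Real.smoothTransition.contDiff.contMDiff.comp contMDiff_fst
    exact hS.comp_contMDiff (h1.prodMk contMDiff_snd) fun p ↦ ⟨hmem p.1, mem_univ _⟩
  have hTc : ∀ t, IsContactEmbedding J α (T t) := fun t ↦ hSc _ (hmem t)
  obtain ⟨k, hk, ⟨D, hD, a, b, hk0⟩, hkT⟩ := exists_cutoff_isotopyHamiltonian h.smooth hT
    (fun t ↦ (hTc t).2.1) (fun t x ↦ ((hTc t).bijective_mfderiv x).1)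
    ((isCompact_Icc (a := (-1 : ℝ)) (b := 2)).prod hC')
  obtain ⟨g, hg, hgγ⟩ := h.exists_hamiltonian_flow hk hD hk0
  refine ⟨g, hg, Filter.mem_of_superset (mem_nhdsSet_iff_exists.2
    ⟨interior C', isOpen_interior, hCC', subset_rfl⟩) fun x hx ↦ ?_⟩
  have h1 := hgγ (-1) 2 (fun t ↦ T t x) (by norm_num) (by norm_num) fun t ht ↦
    h.isHamiltonianAt_isotopyHamiltonian hT (fun t ↦ (hTc t).2.2)
      (fun t x ↦ (hTc t).bijective_mfderiv x)
      ((hk.comp (contMDiff_const.prodMk contMDiff_id)).mdifferentiableAt (n := ∞) (by simp))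
      (hkT (t, x) ⟨⟨ht.1.le, ht.2.le⟩, interior_subset hx⟩)
  simp only [hTdef, Real.smoothTransition.zero, Real.smoothTransition.one, hS0, id] at h1
  exact h1

end Extension


/-! ### Forward flows which come down from infinity -/

/-- A solution of `y' ≤ -c y ^ (3 / 2)` comes down from infinity in unit time. -/
theorem le_of_deriv_le_neg_mul_sqrt {y y' : ℝ → ℝ} {c m : ℝ} (hc : 0 < c) (hm : 0 < m)
    (hy : ∀ s, HasDerivAt y (y' s) s) (h0 : ∀ s, 0 ≤ s → y' s ≤ 0)
    (h1 : ∀ s, 0 ≤ s → m ≤ y s → y' s ≤ -c * (y s * √(y s))) : y 1 ≤ max m (4 / c ^ 2) := by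
  by_contra! hcon
  obtain ⟨hm1, hc1⟩ := max_lt_iff.1 hcon
  have hanti : AntitoneOn y (Icc 0 1) := antitoneOn_of_deriv_nonpos (convex_Icc 0 1)
    (fun s _ ↦ (hy s).continuousAt.continuousWithinAt)
    (fun s _ ↦ (hy s).differentiableAt.differentiableWithinAt) fun s hs ↦ by
      rw [interior_Icc] at hs
      rw [(hy s).deriv]
      exact h0 s hs.1.le
  have hlarge : ∀ s ∈ Icc (0 : ℝ) 1, m < y s := fun s hs ↦
    hm1.trans_le (hanti hs ⟨zero_le_one, le_rfl⟩ hs.2)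
  have hz : ∀ s ∈ Icc (0 : ℝ) 1, HasDerivAt (fun s ↦ (√(y s))⁻¹ - c / 2 * s)
      (-(y' s / (2 * √(y s))) / √(y s) ^ 2 - c / 2) s := by
    intro s hs
    have hpos := hm.trans (hlarge s hs)
    have h2 := (((hy s).sqrt hpos.ne').inv (Real.sqrt_pos.2 hpos).ne').sub
      ((hasDerivAt_id s).const_mul (c / 2))
    exact h2.congr_deriv (by rw [mul_one])
  have hmono : MonotoneOn (fun s ↦ (√(y s))⁻¹ - c / 2 * s) (Icc 0 1) :=
    monotoneOn_of_deriv_nonneg (convex_Icc 0 1)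
      (fun s hs ↦ (hz s hs).continuousAt.continuousWithinAt)
      (fun s hs ↦ (hz s (interior_subset hs)).differentiableAt.differentiableWithinAt)
      fun s hs ↦ by
        have hs' := interior_subset hs
        rw [(hz s hs').deriv]
        have hpos := hm.trans (hlarge s hs')
        have hq := Real.sqrt_pos.2 hpos
        have h2 := h1 s hs'.1 (hlarge s hs').le
        rw [sub_nonneg, neg_div', div_div, le_div_iff₀ (by positivity)]
        have h3 : √(y s) ^ 2 = y s := Real.sq_sqrt hpos.le
        rw [h3]
        linarith
  have h2 := hmono ⟨le_rfl, zero_le_one⟩ ⟨zero_le_one, le_rfl⟩ zero_le_one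
  simp only [mul_zero, sub_zero, mul_one] at h2
  have hpos0 := hm.trans (hlarge 0 ⟨le_rfl, zero_le_one⟩)
  have hpos1 := hm.trans (hlarge 1 ⟨zero_le_one, le_rfl⟩)
  have h3 : c / 2 ≤ (√(y 1))⁻¹ := by
    have : 0 < (√(y 0))⁻¹ := inv_pos.2 (Real.sqrt_pos.2 hpos0)
    linarith
  have hq := Real.sqrt_pos.2 hpos1
  have h4 : c / 2 * √(y 1) ≤ 1 := by
    calc c / 2 * √(y 1) ≤ (√(y 1))⁻¹ * √(y 1) := by gcongr
      _ = 1 := inv_mul_cancel₀ hq.ne'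
  have h5 : (c / 2 * √(y 1)) ^ 2 ≤ 1 := pow_le_one₀ (by positivity) h4
  rw [mul_pow, Real.sq_sqrt hpos1.le] at h5
  rw [div_lt_iff₀ (by positivity)] at hc1
  nlinarith

section SemiFlow

variable {E : Type*} [NormedAddCommGroup E] [NormedSpace ℝ E]
  {H : Type*} [TopologicalSpace H] {J : ModelWithCorners ℝ E H}
  {U : Type*} [TopologicalSpace U] [ChartedSpace H U]

theorem HasVelocityAt.congr {γ : ℝ → U} {t : ℝ} {v w : TangentSpace J (γ t)}
    (h : HasVelocityAt J γ t v) (hvw : v = w) : HasVelocityAt J γ t w := hvw ▸ h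

theorem HasVelocityAt.hasDerivAt_comp {γ : ℝ → U} {t : ℝ} {v : TangentSpace J (γ t)}
    (h : HasVelocityAt J γ t v) {f : U → ℝ} (hf : MDifferentiableAt J 𝓘(ℝ, ℝ) f (γ t)) :
    HasDerivAt (fun r ↦ f (γ r)) (differential J f (γ t) v) t := by
  have h1 : ∀ c : ℝ, c = differential J f (γ t) v →
      HasFDerivAt (fun r ↦ f (γ r)) ((1 : ℝ →L[ℝ] ℝ).smulRight c) t := by
    rintro c rfl
    refine HasMFDerivAt.hasFDerivAt
      ((HasMFDerivAt.comp t hf.hasMFDerivAt h).congr_mfderiv ?_)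
    refine ContinuousLinearMap.ext_ring ?_
    exact map_smul (differential J f (γ t)) (1 : ℝ) v
  have h2 : ∀ c : ℝ, c = differential J f (γ t) v → HasDerivAt (fun r ↦ f (γ r)) c t :=
    fun c hc ↦ (h1 c hc).hasDerivAt.congr_deriv (one_mul c)
  exact h2 _ rfl

/-- A diffeomorphism is a local diffeomorphism near each point of an open set. -/
theorem isLocalDiffeomorphAt_of_eventuallyEq {f : U → U} {x : U} (Ψ : U ≃ₘ⟮J, J⟯ U)
    (h : f =ᶠ[𝓝 x] Ψ) : IsLocalDiffeomorphAt J J ∞ f x := by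
  obtain ⟨s, hs, hso, hxs⟩ := eventually_nhds_iff.1 h
  let e := Ψ.toHomeomorph.toOpenPartialHomeomorph.restrOpen s hso
  exact ⟨{ e with
      contMDiffOn_toFun := Ψ.contMDiff.contMDiffOn
      contMDiffOn_invFun := Ψ.symm.contMDiff.contMDiffOn },
    ⟨mem_univ _, hxs⟩, fun y hy ↦ hs y hy.2⟩

variable [IsManifold J ∞ U] [J.Boundaryless] [FiniteDimensional ℝ E] [T2Space U]

/-- A smooth field with a proper Lyapunov function, cut off outside a sublevel set. -/
theorem exists_cutoff_flow {X : ∀ x : U, TangentSpace J x} (hX : IsSmoothField J X)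
    {e : U → ℝ} (he : ContMDiff J 𝓘(ℝ, ℝ) ∞ e) (hproper : ∀ c, IsCompact {x | e x ≤ c})
    (hdec : ∀ x, differential J e x (X x) ≤ 0) (c : ℝ) :
    ∃ (ρ : U → ℝ) (ψ : ℝ → (U ≃ₘ⟮J, J⟯ U)), (∀ᶠ x in 𝓝ˢ {x | e x ≤ c}, ρ x = 1) ∧
      ContMDiff (𝓘(ℝ, ℝ).prod J) J ∞ (fun p : ℝ × U ↦ ψ p.1 p.2) ∧ (∀ x, ψ 0 x = x) ∧
      (∀ x, IsMIntegralCurve (fun t ↦ ψ t x) (fun x ↦ ρ x • X x)) ∧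
      IsSmoothField J (fun x ↦ ρ x • X x) ∧
      ∀ x, Antitone fun t ↦ e (ψ t x) := by
  have : SigmaCompactSpace U := ⟨⟨fun n ↦ {x | e x ≤ n}, fun n ↦ hproper n,
    eq_univ_of_forall fun x ↦ mem_iUnion.2 ⟨⌈e x⌉₊, show e x ≤ _ from Nat.le_ceil _⟩⟩⟩
  obtain ⟨ρ, hρ, hρ1, hρc, -, hρ01⟩ := exists_contMDiff_bump J (hproper c) isOpen_univ
    (subset_univ _)
  have hY : IsSmoothField J (fun x ↦ ρ x • X x) := ContMDiff.smul_section hρ hX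
  have hcomplete : ∀ x, ∃ γ : ℝ → U, γ 0 = x ∧ IsMIntegralCurve γ (fun x ↦ ρ x • X x) := by
    refine hY.exists_integralCurve_of_isCompact hρc.isCompact fun x hx ↦
      ⟨fun _ ↦ x, rfl, fun t _ ↦ ?_⟩
    have h1 : ρ x • X x = 0 := by rw [image_eq_zero_of_notMem_tsupport hx, zero_smul]
    exact ((hasVelocityAt_const (J := J) x t).congr h1.symm).hasMFDerivWithinAt
  obtain ⟨φ, hφ, hφ0, hφint, hφadd⟩ := hY.exists_flow hcomplete
  have hsl : ∀ t, ContMDiff J J ∞ (φ t) := fun t ↦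
    hφ.comp (contMDiff_const.prodMk contMDiff_id)
  refine ⟨ρ, fun t ↦
    { toFun := φ t
      invFun := φ (-t)
      left_inv := fun x ↦ by rw [← hφadd, neg_add_cancel, hφ0]
      right_inv := fun x ↦ by rw [← hφadd, add_neg_cancel, hφ0]
      contMDiff_toFun := hsl t
      contMDiff_invFun := hsl (-t) }, hρ1, hφ, hφ0, hφint, hY, fun x ↦ ?_⟩
  have h1 : ∀ t, HasDerivAt (fun t ↦ e (φ t x)) _ t := fun t ↦
    HasVelocityAt.hasDerivAt_comp (hφint x t) (he.mdifferentiableAt (by simp))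
  refine antitone_of_deriv_nonpos (f := fun t ↦ e (φ t x)) (fun t ↦ (h1 t).differentiableAt)
    fun t ↦ ?_
  rw [(h1 t).deriv]
  have h2 : differential J e (φ t x) (ρ (φ t x) • X (φ t x)) =
      ρ (φ t x) * differential J e (φ t x) (X (φ t x)) := map_smul _ _ _
  rw [h2]
  exact mul_nonpos_of_nonneg_of_nonpos (hρ01 _).1 (hdec _)

variable {α : OneForm J U} {R : ∀ x : U, TangentSpace J x}

/-- A Hamiltonian whose vector field comes down from infinity generates, for positive times,
a family of contact embeddings. -/
theorem IsContactForm.exists_semiflow (h : IsContactForm J α R) {k e : U → ℝ}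
    (hk : ContMDiff J 𝓘(ℝ, ℝ) ∞ k) (he : ContMDiff J 𝓘(ℝ, ℝ) ∞ e)
    (hproper : ∀ c, IsCompact {x | e x ≤ c})
    (hdec : ∀ x v, IsHamiltonianAt J α R k x v → differential J e x v ≤ 0)
    {c m : ℝ} (hc : 0 < c) (hm : 0 < m)
    (hdec' : ∀ x v, IsHamiltonianAt J α R k x v → m ≤ e x →
      differential J e x v ≤ -c * (e x * √(e x)))
    (hR : ∀ x, differential J k x (R x) ≤ -1) :
    ∃ φ : ℝ → U → U,
      ContMDiffOn (𝓘(ℝ, ℝ).prod J) J ∞ (fun p : ℝ × U ↦ φ p.1 p.2) (Ici 0 ×ˢ univ) ∧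
      φ 0 = id ∧ (∀ s, 0 ≤ s → IsContactEmbedding J α (φ s)) ∧
      (∀ s, 0 ≤ s → ∀ x, ∃ a ≤ Real.exp (-s), IsConformalFactorAt J α (φ s) x a) ∧
      (∀ s, 0 ≤ s → ∀ x, e (φ s x) ≤ e x) ∧ ∀ x, e (φ 1 x) ≤ max m (4 / c ^ 2) := by
  have hk' : ContMDiff (𝓘(ℝ, ℝ).prod J) 𝓘(ℝ, ℝ) ∞ fun p : ℝ × U ↦ k p.2 :=
    hk.comp contMDiff_snd
  obtain ⟨X', hX', hX's⟩ := h.exists_hamiltonianField (k := fun _ ↦ k) hk'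
  set X : ∀ x : U, TangentSpace J x := X' 0 with hXdef
  have hX : ∀ x, IsHamiltonianAt J α R k x (X x) := hX' 0
  have hXs : IsSmoothField J X := hX's.comp ((contMDiff_const (c := (0 : ℝ))).prodMk contMDiff_id)
  choose ρ ψ hρ hψ hψ0 hψint hY hanti using fun c ↦
    exists_cutoff_flow hXs he hproper (fun x ↦ hdec x _ (hX x)) c
  have hslow : ∀ (n : ℝ) {P : U → Prop}, (∀ᶠ y in 𝓝ˢ {x | e x ≤ n}, P y) → ∀ x, e x ≤ n →
      ∃ δ > 0, ∀ r, -δ < r → P (ψ n r x) := by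
    intro n P hP x hx
    have h1 : ∀ᶠ r in 𝓝 (0 : ℝ), P (ψ n r x) := by
      have h2 : ContinuousAt (fun r ↦ ψ n r x) 0 := (hψint n x).continuous.continuousAt
      refine h2.eventually (Filter.Eventually.filter_mono (nhds_le_nhdsSet ?_) hP)
      change e (ψ n 0 x) ≤ n
      rwa [hψ0]
    obtain ⟨δ, hδ, hδP⟩ := Metric.eventually_nhds_iff_ball.1 h1
    refine ⟨δ, hδ, fun r hr ↦ ?_⟩
    rcases le_or_gt 0 r with h0 | h0
    · refine Filter.Eventually.self_of_nhdsSet hP _ ?_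
      have h3 := hanti n x h0
      simp only [hψ0] at h3
      exact h3.trans hx
    · exact hδP r (by rw [Real.ball_eq_Ioo]; constructor <;> linarith)
  have hvel : ∀ n x, e x ≤ n → ∃ δ > 0, ∀ r, -δ < r →
      HasVelocityAt J (fun r ↦ ψ n r x) r (X (ψ n r x)) := by
    intro n x hx
    obtain ⟨δ, hδ, h1⟩ := hslow n (hρ n) x hx
    refine ⟨δ, hδ, fun r hr ↦ ?_⟩
    have h2 := hψint n x r
    simp only [h1 r hr, one_smul] at h2
    exact h2
  have hcons : ∀ n n' x, e x ≤ n → n ≤ n' → ∀ s, 0 ≤ s → ψ n s x = ψ n' s x := by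
    intro n n' x hx hn s hs
    have hρ' : ∀ᶠ y in 𝓝ˢ {x | e x ≤ n}, ρ n' y = 1 :=
      (hρ n').filter_mono (nhdsSet_mono fun y hy ↦ le_trans hy hn)
    obtain ⟨δ, hδ, h1⟩ := hslow n hρ' x hx
    obtain ⟨δ', hδ', h2⟩ := hvel n x hx
    have h0 : (0 : ℝ) ∈ Ioo (-min δ δ') (s + 1) := ⟨by simp [hδ, hδ'], by linarith⟩
    refine isMIntegralCurveOn_Ioo_eqOn_of_contMDiff_boundaryless (I := J)
      (v := fun x ↦ ρ n' x • X x) (γ := fun r ↦ ψ n r x)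
      (γ' := fun r ↦ ψ n' r x) h0 ((hY n').of_le (by simp)) (fun r hr ↦ ?_)
      ((hψint n' x).isMIntegralCurveOn _) (by rw [hψ0, hψ0]) ⟨by linarith [h0.1], by linarith⟩
    have h3 := h2 r ((neg_le_neg (min_le_right _ _)).trans_lt hr.1)
    have h4 : ρ n' (ψ n r x) • X (ψ n r x) = X (ψ n r x) := by
      rw [h1 r ((neg_le_neg (min_le_left _ _)).trans_lt hr.1), one_smul]
    exact (h3.congr h4.symm).hasMFDerivWithinAt
  set φ : ℝ → U → U := fun s x ↦ ψ (e x) s x with hφ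
  have hφψ : ∀ n x, e x ≤ n → ∀ s, 0 ≤ s → φ s x = ψ n s x := fun n x hx s hs ↦
    hcons (e x) n x le_rfl hx s hs
  have hnear : ∀ x, ∀ᶠ y in 𝓝 x, e y ≤ e x + 1 := fun x ↦
    (he.continuous.continuousAt.eventually_lt continuousAt_const
      (lt_add_one (e x))).mono fun y hy ↦ hy.le
  have hφnear : ∀ s, 0 ≤ s → ∀ x, φ s =ᶠ[𝓝 x] ψ (e x + 1) s := fun s hs x ↦
    (hnear x).mono fun y hy ↦ hφψ _ y hy s hs
  have hconf : ∀ s, 0 ≤ s → ∀ x, ∃ a ≤ Real.exp (-s), IsConformalFactorAt J α (φ s) x a := by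
    intro s hs x
    set n := e x + 1 with hn
    have hcont : Continuous fun p : ℝ × U ↦ ψ n p.1 p.2 := (hψ n).continuous
    have h1 := h.isConformalFactorAt_of_hamiltonian (k := fun _ ↦ k) hk' (F := fun t x ↦ ψ n t x) hs (x := x)
      (fun a _ ↦ .of_forall fun p ↦ (hψ n).contMDiffAt) (.of_forall fun z ↦ hψ0 n z)
      (fun a ha ↦ by
        have h2 : e (ψ n a x) ≤ n := by
          have := hanti n x ha.1
          simp only [hψ0] at this
          linarith
        have h3 : ∀ᶠ p in 𝓝 (a, x), ρ n (ψ n p.1 p.2) = 1 :=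
          (hcont.tendsto (a, x)).eventually (Filter.Eventually.filter_mono
            (nhds_le_nhdsSet (show ψ n a x ∈ {x | e x ≤ n} from h2)) (hρ n))
        filter_upwards [h3] with p hp
        refine ⟨X (ψ n p.1 p.2), ?_, hX _⟩
        have h4 := hψint n p.2 p.1
        simp only [hp, one_smul] at h4
        exact h4)
    refine ⟨Real.exp (∫ a in (0 : ℝ)..s, differential J k (ψ n a x) (R (ψ n a x))), ?_, ?_⟩
    rotate_left
    · rw [IsConformalFactorAt, (hφnear s hs x).mfderiv_eq, (hφnear s hs x).self_of_nhds]
      exact h1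
    · refine Real.exp_le_exp.2 ?_
      have hd : Continuous fun a ↦ differential J k (ψ n a x) (R (ψ n a x)) :=
        (h.continuous_differential_reeb (k := fun _ ↦ k) hk').comp
          (continuous_const (y := (0 : ℝ)).prodMk (hψint n x).continuous)
      calc ∫ a in (0 : ℝ)..s, differential J k (ψ n a x) (R (ψ n a x))
          ≤ ∫ a in (0 : ℝ)..s, (-1 : ℝ) := intervalIntegral.integral_mono hs
            (hd.intervalIntegrable _ _) intervalIntegrable_const fun a ↦ hR _
        _ = -s := by simp
  refine ⟨φ, ?_, funext fun x ↦ hψ0 _ x, fun s hs ↦ ⟨fun x ↦ ?_, fun x y hxy ↦ ?_, fun x ↦ ?_⟩,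
    hconf, fun s hs x ↦ ?_, fun x ↦ ?_⟩
  · rintro ⟨s, x⟩ ⟨hs, -⟩
    refine ((hψ (e x + 1)).contMDiffAt.contMDiffWithinAt).congr_of_eventuallyEq ?_
      (hφψ _ x (by linarith) s hs)
    have h1 : ∀ᶠ p : ℝ × U in 𝓝 (s, x), e p.2 ≤ e x + 1 :=
      (continuous_snd.tendsto (s, x)).eventually (hnear x)
    filter_upwards [nhdsWithin_le_nhds h1, self_mem_nhdsWithin] with p hp hp'
    exact hφψ _ p.2 hp p.1 hp'.1
  · exact isLocalDiffeomorphAt_of_eventuallyEq _ (hφnear s hs x)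
  · rw [hφψ _ x (le_max_left _ _) s hs, hφψ _ y (le_max_right _ _) s hs] at hxy
    exact (ψ (max (e x) (e y)) s).injective hxy
  · obtain ⟨a, -, ha⟩ := hconf s hs x
    exact ⟨a, ha⟩
  · have := hanti (e x) x hs
    simp only [hψ0] at this
    exact this
  · obtain ⟨δ, hδ, h1⟩ := hvel (e x) x le_rfl
    have h2 : ∀ t, HasDerivAt (fun t ↦ e (ψ (e x) t x)) _ t := fun t ↦
      HasVelocityAt.hasDerivAt_comp (hψint (e x) x t) (he.mdifferentiableAt (by simp))
    have h3 : ∀ t, 0 ≤ t → ρ (e x) (ψ (e x) t x) • X (ψ (e x) t x) = X (ψ (e x) t x) :=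
      fun t ht ↦ hasMFDerivAt_curve_unique (hψint (e x) x t) (h1 t (by linarith))
    refine le_of_deriv_le_neg_mul_sqrt hc hm h2 (fun t ht ↦ ?_) (fun t ht hmt ↦ ?_)
    · refine (le_of_eq (congrArg (differential J e (ψ (e x) t x)) (h3 t ht))).trans ?_
      exact hdec _ _ (hX _)
    · refine (le_of_eq (congrArg (differential J e (ψ (e x) t x)) (h3 t ht))).trans ?_
      exact hdec' _ _ (hX _) hmt

end SemiFlow


/-! ### Non-orderability up to conjugation from a flow which comes down from infinity -/

section NonOrderable

variable {E : Type*} [NormedAddCommGroup E] [NormedSpace ℝ E]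
  {H : Type*} [TopologicalSpace H] {J : ModelWithCorners ℝ E H}
  {U : Type*} [TopologicalSpace U] [ChartedSpace H U]
  {α : OneForm J U} {R : ∀ x : U, TangentSpace J x}

theorem IsContactForm.ne_zero (h : IsContactForm J α R) (x : U) : α x ≠ 0 := by
  intro h0
  have h1 := h.apply_reeb x
  rw [h0] at h1
  exact zero_ne_one h1

theorem IsConformalFactorAt.comp {φ ψ : U → U} {x : U} {a b : ℝ}
    (hψ : IsConformalFactorAt J α ψ (φ x) b) (hφ : IsConformalFactorAt J α φ x a)
    (hψd : MDifferentiableAt J J ψ (φ x)) (hφd : MDifferentiableAt J J φ x) :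
    IsConformalFactorAt J α (ψ ∘ φ) x (b * a) := by
  refine ⟨mul_pos hψ.1 hφ.1, ?_⟩
  rw [mfderiv_comp x hψd hφd]
  have h1 := congrArg (fun L : E →L[ℝ] ℝ ↦ L.comp (mfderiv J J φ x)) hψ.2
  refine h1.trans ?_
  change b • (α (φ x)).comp (mfderiv J J φ x) = (b * a) • α x
  rw [hφ.2, smul_smul]

theorem IsConformalFactorAt.congr {φ ψ : U → U} {x : U} {a : ℝ}
    (h : IsConformalFactorAt J α φ x a) (hφψ : ψ =ᶠ[𝓝 x] φ) : IsConformalFactorAt J α ψ x a := by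
  rw [IsConformalFactorAt, hφψ.mfderiv_eq, hφψ.self_of_nhds]
  exact h

theorem trans_mem_contactomorphismGroup {g g' : U ≃ₘ⟮J, J⟯ U}
    (hg : g ∈ contactomorphismGroup J α) (hg' : g' ∈ contactomorphismGroup J α) :
    g.trans g' ∈ contactomorphismGroup J α := by
  obtain ⟨C, S, hC, hS, hSc, hS0, rfl⟩ := hg
  obtain ⟨C', S', hC', hS', hSc', hS0', rfl⟩ := hg'
  refine ⟨C ∪ C', fun t ↦ (S t).trans (S' t), hC.union hC', ?_, fun t ht ↦ ⟨fun x ↦ ?_,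
    fun x hx ↦ ?_⟩, ?_, rfl⟩
  · exact hS'.comp (contMDiff_fst.contMDiffOn.prodMk hS) fun p hp ↦ ⟨hp.1, mem_univ _⟩
  · obtain ⟨a, ha⟩ := (hSc t ht).1 x
    obtain ⟨b, hb⟩ := (hSc' t ht).1 (S t x)
    exact ⟨b * a, hb.comp ha ((S' t).contMDiff.mdifferentiableAt (by simp))
      ((S t).contMDiff.mdifferentiableAt (by simp))⟩
  · have h1 : S t x = x := (hSc t ht).2 x fun h ↦ hx (.inl h)
    have h2 : S' t x = x := (hSc' t ht).2 x fun h ↦ hx (.inr h)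
    change S' t (S t x) = x
    rw [h1, h2]
  · refine Diffeomorph.ext fun x ↦ ?_
    change S' 0 (S 0 x) = x
    rw [hS0, hS0']
    rfl

variable [IsManifold J ∞ U] [J.Boundaryless] [FiniteDimensional ℝ E]

/-- The conformal factor of a smooth contact map is bounded on compact sets. -/
theorem IsContactForm.exists_conformalFactor_le (h : IsContactForm J α R) {g : U → U}
    (hg : ContMDiff J J ∞ g) (hgc : IsContactMap J α g) {C : Set U} (hC : IsCompact C) :
    ∃ B, ∀ x ∈ C, conformalFactor J α g x ≤ B := by
  have hcont : Continuous (conformalFactor J α g) := by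
    rw [continuous_iff_continuousAt]
    intro x
    have hy := mem_extChartAt_target (I := J) x
    have hs := (contMDiffAt_extChartAt_symm hy)
    have hu : ContMDiffAt 𝓘(ℝ, E) J ∞ (g ∘ (extChartAt J x).symm) (extChartAt J x x) :=
      hg.contMDiffAt.comp _ hs
    have h1 : ContinuousAt (fun y ↦ α.pull J (g ∘ (extChartAt J x).symm) y (fieldInChart J R x y))
        (extChartAt J x x) :=
      (h.smooth.contDiffAt_pull hu).continuousAt.clm_apply
        ((h.contDiffOn_reeb x).continuousOn.continuousAt (extChartAt_target_mem_nhds (I := J) x))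
    refine (ContinuousAt.comp (x := x) h1 (continuousAt_extChartAt (I := J) x)).congr ?_
    filter_upwards [extChartAt_source_mem_nhds (I := J) x] with z hz
    have hzt := (extChartAt J x).map_source hz
    have hzx : (extChartAt J x).symm (extChartAt J x z) = z := (extChartAt J x).left_inv hz
    change α.pull J (g ∘ (extChartAt J x).symm) (extChartAt J x z)
      (fieldInChart J R x (extChartAt J x z)) = _
    rw [OneForm.pull_apply, mfderiv_comp (extChartAt J x z)
      (hg.mdifferentiableAt (by simp))
      ((contMDiffAt_extChartAt_symm hzt).mdifferentiableAt (by simp))]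
    have key : ∀ w, w = (extChartAt J x).symm (extChartAt J x z) →
        α (g w) (mfderiv J J g w (R w)) = conformalFactor J α g w := by
      rintro w -
      have h2 := congrArg (fun L : E →L[ℝ] ℝ ↦ L (R w)) (conformalFactor_spec hgc w).2
      refine h2.trans ?_
      change conformalFactor J α g w * α w (R w) = _
      rw [h.apply_reeb, mul_one]
    have h3 := key _ rfl
    rw [hzx] at h3
    refine Eq.trans ?_ h3
    have h4 := mfderiv_extChartAt_symm_fieldInChart R hzt
    refine Eq.trans (congrArg (fun v : E ↦ α (g ((extChartAt J x).symm (extChartAt J x z)))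
      (mfderiv J J g ((extChartAt J x).symm (extChartAt J x z)) v)) h4) ?_
    rw [hzx]
  obtain ⟨B, hB⟩ := (hC.image hcont).bddAbove
  exact ⟨B, fun x hx ↦ hB ⟨x, hx, rfl⟩⟩

variable [T2Space U]

/-- The maximal cone is non-orderable up to conjugation as soon as there is a contact Hamiltonian
whose flow comes down from infinity in finite time and contracts the contact form. -/
theorem IsContactForm.nonOrderableUpToConjugation (h : IsContactForm J α R) {k e : U → ℝ}
    (hk : ContMDiff J 𝓘(ℝ, ℝ) ∞ k) (he : ContMDiff J 𝓘(ℝ, ℝ) ∞ e)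
    (hproper : ∀ c, IsCompact {x | e x ≤ c})
    (hdec : ∀ x v, IsHamiltonianAt J α R k x v → differential J e x v ≤ 0)
    {c m : ℝ} (hc : 0 < c) (hm : 0 < m)
    (hdec' : ∀ x v, IsHamiltonianAt J α R k x v → m ≤ e x →
      differential J e x v ≤ -c * (e x * √(e x)))
    (hR : ∀ x, differential J k x (R x) ≤ -1) : NonOrderableUpToConjugation J α := by
  have : SigmaCompactSpace U := ⟨⟨fun n ↦ {x | e x ≤ n}, fun n ↦ hproper n,
    eq_univ_of_forall fun x ↦ mem_iUnion.2 ⟨⌈e x⌉₊, show e x ≤ _ from Nat.le_ceil _⟩⟩⟩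
  obtain ⟨φ, hφ, hφ0, hφe, hφc, hφE, hφ1⟩ :=
    h.exists_semiflow hk he hproper hdec hc hm hdec' hR
  set b := max m (4 / c ^ 2) with hb
  have hσ : φ 1 ∈ contractingEmbeddings J α := by
    refine ⟨(hproper b).closure_of_subset ?_, φ,
      hφ.mono (prod_mono (fun t ht ↦ ht.1) subset_rfl), fun t ht ↦ hφe t ht.1, hφ0, rfl⟩
    rintro _ ⟨x, rfl⟩
    exact hφ1 x
  have hsqueeze : ∀ K₁ ∈ maximalCone J α, ∀ K₂ ∈ maximalCone J α,
      ∃ g ∈ contactomorphismGroup J α, ∀ x, adjoint J α g K₁ x ≤ K₂ x := by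
    rintro K₁ ⟨⟨hK₁s, hK₁c⟩, hK₁0, -⟩ K₂ ⟨⟨hK₂s, -⟩, hK₂0, σ, ⟨-, S, hS, hSc, hS0, rfl⟩, hpos⟩
    obtain ⟨c₁, hc₁⟩ : ∃ c₁, tsupport K₁ ⊆ {x | e x ≤ c₁} := by
      obtain ⟨c₁, hc₁⟩ := (hK₁c.isCompact.image he.continuous).bddAbove
      exact ⟨c₁, fun x hx ↦ hc₁ ⟨x, hx, rfl⟩⟩
    obtain ⟨g₂, hg₂, hg₂S⟩ := h.exists_mem_contactomorphismGroup_eq hS hSc hS0 (hproper c₁)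
    have hg₂C : ∀ x, e x ≤ c₁ → g₂ x = S 1 x := fun x hx ↦
      Filter.Eventually.self_of_nhdsSet hg₂S x hx
    have hg₂c : IsContactMap J α g₂ := by
      obtain ⟨_, S', _, _, hS'c, _, rfl⟩ := hg₂
      exact (hS'c 1 ⟨zero_le_one, le_rfl⟩).1
    obtain ⟨B, hB⟩ := h.exists_conformalFactor_le g₂.contMDiff hg₂c (hproper c₁)
    obtain ⟨M, hM⟩ := (hK₁c.isCompact.image hK₁s.continuous).bddAbove
    obtain ⟨ε, hε, hεK⟩ := (hproper c₁).exists_forall_le'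
      (f := fun x ↦ K₂ (g₂ x)) (hK₂s.continuous.comp g₂.contMDiff.continuous).continuousOn (a := 0)
      fun x hx ↦ by rw [hg₂C x hx]; exact hpos _ ⟨x, rfl⟩
    obtain ⟨s, hs0, hs⟩ : ∃ s : ℝ, 0 ≤ s ∧ Real.exp (-s) * (max B 0 * max M 0) ≤ ε := by
      have h1 : Filter.Tendsto (fun s : ℝ ↦ Real.exp (-s) * (max B 0 * max M 0))
          Filter.atTop (𝓝 (0 * (max B 0 * max M 0))) :=
        (Real.tendsto_exp_atBot.comp Filter.tendsto_neg_atTop_atBot).mul_const _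
      rw [zero_mul] at h1
      obtain ⟨s, h2, h3⟩ :=
        ((h1.eventually (ge_mem_nhds hε)).and (Filter.eventually_ge_atTop 0)).exists
      exact ⟨s, h3, h2⟩
    obtain ⟨g₁, hg₁, hg₁φ⟩ := h.exists_mem_contactomorphismGroup_eq (S := fun t ↦ φ (s * t))
      (hφ.comp (t := Ici 0 ×ˢ univ) (f := fun p : ℝ × U ↦ (s * p.1, p.2))
        ((contMDiffOn_const.mul contMDiffOn_fst).prodMk contMDiffOn_snd)
        fun p hp ↦ ⟨mul_nonneg hs0 hp.1.1, mem_univ _⟩)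
      (fun t ht ↦ hφe _ (mul_nonneg hs0 ht.1)) (by simp only [mul_zero, hφ0]) hK₁c.isCompact
    simp only [mul_one] at hg₁φ
    refine ⟨g₁.trans g₂, trans_mem_contactomorphismGroup hg₁ hg₂, fun x ↦ ?_⟩
    set y := (g₁.trans g₂).symm x with hy
    have hyx : g₂ (g₁ y) = x := (g₁.trans g₂).apply_symm_apply x
    change conformalFactor J α (g₁.trans g₂) y * K₁ y ≤ K₂ x
    by_cases hyK : y ∈ tsupport K₁
    · have h1 : (g₁ : U → U) =ᶠ[𝓝 y] φ s :=
        Filter.Eventually.filter_mono (nhds_le_nhdsSet hyK) hg₁φ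
      obtain ⟨a, ha, haφ⟩ := hφc s hs0 y
      have hg₁y : e (g₁ y) ≤ c₁ := by
        rw [h1.self_of_nhds]
        exact (hφE s hs0 y).trans (hc₁ hyK)
      have h2 := conformalFactor_eq (h.ne_zero y)
        ((conformalFactor_spec hg₂c (g₁ y)).comp (haφ.congr h1)
          (g₂.contMDiff.mdifferentiableAt (by simp)) (g₁.contMDiff.mdifferentiableAt (by simp)))
      have h3 : conformalFactor J α (g₁.trans g₂) y = conformalFactor J α g₂ (g₁ y) * a := h2
      have h4 := (conformalFactor_spec hg₂c (g₁ y)).1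
      rw [h3]
      calc conformalFactor J α g₂ (g₁ y) * a * K₁ y
          ≤ max B 0 * Real.exp (-s) * max M 0 := by
            gcongr
            · exact hK₁0 y
            · exact haφ.1.le
            · exact (hB _ hg₁y).trans (le_max_left _ _)
            · exact (hM ⟨y, hyK, rfl⟩).trans (le_max_left _ _)
        _ = Real.exp (-s) * (max B 0 * max M 0) := by ring
        _ ≤ ε := hs
        _ ≤ K₂ x := by
          rw [← hyx]
          exact hεK _ hg₁y
    · rw [image_eq_zero_of_notMem_tsupport hyK, mul_zero]
      exact hK₂0 x
  refine ⟨?_, hsqueeze⟩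
  obtain ⟨K, hK, hK1, hKc, -, hK01⟩ := exists_contMDiff_bump J (hproper b) isOpen_univ
    (subset_univ _)
  have hKpos : ∀ x ∈ range (φ 1), K x = 1 := by
    rintro _ ⟨x, rfl⟩
    exact Filter.Eventually.self_of_nhdsSet hK1 _ (hφ1 x)
  have hKmem : K ∈ maximalCone J α := ⟨⟨hK, hKc⟩, fun x ↦ (hK01 x).1, φ 1, hσ, fun x hx ↦ by
    rw [hKpos x hx]; exact one_pos⟩
  have hKmem' : (fun x ↦ 2⁻¹ * K x) ∈ maximalCone J α :=
    ⟨⟨contMDiff_const.mul hK, hKc.mul_left⟩, fun x ↦ mul_nonneg (by norm_num) (hK01 x).1, φ 1, hσ,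
      fun x hx ↦ mul_pos (by norm_num) (by rw [hKpos x hx]; exact one_pos)⟩
  obtain ⟨g, hg, hgK⟩ := hsqueeze K hKmem _ hKmem'
  exact ⟨K, hKmem, g, hg, 2⁻¹, by norm_num, by norm_num, hgK⟩

end NonOrderable


/-! ### Contactizations of exact symplectic manifolds -/

section Contactization

variable {E : Type*} [NormedAddCommGroup E] [NormedSpace ℝ E]
  {H : Type*} [TopologicalSpace H] {I : ModelWithCorners ℝ E H}
  {V : Type*} [TopologicalSpace V] [ChartedSpace H V] {lam : OneForm I V}

theorem contactization_apply (lam : OneForm I V) (p : V × ℝ) (w : E) (r : ℝ) :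
    contactization I lam p ((w, r) : E × ℝ) = lam p.1 w + r := by
  rw [contactization, mfderiv_fst, mfderiv_snd]
  rfl

variable (I V) in
/-- The field `∂/∂t` on `V × ℝ`. -/
def verticalField (p : V × ℝ) : TangentSpace (I.prod 𝓘(ℝ, ℝ)) p := ((0 : E), (1 : ℝ))

variable [IsManifold I ∞ V] [I.Boundaryless]

theorem contactization_inChart (lam : OneForm I V) {p : V × ℝ} {q : E × ℝ}
    (hq : q.1 ∈ (extChartAt I p.1).target) (w : E × ℝ) :
    (contactization I lam).inChart (I.prod 𝓘(ℝ, ℝ)) p q w = lam.inChart I p.1 q.1 w.1 + w.2 := by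
  have hχ : (extChartAt (I.prod 𝓘(ℝ, ℝ)) p).symm =
      fun q : E × ℝ ↦ ((extChartAt I p.1).symm q.1, q.2) := by
    rw [extChartAt_prod]
    rfl
  have h1 : HasMFDerivAt 𝓘(ℝ, E × ℝ) I (fun q : E × ℝ ↦ (extChartAt I p.1).symm q.1) q
      ((mfderiv 𝓘(ℝ, E) I (extChartAt I p.1).symm q.1).comp (ContinuousLinearMap.fst ℝ E ℝ)) :=
    HasMFDerivAt.comp (g := (extChartAt I p.1).symm) (f := Prod.fst) q
      ((contMDiffAt_extChartAt_symm hq).mdifferentiableAt (by simp)).hasMFDerivAt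
      hasFDerivAt_fst.hasMFDerivAt
  have h2 : HasMFDerivAt 𝓘(ℝ, E × ℝ) 𝓘(ℝ, ℝ) (Prod.snd : E × ℝ → ℝ) q
      (ContinuousLinearMap.snd ℝ E ℝ) := hasFDerivAt_snd.hasMFDerivAt
  have h3 := (h1.prodMk h2).mfderiv
  rw [OneForm.inChart, hχ]
  change contactization I lam ((extChartAt I p.1).symm q.1, q.2)
    (mfderiv 𝓘(ℝ, E × ℝ) (I.prod 𝓘(ℝ, ℝ))
      (fun q : E × ℝ ↦ ((extChartAt I p.1).symm q.1, q.2)) q w) = _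
  rw [h3]
  exact contactization_apply lam ((extChartAt I p.1).symm q.1, q.2)
    (mfderiv 𝓘(ℝ, E) I (extChartAt I p.1).symm q.1 w.1) w.2

theorem mem_extChartAt_prod_target {p : V × ℝ} {q : E × ℝ} :
    q ∈ (extChartAt (I.prod 𝓘(ℝ, ℝ)) p).target ↔ q.1 ∈ (extChartAt I p.1).target := by
  rw [extChartAt_prod, PartialEquiv.prod_target, mem_prod, extChartAt_model_space_eq_id]
  simp

theorem contactization_inChart_eq (lam : OneForm I V) {p : V × ℝ} {q : E × ℝ}
    (hq : q ∈ (extChartAt (I.prod 𝓘(ℝ, ℝ)) p).target) :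
    (contactization I lam).inChart (I.prod 𝓘(ℝ, ℝ)) p q =
      (lam.inChart I p.1 q.1).comp (ContinuousLinearMap.fst ℝ E ℝ) +
        ContinuousLinearMap.snd ℝ E ℝ :=
  ContinuousLinearMap.ext fun w ↦
    contactization_inChart lam (mem_extChartAt_prod_target.1 hq) w

theorem OneForm.IsSmoothInCharts.contactization (hlam : lam.IsSmoothInCharts I) :
    (contactization I lam).IsSmoothInCharts (I.prod 𝓘(ℝ, ℝ)) := by
  intro p
  have h1 : ContDiffOn ℝ ∞ (fun q : E × ℝ ↦ (lam.inChart I p.1 q.1).comp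
      (ContinuousLinearMap.fst ℝ E ℝ) + ContinuousLinearMap.snd ℝ E ℝ)
      (extChartAt (I.prod 𝓘(ℝ, ℝ)) p).target :=
    ((((hlam p.1).comp contDiffOn_fst fun q hq ↦
      mem_extChartAt_prod_target.1 hq)).clm_comp contDiffOn_const).add contDiffOn_const
  exact h1.congr fun q hq ↦ contactization_inChart_eq lam hq

theorem contactization_d (hlam : lam.IsSmoothInCharts I) (p : V × ℝ) (v w : E × ℝ) :
    (contactization I lam).d (I.prod 𝓘(ℝ, ℝ)) p v w = lam.d I p.1 v.1 w.1 := by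
  set q₀ := extChartAt (I.prod 𝓘(ℝ, ℝ)) p p with hq₀
  have hq : q₀.1 = extChartAt I p.1 p.1 := by rw [hq₀, extChartAt_prod]; rfl
  have hd : DifferentiableAt ℝ (lam.inChart I p.1) q₀.1 := by
    rw [hq]
    exact (hlam.contDiffAt_inChart (mem_extChartAt_target p.1)).differentiableAt (by simp)
  have hL : ∀ a b : E × ℝ, fderiv ℝ ((contactization I lam).inChart (I.prod 𝓘(ℝ, ℝ)) p) q₀ a b =
      fderiv ℝ (lam.inChart I p.1) (extChartAt I p.1 p.1) a.1 b.1 := by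
    intro a b
    have h1 : (contactization I lam).inChart (I.prod 𝓘(ℝ, ℝ)) p =ᶠ[𝓝 q₀] fun q : E × ℝ ↦
        (lam.inChart I p.1 q.1).comp (ContinuousLinearMap.fst ℝ E ℝ) +
          ContinuousLinearMap.snd ℝ E ℝ := by
      filter_upwards [extChartAt_target_mem_nhds (I := I.prod 𝓘(ℝ, ℝ)) p] with q hq'
      exact contactization_inChart_eq lam hq'
    have h2 : HasFDerivAt (fun q : E × ℝ ↦ lam.inChart I p.1 q.1) _ q₀ :=
      hd.hasFDerivAt.comp q₀ hasFDerivAt_fst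
    have h3 := (h2.clm_comp (hasFDerivAt_const (ContinuousLinearMap.fst ℝ E ℝ) q₀)).add_const
      (ContinuousLinearMap.snd ℝ E ℝ)
    rw [h1.fderiv_eq, h3.fderiv, hq]
    simp
  exact congrArg₂ (· - ·) (hL v w) (hL w v)

theorem isContactForm_contactization (hlam : lam.IsSmoothInCharts I)
    (hnd : IsExactSymplectic I lam) :
    IsContactForm (I.prod 𝓘(ℝ, ℝ)) (contactization I lam) (verticalField I V) where
  smooth := hlam.contactization
  apply_reeb p := (contactization_apply lam p 0 1).trans (by
    rw [show lam p.1 (0 : E) = 0 from map_zero (lam p.1), zero_add])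
  d_reeb p w := by
    refine (contactization_d hlam p ((0 : E), (1 : ℝ)) w).trans ?_
    have h5 : ∀ e : E, fderiv ℝ (lam.inChart I p.1) (extChartAt I p.1 p.1) (0 : E) e -
      fderiv ℝ (lam.inChart I p.1) (extChartAt I p.1 p.1) e (0 : E) = 0 := fun e ↦ by simp
    exact h5 _
  nondegenerate := by
    rintro p ⟨v, r⟩ h0 hd
    have hv : v = 0 := hnd p.1 v fun w ↦
      (contactization_d hlam p (v, r) ((w : E), (0 : ℝ))).symm.trans (hd ((w : E), (0 : ℝ)))
    subst hv
    have h1 := (contactization_apply lam p 0 r).symm.trans h0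
    rw [show lam p.1 (0 : E) = 0 from map_zero (lam p.1), zero_add] at h1
    exact congrArg (fun r : ℝ ↦ ((0 : E), r)) h1

/-- The function `g + t²` on `V × ℝ`. -/
def lyapunov (g : V → ℝ) (p : V × ℝ) : ℝ := g p.1 + p.2 ^ 2

/-- The contact Hamiltonian `-t √(g + t²)` on `V × ℝ`. -/
def contractingHamiltonian (g : V → ℝ) (p : V × ℝ) : ℝ := -(p.2 * √(lyapunov g p))

theorem contMDiff_lyapunov {g : V → ℝ} (hg : ContMDiff I 𝓘(ℝ, ℝ) ∞ g) :
    ContMDiff (I.prod 𝓘(ℝ, ℝ)) 𝓘(ℝ, ℝ) ∞ (lyapunov g) :=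
  (hg.comp contMDiff_fst).add (contMDiff_snd.pow 2)

theorem contMDiff_contractingHamiltonian {g : V → ℝ} (hg : ContMDiff I 𝓘(ℝ, ℝ) ∞ g)
    (hpos : ∀ p : V × ℝ, 0 < lyapunov g p) :
    ContMDiff (I.prod 𝓘(ℝ, ℝ)) 𝓘(ℝ, ℝ) ∞ (contractingHamiltonian g) := by
  have h1 : ContMDiff (I.prod 𝓘(ℝ, ℝ)) 𝓘(ℝ, ℝ) ∞ fun p ↦ √(lyapunov g p) := fun p ↦
    ContMDiffAt.comp p ((Real.contDiffAt_sqrt (hpos p).ne').contMDiffAt)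
      (contMDiff_lyapunov hg).contMDiffAt
  exact (contMDiff_snd.mul h1).neg

theorem differential_lyapunov {g : V → ℝ} {p : V × ℝ} (hg : MDifferentiableAt I 𝓘(ℝ, ℝ) g p.1)
    (w : E) (r : ℝ) : differential (I.prod 𝓘(ℝ, ℝ)) (lyapunov g) p ((w, r) : E × ℝ) =
      differential I g p.1 w + 2 * p.2 * r := by
  have h1 : HasMFDerivAt (I.prod 𝓘(ℝ, ℝ)) 𝓘(ℝ, ℝ) (fun p : V × ℝ ↦ g p.1) p
      ((differential I g p.1).comp (ContinuousLinearMap.fst ℝ E ℝ)) :=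
    HasMFDerivAt.comp p hg.hasMFDerivAt (hasMFDerivAt_fst p)
  have h2 : HasMFDerivAt (I.prod 𝓘(ℝ, ℝ)) 𝓘(ℝ, ℝ) (fun p : V × ℝ ↦ p.2 ^ 2) p
      ((2 * p.2) • ContinuousLinearMap.snd ℝ E ℝ) := by
    have h3 : HasFDerivAt (fun r : ℝ ↦ r ^ 2) ((2 * p.2) • (1 : ℝ →L[ℝ] ℝ)) p.2 := by
      have := (hasDerivAt_pow 2 p.2).hasFDerivAt
      convert! this using 1
      ext
      simp
    exact (HasMFDerivAt.comp p h3.hasMFDerivAt (hasMFDerivAt_snd p)).congr_mfderiv (by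
      ext <;> rfl)
  have h3 := (h1.add h2).mfderiv
  exact congrArg (fun L : E × ℝ →L[ℝ] ℝ ↦ L (w, r)) h3

theorem differential_contractingHamiltonian {g : V → ℝ} {p : V × ℝ}
    (hg : MDifferentiableAt I 𝓘(ℝ, ℝ) g p.1) (hpos : 0 < lyapunov g p) (w : E) (r : ℝ) :
    differential (I.prod 𝓘(ℝ, ℝ)) (contractingHamiltonian g) p ((w, r) : E × ℝ) =
      -(r * √(lyapunov g p) +
        p.2 * ((differential I g p.1 w + 2 * p.2 * r) / (2 * √(lyapunov g p)))) := by
  have hG : HasMFDerivAt (I.prod 𝓘(ℝ, ℝ)) 𝓘(ℝ, ℝ) (lyapunov g) p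
      (differential (I.prod 𝓘(ℝ, ℝ)) (lyapunov g) p) :=
    MDifferentiableAt.hasMFDerivAt
      ((hg.comp p mdifferentiableAt_fst).add (mdifferentiableAt_snd.pow 2))
  have h1 : HasMFDerivAt (I.prod 𝓘(ℝ, ℝ)) 𝓘(ℝ, ℝ) (fun p ↦ √(lyapunov g p)) p
      ((1 / (2 * √(lyapunov g p))) • differential (I.prod 𝓘(ℝ, ℝ)) (lyapunov g) p) := by
    have h2 := (Real.hasDerivAt_sqrt hpos.ne').hasFDerivAt
    refine (HasMFDerivAt.comp p h2.hasMFDerivAt hG).congr_mfderiv ?_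
    refine ContinuousLinearMap.ext fun v ↦ ?_
    exact mul_comm (differential (I.prod 𝓘(ℝ, ℝ)) (lyapunov g) p v) (1 / (2 * √(lyapunov g p)))
  have h3 := ((hasMFDerivAt_snd (I := I) (I' := 𝓘(ℝ, ℝ)) p).mul' h1).neg.mfderiv
  refine (congrArg (fun L : E × ℝ →L[ℝ] ℝ ↦ L (w, r)) h3).trans ?_
  rw [← differential_lyapunov hg]
  change -(p.2 * ((1 / (2 * √(lyapunov g p))) *
    differential (I.prod 𝓘(ℝ, ℝ)) (lyapunov g) p ((w, r) : E × ℝ)) + r * √(lyapunov g p)) = _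
  ring

theorem OneForm.d_sub_smul (lam : OneForm I V) (x : V) (a : ℝ) (v w u : TangentSpace I x) :
    lam.d I x (v - a • w) u = lam.d I x v u - a * lam.d I x w u := by
  have h : ∀ L : E →L[ℝ] E →L[ℝ] ℝ, ∀ v w u : E, L (v - a • w) u - L u (v - a • w) =
      L v u - L u v - a * (L w u - L u w) := fun L v w u ↦ by
    simp
    ring
  exact h (fderiv ℝ (lam.inChart I x) (extChartAt I x x)) v w u

theorem IsLiouvilleField.apply_self {Z : ∀ x : V, TangentSpace I x}
    (hZ : IsLiouvilleField I lam Z) (x : V) : lam x (Z x) = 0 := by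
  rw [← hZ, OneForm.d_self]

/-- The derivative of `g + t²` along the Hamiltonian vector field of `-t √(g + t²)`. -/
theorem differential_lyapunov_of_isHamiltonianAt (hlam : lam.IsSmoothInCharts I)
    (hnd : IsExactSymplectic I lam) {Z : ∀ x : V, TangentSpace I x}
    (hZ : IsLiouvilleField I lam Z) {g : V → ℝ} {p : V × ℝ}
    (hg : MDifferentiableAt I 𝓘(ℝ, ℝ) g p.1) (hpos : 0 < lyapunov g p) {v : E × ℝ}
    (hv : IsHamiltonianAt (I.prod 𝓘(ℝ, ℝ)) (contactization I lam) (verticalField I V)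
      (contractingHamiltonian g) p v) :
    differential (I.prod 𝓘(ℝ, ℝ)) (lyapunov g) p v =
      -(√(lyapunov g p) * (differential I g p.1 (Z p.1) + 2 * p.2 ^ 2)) := by
  obtain ⟨(ξ : TangentSpace I p.1), (τ : ℝ)⟩ := v
  set a := √(lyapunov g p) with ha
  have ha0 : 0 < a := Real.sqrt_pos.2 hpos
  obtain ⟨h1, h2⟩ := hv
  have h1' : lam p.1 ξ + τ = -(p.2 * a) := (contactization_apply lam p ξ τ).symm.trans h1
  set ht := -(a + p.2 * ((2 * p.2) / (2 * a))) with hht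
  have hR : differential (I.prod 𝓘(ℝ, ℝ)) (contractingHamiltonian g) p (verticalField I V p) =
      ht := by
    refine (differential_contractingHamiltonian hg hpos (0 : E) 1).trans ?_
    rw [show differential I g p.1 (0 : E) = 0 from map_zero (differential I g p.1), hht]
    ring
  have h2' : ∀ u : E, lam.d I p.1 ξ u - p.2 * (differential I g p.1 u / (2 * a)) =
      ht * lam p.1 u := by
    intro u
    have h3 := h2 (u, (0 : ℝ))
    rw [hR] at h3
    have h4 := contactization_d hlam p (ξ, τ) (u, (0 : ℝ))
    have h5 := differential_contractingHamiltonian hg hpos u 0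
    have h6 := contactization_apply lam p u 0
    have h7 : lam.d I p.1 ξ u + -(0 * a + p.2 * ((differential I g p.1 u + 2 * p.2 * 0) / (2 * a))) =
        ht * (lam p.1 u + 0) := by
      rw [← h6, ha, ← h5, ← h4]
      exact h3
    linear_combination h7
  have hξ : lam p.1 ξ = -(p.2 * (differential I g p.1 (Z p.1) / (2 * a))) := by
    have h3 := h2' (Z p.1)
    rw [OneForm.d_swap, hZ, hZ.apply_self] at h3
    linear_combination -h3
  have hdg : differential I g p.1 ξ = ht * differential I g p.1 (Z p.1) := by
    set ζ : TangentSpace I p.1 := ξ - ht • Z p.1 with hζ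
    have hζd : ∀ u : TangentSpace I p.1,
        lam.d I p.1 ζ u = p.2 * (differential I g p.1 u / (2 * a)) := by
      intro u
      have h3 := h2' u
      rw [hζ, OneForm.d_sub_smul, hZ]
      linear_combination h3
    have hζ0 : differential I g p.1 ζ = 0 := by
      by_cases ht0 : p.2 = 0
      · have : ζ = 0 := hnd p.1 ζ fun u ↦ by rw [hζd, ht0, zero_mul]
        rw [this, map_zero]
      · have h3 := hζd ζ
        rw [OneForm.d_self] at h3
        have h4 := (mul_eq_zero.1 h3.symm).resolve_left ht0
        exact (div_eq_zero_iff.1 h4).resolve_right (by positivity)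
    have h5 : differential I g p.1 ζ =
        differential I g p.1 ξ - ht * differential I g p.1 (Z p.1) := by
      rw [hζ, map_sub, map_smul, smul_eq_mul]
    linear_combination hζ0 - h5
  refine (differential_lyapunov hg ξ τ).trans ?_
  rw [hdg]
  have hτ : τ = -(p.2 * a) + p.2 * (differential I g p.1 (Z p.1) / (2 * a)) := by
    linear_combination h1' - hξ
  rw [hτ, hht]
  field_simp
  ring

/-- The maximal cone of a contactization is non-orderable up to conjugation if the symplectic
manifold carries an exhaustion function which grows exponentially along the Liouville field. -/
theorem nonOrderableUpToConjugation_contactization [T2Space V] [FiniteDimensional ℝ E]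
    (hlam : lam.IsSmoothInCharts I) (hnd : IsExactSymplectic I lam)
    {Z : ∀ x : V, TangentSpace I x} (hZ : IsLiouvilleField I lam Z) {g : V → ℝ}
    (hg : ContMDiff I 𝓘(ℝ, ℝ) ∞ g) (hproper : ∀ c, IsCompact {x | g x ≤ c}) (hg1 : ∀ x, 1 ≤ g x)
    (hgZ : ∀ x, 0 ≤ differential I g x (Z x)) {c m : ℝ} (hc : 0 < c)
    (hgZ' : ∀ x, m ≤ g x → c * g x ≤ differential I g x (Z x)) :
    NonOrderableUpToConjugation (I.prod 𝓘(ℝ, ℝ)) (contactization I lam) := by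
  have he1 : ∀ p : V × ℝ, 1 ≤ lyapunov g p := fun p ↦
    (hg1 p.1).trans (le_add_of_nonneg_right (sq_nonneg _))
  have he0 : ∀ p : V × ℝ, 0 < lyapunov g p := fun p ↦ one_pos.trans_le (he1 p)
  have hder := fun (p : V × ℝ) (v : E × ℝ) (hv : IsHamiltonianAt (I.prod 𝓘(ℝ, ℝ))
      (contactization I lam) (verticalField I V) (contractingHamiltonian g) p v) ↦
    differential_lyapunov_of_isHamiltonianAt hlam hnd hZ
      (hg.mdifferentiableAt (by simp)) (he0 p) hv
  refine (isContactForm_contactization hlam hnd).nonOrderableUpToConjugation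
    (contMDiff_contractingHamiltonian hg he0) (contMDiff_lyapunov hg) (fun a ↦ ?_)
    (fun p v hv ↦ ?_) (c := min (c / 2) 1) (m := 2 * max m 1) (by positivity) (by positivity)
    (fun p v hv hm ↦ ?_) (fun p ↦ ?_)
  · refine ((hproper a).prod (isCompact_Icc (a := -(|a| + 1)) (b := |a| + 1))).of_isClosed_subset
      (isClosed_le (contMDiff_lyapunov hg).continuous continuous_const) fun p hp ↦ ?_
    have hp' : g p.1 + p.2 ^ 2 ≤ a := hp
    have h1 := hg1 p.1
    refine ⟨show g p.1 ≤ a by nlinarith [sq_nonneg p.2], abs_le.1 ?_⟩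
    refine abs_le_of_sq_le_sq ?_ (by positivity)
    nlinarith [le_abs_self a, abs_nonneg a]
  · rw [hder p v hv, neg_nonpos]
    have := hgZ p.1
    positivity
  · rw [hder p v hv]
    have h1 : min (c / 2) 1 * lyapunov g p ≤ differential I g p.1 (Z p.1) + 2 * p.2 ^ 2 := by
      have h2 : lyapunov g p = g p.1 + p.2 ^ 2 := rfl
      rcases le_total (g p.1) (p.2 ^ 2) with h3 | h3
      · calc min (c / 2) 1 * lyapunov g p ≤ 1 * lyapunov g p :=
              mul_le_mul_of_nonneg_right (min_le_right _ _) (he0 p).le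
          _ ≤ _ := by linarith [hgZ p.1]
      · have h4 : m ≤ g p.1 := by linarith [le_max_left m 1]
        calc min (c / 2) 1 * lyapunov g p ≤ c / 2 * lyapunov g p :=
              mul_le_mul_of_nonneg_right (min_le_left _ _) (he0 p).le
          _ ≤ c * g p.1 := by nlinarith
          _ ≤ _ := by linarith [hgZ' p.1 h4, sq_nonneg p.2]
    have h2 := mul_le_mul_of_nonneg_left h1 (Real.sqrt_nonneg (lyapunov g p))
    linarith
  · refine (differential_contractingHamiltonian (hg.mdifferentiableAt (by simp)) (he0 p)
      (0 : E) 1).trans_le ?_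
    rw [show differential I g p.1 (0 : E) = 0 from map_zero (differential I g p.1)]
    have h1 : 1 ≤ √(lyapunov g p) := Real.one_le_sqrt.2 (he1 p)
    have h2 : 0 ≤ p.2 * ((0 + 2 * p.2 * 1) / (2 * √(lyapunov g p))) := by
      have : p.2 * ((0 + 2 * p.2 * 1) / (2 * √(lyapunov g p))) = p.2 ^ 2 / √(lyapunov g p) := by
        field_simp
        ring
      rw [this]
      positivity
    linarith

end Contactization


/-! ### The standard contact structure on `ℝ^{2n+1}` -/

section Standard

theorem OneForm.inChart_vectorSpace {F : Type*} [NormedAddCommGroup F] [NormedSpace ℝ F]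
    (lam : OneForm 𝓘(ℝ, F) F) (x y : F) : lam.inChart 𝓘(ℝ, F) x y = lam y := by
  rw [OneForm.inChart, extChartAt_model_space_eq_id]
  have h : mfderiv 𝓘(ℝ, F) 𝓘(ℝ, F) (PartialEquiv.refl F).symm y =
      ContinuousLinearMap.id ℝ F := mfderiv_id
  rw [h]
  rfl

theorem differential_vectorSpace {F : Type*} [NormedAddCommGroup F] [NormedSpace ℝ F]
    (g : F → ℝ) (x : F) : differential 𝓘(ℝ, F) g x = fderiv ℝ g x := mfderiv_eq_fderiv

variable (n : ℕ)

theorem standardForm_apply (p w : EuclideanSpace ℝ (Fin n ⊕ Fin n)) :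
    standardForm n p w =
      ∑ j, (p (Sum.inl j) * w (Sum.inr j) - p (Sum.inr j) * w (Sum.inl j)) := by
  have h : ∀ L : EuclideanSpace ℝ (Fin n ⊕ Fin n) →L[ℝ] ℝ,
      L = (∑ j, (p (Sum.inl j) • EuclideanSpace.proj (Sum.inr j) -
        p (Sum.inr j) • EuclideanSpace.proj (Sum.inl j)) :
          EuclideanSpace ℝ (Fin n ⊕ Fin n) →L[ℝ] ℝ) →
      L w = ∑ j, (p (Sum.inl j) * w (Sum.inr j) - p (Sum.inr j) * w (Sum.inl j)) := by
    rintro _ rfl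
    simp
  exact h _ rfl

theorem standardForm_swap (p w : EuclideanSpace ℝ (Fin n ⊕ Fin n)) :
    standardForm n p w = -standardForm n w p := by
  rw [standardForm_apply, standardForm_apply, ← Finset.sum_neg_distrib]
  exact Finset.sum_congr rfl fun j _ ↦ by ring

/-- The standard form as a linear map to the dual space. -/
def standardFormLinear : EuclideanSpace ℝ (Fin n ⊕ Fin n) →L[ℝ]
    EuclideanSpace ℝ (Fin n ⊕ Fin n) →L[ℝ] ℝ :=
  LinearMap.toContinuousLinearMap
    { toFun := fun p ↦ standardForm n p
      map_add' := fun p q ↦ ContinuousLinearMap.ext fun w ↦ by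
        refine (standardForm_apply n (p + q) w).trans ?_
        refine Eq.trans ?_ (congrArg₂ (· + ·) (standardForm_apply n p w)
          (standardForm_apply n q w)).symm
        rw [← Finset.sum_add_distrib]
        exact Finset.sum_congr rfl fun j _ ↦ by simp only [PiLp.add_apply]; ring
      map_smul' := fun a p ↦ ContinuousLinearMap.ext fun w ↦ by
        refine (standardForm_apply n (a • p) w).trans ?_
        refine Eq.trans ?_ (congrArg (a * ·) (standardForm_apply n p w)).symm
        rw [Finset.mul_sum]
        exact Finset.sum_congr rfl fun j _ ↦ by simp only [PiLp.smul_apply, smul_eq_mul]; ring }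

theorem standardForm_inChart (x : EuclideanSpace ℝ (Fin n ⊕ Fin n)) :
    (standardForm n).inChart 𝓘(ℝ, EuclideanSpace ℝ (Fin n ⊕ Fin n)) x = standardFormLinear n :=
  funext fun y ↦ OneForm.inChart_vectorSpace _ x y

theorem standardForm_d (x v w : EuclideanSpace ℝ (Fin n ⊕ Fin n)) :
    (standardForm n).d 𝓘(ℝ, EuclideanSpace ℝ (Fin n ⊕ Fin n)) x v w = 2 * standardForm n v w := by
  have h : (standardForm n).d 𝓘(ℝ, EuclideanSpace ℝ (Fin n ⊕ Fin n)) x v w =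
      standardForm n v w - standardForm n w v := by
    have h1 : fderiv ℝ ((standardForm n).inChart 𝓘(ℝ, EuclideanSpace ℝ (Fin n ⊕ Fin n)) x)
        (extChartAt 𝓘(ℝ, EuclideanSpace ℝ (Fin n ⊕ Fin n)) x x) = standardFormLinear n := by
      rw [standardForm_inChart]
      exact (standardFormLinear n).fderiv
    exact congrArg (fun L : EuclideanSpace ℝ (Fin n ⊕ Fin n) →L[ℝ]
      EuclideanSpace ℝ (Fin n ⊕ Fin n) →L[ℝ] ℝ ↦ L v w - L w v) h1
  rw [h, standardForm_swap n w v]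
  ring

theorem nonOrderableUpToConjugation_standardForm : NonOrderableUpToConjugation
    (𝓘(ℝ, EuclideanSpace ℝ (Fin n ⊕ Fin n)).prod 𝓘(ℝ, ℝ))
    (contactization 𝓘(ℝ, EuclideanSpace ℝ (Fin n ⊕ Fin n)) (standardForm n)) := by
  have hg : ContDiff ℝ ∞ fun x : EuclideanSpace ℝ (Fin n ⊕ Fin n) ↦ 1 + ‖x‖ ^ 2 :=
    contDiff_const.add (contDiff_norm_sq ℝ)
  have hgZ : ∀ x : EuclideanSpace ℝ (Fin n ⊕ Fin n),
      differential 𝓘(ℝ, EuclideanSpace ℝ (Fin n ⊕ Fin n)) (fun x ↦ 1 + ‖x‖ ^ 2) x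
        ((2 : ℝ)⁻¹ • x) = ‖x‖ ^ 2 := by
    intro x
    rw [differential_vectorSpace]
    have h1 : HasFDerivAt (fun x : EuclideanSpace ℝ (Fin n ⊕ Fin n) ↦ 1 + ‖x‖ ^ 2)
      (2 • innerSL ℝ x) x := (hasStrictFDerivAt_norm_sq x).hasFDerivAt.const_add 1
    rw [h1.fderiv]
    have h2 : (2 • innerSL ℝ x) ((2 : ℝ)⁻¹ • x) = ‖x‖ ^ 2 := by
      rw [map_smul]
      simp
    exact h2
  refine nonOrderableUpToConjugation_contactization (Z := fun x ↦ (2 : ℝ)⁻¹ • x)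
    (g := fun x ↦ 1 + ‖x‖ ^ 2) (fun x ↦ ?_) (fun x v hv ↦ ?_) (fun x w ↦ ?_) hg.contMDiff
    (fun c ↦ ?_) (fun x ↦ by simp) (fun x ↦ ?_) (c := 2⁻¹) (m := 2) (by norm_num)
    (fun x hx ↦ ?_)
  · rw [standardForm_inChart]
    exact (standardFormLinear n).contDiff.contDiffOn
  · have h1 : ∀ w : EuclideanSpace ℝ (Fin n ⊕ Fin n), standardForm n v w = 0 := fun w ↦ by
      have := (standardForm_d n x v w).symm.trans (hv w)
      linarith
    have h2 : ∀ v : EuclideanSpace ℝ (Fin n ⊕ Fin n), (∀ w, standardForm n v w = 0) → v = 0 := by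
      intro v h1
      ext i
      rcases i with j | j
      · have := h1 (EuclideanSpace.single (Sum.inr j) 1)
        rw [standardForm_apply] at this
        simpa using this
      · have := h1 (EuclideanSpace.single (Sum.inl j) 1)
        rw [standardForm_apply] at this
        simpa using this
    exact h2 v h1
  · refine (standardForm_d n x ((2 : ℝ)⁻¹ • x) w).trans ?_
    have h1 : standardForm n ((2 : ℝ)⁻¹ • x) w = 2⁻¹ * standardForm n x w :=
      congrArg (fun L : EuclideanSpace ℝ (Fin n ⊕ Fin n) →L[ℝ] ℝ ↦ L w)
        (map_smul (standardFormLinear n) (2 : ℝ)⁻¹ x)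
    rw [h1]
    ring
  · refine (isCompact_closedBall (0 : EuclideanSpace ℝ (Fin n ⊕ Fin n)) (|c| + 1)).of_isClosed_subset
      (isClosed_le hg.continuous continuous_const) fun x hx ↦ ?_
    have hx' : 1 + ‖x‖ ^ 2 ≤ c := hx
    rw [mem_closedBall_zero_iff]
    refine abs_le_of_sq_le_sq' ?_ (by positivity) |>.2
    nlinarith [le_abs_self c, abs_nonneg c]
  · rw [hgZ]
    positivity
  · rw [hgZ]
    linarith

end Standard


/-! ### One-jet spaces of closed manifolds -/

section Cotangent

variable {E : Type*} [NormedAddCommGroup E] [NormedSpace ℝ E]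
  {H : Type*} [TopologicalSpace H] (I : ModelWithCorners ℝ E H)
  {M : Type*} [TopologicalSpace M] [ChartedSpace H M] [IsManifold I ∞ M]

/-- The preferred trivialization of the cotangent bundle around `q`. -/
abbrev cotangentTriv (q : M) : Bundle.Trivialization (E →L[ℝ] ℝ)
    (Bundle.TotalSpace.proj : CotangentSpace I M → M) :=
  trivializationAt (E →L[ℝ] ℝ) (fun x : M ↦ TangentSpace I x →L[ℝ] ℝ) q

variable {I}

theorem cotangentTriv_apply (q : M) (p : CotangentSpace I M) : cotangentTriv I q p =
    (p.proj, (p.snd : TangentSpace I p.proj →L[ℝ] ℝ).comp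
      ((trivializationAt E (TangentSpace I) q).symmL ℝ p.proj)) := by
  rw [hom_trivializationAt_apply]
  simp [ContinuousLinearMap.inCoordinates]

theorem cotangentTriv_baseSet (q : M) : (cotangentTriv I q).baseSet = (chartAt H q).source := by
  rw [hom_trivializationAt_baseSet, TangentBundle.trivializationAt_baseSet]
  simp

instance [T2Space M] : T2Space (CotangentSpace I M) := by
  refine ⟨fun p p' hpp' ↦ ?_⟩
  have hproj : Continuous (Bundle.TotalSpace.proj : CotangentSpace I M → M) :=
    FiberBundle.continuous_proj _ _
  by_cases h : p.proj = p'.proj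
  · set e := cotangentTriv I p.proj with he
    have hb : p.proj ∈ e.baseSet := FiberBundle.mem_baseSet_trivializationAt' p.proj
    have hp : p ∈ e.source := e.mem_source.2 hb
    have hp' : p' ∈ e.source := e.mem_source.2 (h ▸ hb)
    obtain ⟨u, v, hu, hv, hpu, hpv, huv⟩ := t2_separation fun h ↦ hpp' (e.injOn hp hp' h)
    exact ⟨_, _, e.continuousOn.isOpen_inter_preimage e.open_source hu,
      e.continuousOn.isOpen_inter_preimage e.open_source hv, ⟨hp, hpu⟩, ⟨hp', hpv⟩,
      (huv.preimage e).mono inter_subset_right inter_subset_right⟩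
  · obtain ⟨u, v, hu, hv, hpu, hpv, huv⟩ := t2_separation h
    exact ⟨_, _, hu.preimage hproj, hv.preimage hproj, hpu, hpv, huv.preimage _⟩

variable [I.Boundaryless]

theorem mem_extChartAt_cotangent_target {p : CotangentSpace I M} {z : E × (E →L[ℝ] ℝ)} :
    z ∈ (extChartAt (I.prod 𝓘(ℝ, E →L[ℝ] ℝ)) p).target ↔ z.1 ∈ (extChartAt I p.proj).target := by
  rw [FiberBundle.extChartAt_target, cotangentTriv_baseSet]
  refine ⟨fun h ↦ h.1.1, fun h ↦ ⟨⟨h, ?_⟩, mem_univ _⟩⟩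
  rw [mem_preimage, ← extChartAt_source I]
  exact (extChartAt I p.proj).map_target h

theorem extChartAt_cotangent_symm_proj {p : CotangentSpace I M} {z : E × (E →L[ℝ] ℝ)}
    (hz : z.1 ∈ (extChartAt I p.proj).target) :
    ((extChartAt (I.prod 𝓘(ℝ, E →L[ℝ] ℝ)) p).symm z).proj = (extChartAt I p.proj).symm z.1 := by
  rw [FiberBundle.extChartAt]
  refine (cotangentTriv I p.proj).proj_symm_apply' (b := (extChartAt I p.proj).symm z.1) ?_
  rw [cotangentTriv_baseSet, ← extChartAt_source I]
  exact (extChartAt I p.proj).map_target hz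

theorem extChartAt_cotangent_symm_snd {p : CotangentSpace I M} {z : E × (E →L[ℝ] ℝ)}
    (hz : z.1 ∈ (extChartAt I p.proj).target) (u : E) :
    ((extChartAt (I.prod 𝓘(ℝ, E →L[ℝ] ℝ)) p).symm z).snd
      (mfderiv 𝓘(ℝ, E) I (extChartAt I p.proj).symm z.1 u) = z.2 u := by
  have : IsManifold I 1 M := .of_le (n := ∞) (by simp)
  set P := (extChartAt (I.prod 𝓘(ℝ, E →L[ℝ] ℝ)) p).symm z with hP
  have hproj := extChartAt_cotangent_symm_proj hz
  have hzt : z ∈ (extChartAt (I.prod 𝓘(ℝ, E →L[ℝ] ℝ)) p).target :=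
    mem_extChartAt_cotangent_target.2 hz
  have h1 : extChartAt (I.prod 𝓘(ℝ, E →L[ℝ] ℝ)) p P = z := (extChartAt _ p).right_inv hzt
  rw [FiberBundle.extChartAt] at h1
  have h2 : (cotangentTriv I p.proj P).2 = z.2 := congrArg Prod.snd h1
  rw [cotangentTriv_apply] at h2
  have hsrc : P.proj ∈ (chartAt H p.proj).source := by
    rw [hproj, ← extChartAt_source I]
    exact (extChartAt I p.proj).map_target hz
  have h3 := TangentBundle.symmL_trivializationAt (I := I) (x₀ := p.proj) (x := P.proj) hsrc
  rw [I.range_eq_univ, mfderivWithin_univ, hproj, (extChartAt I p.proj).right_inv hz] at h3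
  have h4 : (trivializationAt E (TangentSpace I) p.proj).symmL ℝ P.proj =
      (mfderiv 𝓘(ℝ, E) I (extChartAt I p.proj).symm z.1 : E →L[ℝ] E) := by
    rw [hproj]
    exact h3
  rw [← h2]
  exact congrArg (fun L : E →L[ℝ] E ↦ P.snd (L u)) h4.symm

theorem canonicalForm_inChart {p : CotangentSpace I M} {z : E × (E →L[ℝ] ℝ)}
    (hz : z ∈ (extChartAt (I.prod 𝓘(ℝ, E →L[ℝ] ℝ)) p).target) :
    (canonicalForm I M).inChart (I.prod 𝓘(ℝ, E →L[ℝ] ℝ)) p z =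
      z.2.comp (ContinuousLinearMap.fst ℝ E (E →L[ℝ] ℝ)) := by
  have hz1 := mem_extChartAt_cotangent_target.1 hz
  set χ := extChartAt (I.prod 𝓘(ℝ, E →L[ℝ] ℝ)) p with hχ
  have h1 := mfderiv_comp z
    ((Bundle.contMDiff_proj (n := ∞) (IB := I) (fun x : M ↦ TangentSpace I x →L[ℝ] ℝ)).mdifferentiableAt
      (x := χ.symm z) (by simp)) ((contMDiffAt_extChartAt_symm hz).mdifferentiableAt (by simp))
  have h2 : (Bundle.TotalSpace.proj ∘ χ.symm : E × (E →L[ℝ] ℝ) → M) =ᶠ[𝓝 z]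
      (extChartAt I p.proj).symm ∘ Prod.fst := by
    filter_upwards [continuousAt_fst.preimage_mem_nhds
      ((isOpen_extChartAt_target p.proj).mem_nhds hz1)] with z' hz'
    exact extChartAt_cotangent_symm_proj hz'
  have h3 : HasMFDerivAt 𝓘(ℝ, E × (E →L[ℝ] ℝ)) I ((extChartAt I p.proj).symm ∘ Prod.fst) z
      ((mfderiv 𝓘(ℝ, E) I (extChartAt I p.proj).symm z.1).comp
        (ContinuousLinearMap.fst ℝ E (E →L[ℝ] ℝ))) :=
    HasMFDerivAt.comp z
      ((contMDiffAt_extChartAt_symm hz1).mdifferentiableAt (by simp)).hasMFDerivAt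
      hasFDerivAt_fst.hasMFDerivAt
  rw [h2.mfderiv_eq, h3.mfderiv] at h1
  refine ContinuousLinearMap.ext fun w ↦ ?_
  have h4 := congrArg (fun L : E × (E →L[ℝ] ℝ) →L[ℝ] E ↦ (χ.symm z).snd (L w)) h1
  exact h4.symm.trans (extChartAt_cotangent_symm_snd hz1 w.1)

theorem canonicalForm_isSmoothInCharts :
    (canonicalForm I M).IsSmoothInCharts (I.prod 𝓘(ℝ, E →L[ℝ] ℝ)) := by
  intro p
  have h1 : ContDiff ℝ ∞ fun z : E × (E →L[ℝ] ℝ) ↦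
      z.2.comp (ContinuousLinearMap.fst ℝ E (E →L[ℝ] ℝ)) := contDiff_snd.clm_comp contDiff_const
  exact h1.contDiffOn.congr fun z hz ↦ canonicalForm_inChart hz

theorem canonicalForm_d {p : CotangentSpace I M} {z : E × (E →L[ℝ] ℝ)}
    (hz : z ∈ (extChartAt (I.prod 𝓘(ℝ, E →L[ℝ] ℝ)) p).target) (v w : E × (E →L[ℝ] ℝ)) :
    (canonicalForm I M).d (I.prod 𝓘(ℝ, E →L[ℝ] ℝ))
      ((extChartAt (I.prod 𝓘(ℝ, E →L[ℝ] ℝ)) p).symm z)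
      (mfderiv 𝓘(ℝ, E × (E →L[ℝ] ℝ)) (I.prod 𝓘(ℝ, E →L[ℝ] ℝ))
        (extChartAt (I.prod 𝓘(ℝ, E →L[ℝ] ℝ)) p).symm z v)
      (mfderiv 𝓘(ℝ, E × (E →L[ℝ] ℝ)) (I.prod 𝓘(ℝ, E →L[ℝ] ℝ))
        (extChartAt (I.prod 𝓘(ℝ, E →L[ℝ] ℝ)) p).symm z w) = v.2 w.1 - w.2 v.1 := by
  rw [canonicalForm_isSmoothInCharts.d_mfderiv_extChartAt_symm hz]
  have h1 : (canonicalForm I M).inChart (I.prod 𝓘(ℝ, E →L[ℝ] ℝ)) p =ᶠ[𝓝 z]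
      fun z ↦ z.2.comp (ContinuousLinearMap.fst ℝ E (E →L[ℝ] ℝ)) := by
    filter_upwards [(isOpen_extChartAt_target p).mem_nhds hz] with z' hz'
    exact canonicalForm_inChart hz'
  have h2 := (hasFDerivAt_snd (𝕜 := ℝ) (p := z)).clm_comp
    (hasFDerivAt_const (ContinuousLinearMap.fst ℝ E (E →L[ℝ] ℝ)) z)
  rw [h1.fderiv_eq, h2.fderiv]
  simp

theorem canonicalForm_isExactSymplectic :
    IsExactSymplectic (I.prod 𝓘(ℝ, E →L[ℝ] ℝ)) (canonicalForm I M) := by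
  have key : ∀ (p : CotangentSpace I M) (z : E × (E →L[ℝ] ℝ))
      (_ : z ∈ (extChartAt (I.prod 𝓘(ℝ, E →L[ℝ] ℝ)) p).target) (x : CotangentSpace I M),
      x = (extChartAt (I.prod 𝓘(ℝ, E →L[ℝ] ℝ)) p).symm z → ∀ v : TangentSpace _ x,
      (∀ w, (canonicalForm I M).d (I.prod 𝓘(ℝ, E →L[ℝ] ℝ)) x v w = 0) → v = 0 := by
    rintro p z hz _ rfl v hv
    obtain ⟨v, rfl⟩ := (mfderiv_extChartAt_symm_isInvertible hz).bijective.2 v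
    have h1 : ∀ v : E × (E →L[ℝ] ℝ), (∀ w : E × (E →L[ℝ] ℝ), v.2 w.1 - w.2 v.1 = 0) → v = 0 := by
      rintro ⟨v, ν⟩ h
      have h2 : ν = 0 := ContinuousLinearMap.ext fun u ↦ by simpa using h (u, 0)
      have h3 : v = 0 := SeparatingDual.eq_zero_of_forall_dual_eq_zero (R := ℝ) fun f ↦ by
        simpa [h2] using h (0, f)
      rw [h2, h3]
      rfl
    rw [h1 v fun w ↦ (canonicalForm_d hz v w).symm.trans (hv _)]
    exact map_zero (mfderiv 𝓘(ℝ, E × (E →L[ℝ] ℝ)) (I.prod 𝓘(ℝ, E →L[ℝ] ℝ))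
      (extChartAt (I.prod 𝓘(ℝ, E →L[ℝ] ℝ)) p).symm z)
  exact fun x v hv ↦ key x _ (mem_extChartAt_target x) x (extChartAt_to_inv x).symm v hv

variable (I M) in
/-- The generator of the dilations of the fibres of the cotangent bundle. -/
def fiberDilationField (p : CotangentSpace I M) : TangentSpace (I.prod 𝓘(ℝ, E →L[ℝ] ℝ)) p :=
  (mfderiv 𝓘(ℝ, E × (E →L[ℝ] ℝ)) (I.prod 𝓘(ℝ, E →L[ℝ] ℝ))
    (extChartAt (I.prod 𝓘(ℝ, E →L[ℝ] ℝ)) p).symm (extChartAt (I.prod 𝓘(ℝ, E →L[ℝ] ℝ)) p p)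
    ((0 : E), (cotangentTriv I p.proj p).2) : E × (E →L[ℝ] ℝ))

theorem isLiouvilleField_fiberDilationField : IsLiouvilleField (I.prod 𝓘(ℝ, E →L[ℝ] ℝ))
    (canonicalForm I M) (fiberDilationField I M) := by
  have key : ∀ (p : CotangentSpace I M) (z : E × (E →L[ℝ] ℝ))
      (_ : z ∈ (extChartAt (I.prod 𝓘(ℝ, E →L[ℝ] ℝ)) p).target) (x : CotangentSpace I M),
      x = (extChartAt (I.prod 𝓘(ℝ, E →L[ℝ] ℝ)) p).symm z → ∀ w : TangentSpace _ x,
      (canonicalForm I M).d (I.prod 𝓘(ℝ, E →L[ℝ] ℝ)) x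
        (mfderiv 𝓘(ℝ, E × (E →L[ℝ] ℝ)) (I.prod 𝓘(ℝ, E →L[ℝ] ℝ))
        (extChartAt (I.prod 𝓘(ℝ, E →L[ℝ] ℝ)) p).symm z ((0 : E), z.2) : E × (E →L[ℝ] ℝ)) w =
      canonicalForm I M x w := by
    rintro p z hz _ rfl w
    obtain ⟨w, rfl⟩ := (mfderiv_extChartAt_symm_isInvertible hz).bijective.2 w
    refine (canonicalForm_d hz ((0 : E), z.2) w).trans ?_
    have h1 := congrArg (fun L : E × (E →L[ℝ] ℝ) →L[ℝ] ℝ ↦ L w) (canonicalForm_inChart hz)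
    refine Eq.trans ?_ h1.symm
    have h2 : ∀ w : E × (E →L[ℝ] ℝ), z.2 w.1 - w.2 (0 : E) = z.2 w.1 := fun w ↦ by simp
    exact h2 w
  intro x w
  have h1 : (extChartAt (I.prod 𝓘(ℝ, E →L[ℝ] ℝ)) x x).2 = (cotangentTriv I x.proj x).2 := by
    rw [FiberBundle.extChartAt]
    rfl
  have h2 := key x _ (mem_extChartAt_target x) x (extChartAt_to_inv x).symm w
  rw [h1] at h2
  exact h2

/-- Multiplication of a covector by a scalar. -/
def fiberDilation (r : ℝ) (p : CotangentSpace I M) : CotangentSpace I M :=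
  ⟨p.proj, r • (p.snd : TangentSpace I p.proj →L[ℝ] ℝ)⟩

theorem cotangentTriv_fiberDilation (q : M) (r : ℝ) (p : CotangentSpace I M) :
    (cotangentTriv I q (fiberDilation r p)).2 = r • (cotangentTriv I q p).2 := by
  rw [cotangentTriv_apply, cotangentTriv_apply]
  rfl

theorem extChartAt_symm_smul (r : ℝ) (p : CotangentSpace I M) :
    (extChartAt (I.prod 𝓘(ℝ, E →L[ℝ] ℝ)) p).symm
      ((extChartAt (I.prod 𝓘(ℝ, E →L[ℝ] ℝ)) p p).1, r • (cotangentTriv I p.proj p).2) =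
      fiberDilation r p := by
  have hs : fiberDilation r p ∈ (extChartAt (I.prod 𝓘(ℝ, E →L[ℝ] ℝ)) p).source := by
    rw [extChartAt_source, FiberBundle.chartedSpace_chartAt]
    have hb : p.proj ∈ (cotangentTriv I p.proj).baseSet :=
      FiberBundle.mem_baseSet_trivializationAt' p.proj
    refine ⟨(cotangentTriv I p.proj).mem_source.2 hb, ?_, mem_univ _⟩
    change (cotangentTriv I p.proj (fiberDilation r p)).1 ∈ _
    rw [cotangentTriv_apply]
    exact mem_chart_source H p.proj
  refine Eq.trans (congrArg _ ?_) ((extChartAt (I.prod 𝓘(ℝ, E →L[ℝ] ℝ)) p).left_inv hs)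
  rw [← cotangentTriv_fiberDilation, FiberBundle.extChartAt]
  refine Prod.ext ?_ rfl
  change extChartAt I p.proj (cotangentTriv I p.proj p).1 =
    extChartAt I p.proj (cotangentTriv I p.proj (fiberDilation r p)).1
  rw [cotangentTriv_apply, cotangentTriv_apply]
  rfl

theorem hasVelocityAt_fiberDilation (p : CotangentSpace I M) :
    HasVelocityAt (I.prod 𝓘(ℝ, E →L[ℝ] ℝ)) (fun r ↦ fiberDilation r p) 1
      (fiberDilationField I M p : E × (E →L[ℝ] ℝ)) := by
  set χ := extChartAt (I.prod 𝓘(ℝ, E →L[ℝ] ℝ)) p with hχ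
  set η := (cotangentTriv I p.proj p).2 with hη
  have h1 : HasDerivAt (fun r : ℝ ↦ ((χ p).1, r • η)) ((0 : E), η) 1 := by
    have := (hasDerivAt_const (1 : ℝ) (χ p).1).prodMk ((hasDerivAt_id (1 : ℝ)).smul_const η)
    rwa [one_smul] at this
  have h0 : ((χ p).1, (1 : ℝ) • η) = χ p := by
    rw [one_smul]
    refine Prod.ext rfl ?_
    rw [hχ, FiberBundle.extChartAt]
    rfl
  have h2 : MDifferentiableAt 𝓘(ℝ, E × (E →L[ℝ] ℝ)) (I.prod 𝓘(ℝ, E →L[ℝ] ℝ)) χ.symm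
      ((χ p).1, (1 : ℝ) • η) := by
    rw [h0]
    exact (contMDiffAt_extChartAt_symm (mem_extChartAt_target p)).mdifferentiableAt (by simp)
  have h3 := HasMFDerivAt.comp (1 : ℝ) h2.hasMFDerivAt h1.hasFDerivAt.hasMFDerivAt
  have h4 : (χ.symm ∘ fun r : ℝ ↦ ((χ p).1, r • η)) = fun r ↦ fiberDilation r p :=
    funext fun r ↦ extChartAt_symm_smul r p
  rw [h4] at h3
  refine h3.congr_mfderiv ?_
  refine ContinuousLinearMap.ext_ring ?_
  have h5 : ∀ L L' : E × (E →L[ℝ] ℝ) →L[ℝ] E × (E →L[ℝ] ℝ), L = L' →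
      L ((1 : ℝ) • ((0 : E), η)) = (1 : ℝ) • L' ((0 : E), η) := by
    rintro L _ rfl
    rw [one_smul, one_smul]
  refine h5 _ _ ?_
  rw [h0]

end Cotangent


section CotangentExhaustion

variable {E : Type*} [NormedAddCommGroup E] [NormedSpace ℝ E] [FiniteDimensional ℝ E]
  {H : Type*} [TopologicalSpace H] (I : ModelWithCorners ℝ E H)
  {M : Type*} [TopologicalSpace M] [ChartedSpace H M] [IsManifold I ∞ M]

/-- The square of a Euclidean norm of a covector, read in the trivialization around `q`. -/
def localNormSq (q : M) (p : CotangentSpace I M) : ℝ :=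
  ‖toEuclidean (cotangentTriv I q p).2‖ ^ 2

variable {I}

theorem localNormSq_fiberDilation [I.Boundaryless] (q : M) (r : ℝ) (p : CotangentSpace I M) :
    localNormSq I q (fiberDilation r p) = r ^ 2 * localNormSq I q p := by
  rw [localNormSq, localNormSq, cotangentTriv_fiberDilation, map_smul, norm_smul, mul_pow,
    Real.norm_eq_abs, sq_abs]

theorem contMDiffAt_localNormSq {q : M} {p : CotangentSpace I M}
    (hp : p.proj ∈ (chartAt H q).source) :
    ContMDiffAt (I.prod 𝓘(ℝ, E →L[ℝ] ℝ)) 𝓘(ℝ, ℝ) ∞ (localNormSq I q) p := by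
  have h1 : ContMDiffAt (I.prod 𝓘(ℝ, E →L[ℝ] ℝ)) (I.prod 𝓘(ℝ, E →L[ℝ] ℝ)) ∞
      (cotangentTriv I q) p := by
    refine ((cotangentTriv I q).contMDiffOn (IB := I)).contMDiffAt
      ((cotangentTriv I q).open_source.mem_nhds ((cotangentTriv I q).mem_source.2 ?_))
    rwa [cotangentTriv_baseSet]
  have h2 : ContDiff ℝ ∞ fun η : E →L[ℝ] ℝ ↦ ‖toEuclidean η‖ ^ 2 :=
    (contDiff_norm_sq ℝ).comp toEuclidean.contDiff
  exact h2.contMDiff.contMDiffAt.comp p (contMDiffAt_snd.comp p h1)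

theorem contMDiff_mul_localNormSq [T2Space M] {q : M} (ψ : SmoothBumpFunction I q) :
    ContMDiff (I.prod 𝓘(ℝ, E →L[ℝ] ℝ)) 𝓘(ℝ, ℝ) ∞
      fun p : CotangentSpace I M ↦ ψ p.proj * localNormSq I q p := by
  intro p
  have hproj := Bundle.contMDiff_proj (n := ∞) (F := E →L[ℝ] ℝ) (IB := I) (fun x : M ↦ TangentSpace I x →L[ℝ] ℝ)
  by_cases hp : p.proj ∈ (chartAt H q).source
  · exact (ψ.contMDiff.contMDiffAt.comp p hproj.contMDiffAt).mul (contMDiffAt_localNormSq hp)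
  · refine (contMDiffAt_const (c := (0 : ℝ))).congr_of_eventuallyEq ?_
    filter_upwards [((isClosed_tsupport ψ).isOpen_compl.preimage hproj.continuous).mem_nhds
      fun h ↦ hp (ψ.tsupport_subset_chartAt_source h)] with p' hp'
    rw [image_eq_zero_of_notMem_tsupport hp', zero_mul]

theorem isCompact_localNormSq_le [I.Boundaryless] {q : M} {K : Set M} (hK : IsCompact K)
    (hKq : K ⊆ (chartAt H q).source) (c : ℝ) :
    ∃ C : Set (CotangentSpace I M), IsCompact C ∧
      ∀ p : CotangentSpace I M, p.proj ∈ K → localNormSq I q p ≤ c ^ 2 → p ∈ C := by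
  set B : Set (E →L[ℝ] ℝ) := toEuclidean.symm '' Metric.closedBall 0 |c| with hB
  have hBc : IsCompact B := (isCompact_closedBall _ _).image toEuclidean.symm.continuous
  set e := cotangentTriv I q with he
  refine ⟨e.toOpenPartialHomeomorph.symm '' (K ×ˢ B), (hK.prod hBc).image_of_continuousOn
    (e.toOpenPartialHomeomorph.continuousOn_symm.mono fun z hz ↦ ?_), fun p hpK hp ↦ ?_⟩
  · refine e.mem_target.2 ?_
    rw [he, cotangentTriv_baseSet]
    exact hKq hz.1
  · have hs : p ∈ e.source := e.mem_source.2 (by rw [he, cotangentTriv_baseSet]; exact hKq hpK)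
    refine ⟨e p, ⟨?_, toEuclidean (e p).2, ?_, by simp⟩,
      e.toOpenPartialHomeomorph.left_inv hs⟩
    · rw [e.coe_fst hs]
      exact hpK
    · rw [mem_closedBall_zero_iff]
      exact (le_abs_self _).trans (sq_le_sq.1 hp)

theorem nonOrderableUpToConjugation_canonicalForm [I.Boundaryless] [T2Space M] [CompactSpace M] :
    NonOrderableUpToConjugation ((I.prod 𝓘(ℝ, E →L[ℝ] ℝ)).prod 𝓘(ℝ, ℝ))
      (contactization (I.prod 𝓘(ℝ, E →L[ℝ] ℝ)) (canonicalForm I M)) := by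
  have hproj := Bundle.contMDiff_proj (n := ∞) (F := E →L[ℝ] ℝ) (IB := I) (fun x : M ↦ TangentSpace I x →L[ℝ] ℝ)
  let ψ : ∀ q : M, SmoothBumpFunction I q := fun q ↦ Classical.arbitrary _
  obtain ⟨s, hs⟩ := CompactSpace.elim_nhds_subcover (fun q : M ↦ {x | ψ q x = 1})
    fun q ↦ (ψ q).eventuallyEq_one
  set Q : CotangentSpace I M → ℝ := fun p ↦ ∑ q ∈ s, ψ q p.proj * localNormSq I q p with hQ
  have hQ0 : ∀ p, 0 ≤ Q p := fun p ↦ Finset.sum_nonneg fun q _ ↦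
    mul_nonneg (ψ q).nonneg (sq_nonneg _)
  have hQs : ContMDiff (I.prod 𝓘(ℝ, E →L[ℝ] ℝ)) 𝓘(ℝ, ℝ) ∞ Q :=
    contMDiff_finsetSum fun q _ ↦ contMDiff_mul_localNormSq (ψ q)
  have hQr : ∀ r p, Q (fiberDilation r p) = r ^ 2 * Q p := by
    intro r p
    simp only [hQ, Finset.mul_sum, localNormSq_fiberDilation]
    exact Finset.sum_congr rfl fun q _ ↦ mul_left_comm _ _ _
  set g : CotangentSpace I M → ℝ := fun p ↦ √(1 + Q p) with hg
  have hgs : ContMDiff (I.prod 𝓘(ℝ, E →L[ℝ] ℝ)) 𝓘(ℝ, ℝ) ∞ g := fun p ↦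
    ContMDiffAt.comp p ((Real.contDiffAt_sqrt (by linarith [hQ0 p] : 1 + Q p ≠ 0)).contMDiffAt)
      (contMDiffAt_const.add hQs.contMDiffAt)
  have hg1 : ∀ p, 1 ≤ g p := fun p ↦ Real.one_le_sqrt.2 (by linarith [hQ0 p])
  have hgQ : ∀ p, g p ^ 2 = 1 + Q p := fun p ↦ Real.sq_sqrt (by linarith [hQ0 p])
  have hgZ : ∀ p, differential (I.prod 𝓘(ℝ, E →L[ℝ] ℝ)) g p (fiberDilationField I M p) =
      Q p / g p := by
    have key : ∀ p p' : CotangentSpace I M, p' = p → fiberDilation 1 p = p' →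
        differential (I.prod 𝓘(ℝ, E →L[ℝ] ℝ)) g p'
          (fiberDilationField I M p : E × (E →L[ℝ] ℝ)) = Q p / g p := by
      rintro p _ hp' rfl
      have h1 := (hasVelocityAt_fiberDilation p).hasDerivAt_comp
        (hgs.mdifferentiableAt (by simp))
      have h2 : HasDerivAt (fun r : ℝ ↦ √(1 + r ^ 2 * Q p))
          ((2 * 1 * Q p) / (2 * √(1 + 1 ^ 2 * Q p))) 1 := by
        have h3 := (((hasDerivAt_pow 2 (1 : ℝ)).mul_const (Q p)).const_add 1).sqrt
          (by linarith [hQ0 p] : 1 + 1 ^ 2 * Q p ≠ 0)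
        simpa using h3
      have h3 : (fun r ↦ g (fiberDilation r p)) = fun r : ℝ ↦ √(1 + r ^ 2 * Q p) :=
        funext fun r ↦ by simp only [hg, hQr]
      rw [h3] at h1
      refine (h1.unique h2).trans ?_
      rw [hg]
      simp only [one_pow, one_mul, mul_one]
      exact mul_div_mul_left _ _ two_ne_zero
    intro p
    have h1 : fiberDilation 1 p = p := by rw [fiberDilation, one_smul]
    exact key p p rfl h1
  refine nonOrderableUpToConjugation_contactization canonicalForm_isSmoothInCharts
    canonicalForm_isExactSymplectic isLiouvilleField_fiberDilationField hgs (fun c ↦ ?_) hg1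
    (fun p ↦ ?_) (c := 2⁻¹) (m := 2) (by norm_num) (fun p hp ↦ ?_)
  · have hcover : ∀ q : M, ∃ C : Set (CotangentSpace I M), IsCompact C ∧
        ∀ p : CotangentSpace I M, ψ q p.proj = 1 → localNormSq I q p ≤ c ^ 2 → p ∈ C := by
      intro q
      have hK : IsCompact {x | ψ q x = 1} :=
        (isClosed_eq (ψ q).continuous continuous_const).isCompact
      refine isCompact_localNormSq_le hK (fun x hx ↦ ?_) c
      refine (ψ q).tsupport_subset_chartAt_source (subset_tsupport _ ?_)
      rw [Function.mem_support, show ψ q x = 1 from hx]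
      exact one_ne_zero
    choose C hC hCp using hcover
    refine (s.isCompact_biUnion fun q _ ↦ hC q).of_isClosed_subset
      (isClosed_le hgs.continuous continuous_const) fun p hp ↦ ?_
    have hp' : p.proj ∈ ⋃ q ∈ s, {x | ψ q x = 1} := hs ▸ mem_univ _
    obtain ⟨q, hq, hqp⟩ := mem_iUnion₂.1 hp'
    refine mem_iUnion₂.2 ⟨q, hq, hCp q p hqp ?_⟩
    have h1 : ψ q p.proj * localNormSq I q p ≤ Q p :=
      Finset.single_le_sum (f := fun q ↦ ψ q p.proj * localNormSq I q p)
        (fun q _ ↦ mul_nonneg (ψ q).nonneg (sq_nonneg _)) hq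
    rw [show ψ q p.proj = 1 from hqp, one_mul] at h1
    have h2 : g p ≤ c := hp
    nlinarith [hg1 p, hgQ p]
  · rw [hgZ]
    exact div_nonneg (hQ0 p) (zero_le_one.trans (hg1 p))
  · have h0 : 0 < g p := one_pos.trans_le (hg1 p)
    rw [hgZ, le_div_iff₀ h0]
    nlinarith [hgQ p]

end CotangentExhaustion


/-! ### Liouville completions: smoothness and completeness of the Liouville field -/

section Completion

variable {E : Type*} [NormedAddCommGroup E] [NormedSpace ℝ E]
  {H : Type*} [TopologicalSpace H] {I : ModelWithCorners ℝ E H}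
  {V : Type*} [TopologicalSpace V] [ChartedSpace H V]

theorem OneForm.IsSmooth.isSmoothInCharts [IsManifold I ∞ V] [I.Boundaryless] {lam : OneForm I V}
    (h : lam.IsSmooth I) : lam.IsSmoothInCharts I := by
  have : IsManifold I 1 V := .of_le (n := ∞) (by simp)
  intro x₀ y hy
  set χ := extChartAt I x₀
  set s : V → CotangentSpace I V := fun x ↦ ⟨x, lam x⟩
  have hsrc : ∀ y ∈ χ.target, χ.symm y ∈ (chartAt H x₀).source := fun y hy ↦ by
    rw [← extChartAt_source I]
    exact χ.map_target hy
  have h1 : ContMDiffAt (I.prod 𝓘(ℝ, E →L[ℝ] ℝ)) (I.prod 𝓘(ℝ, E →L[ℝ] ℝ)) ∞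
      (cotangentTriv I x₀) (s (χ.symm y)) := by
    refine ((cotangentTriv I x₀).contMDiffOn (IB := I)).contMDiffAt
      ((cotangentTriv I x₀).open_source.mem_nhds ((cotangentTriv I x₀).mem_source.2 ?_))
    rw [cotangentTriv_baseSet]
    exact hsrc y hy
  have h2 : ContMDiffAt I (I.prod 𝓘(ℝ, E →L[ℝ] ℝ)) ∞ (fun x ↦ cotangentTriv I x₀ (s x))
      (χ.symm y) := h1.comp (χ.symm y) (h (χ.symm y))
  have h3 : ContMDiffAt 𝓘(ℝ, E) 𝓘(ℝ, E →L[ℝ] ℝ) ∞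
      (fun z ↦ (cotangentTriv I x₀ (s (χ.symm z))).2) y :=
    contMDiffAt_snd.comp y (h2.comp y (contMDiffAt_extChartAt_symm hy))
  refine (h3.contDiffAt.congr_of_eventuallyEq ?_).contDiffWithinAt
  filter_upwards [(isOpen_extChartAt_target x₀).mem_nhds hy] with z hz
  rw [cotangentTriv_apply]
  have h4 := TangentBundle.symmL_trivializationAt (I := I) (hsrc z hz)
  rw [I.range_eq_univ, mfderivWithin_univ, χ.right_inv hz] at h4
  exact congrArg (fun L : E →L[ℝ] E ↦ (lam (χ.symm z) : E →L[ℝ] ℝ).comp L) h4.symm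

theorem IsLiouvilleField.isSmoothField [IsManifold I ∞ V] [I.Boundaryless] [FiniteDimensional ℝ E]
    {lam : OneForm I V} (hlam : lam.IsSmoothInCharts I) (hnd : IsExactSymplectic I lam)
    {Z : ∀ x : V, TangentSpace I x} (hZ : IsLiouvilleField I lam Z) : IsSmoothField I Z := by
  refine isSmoothField_of_inChart fun x₀ ↦ ?_
  have hflat : ∀ (x : V) (v w : TangentSpace I x), lam.flat I 0 x v w = lam.d I x v w :=
    fun x v w ↦ by rw [OneForm.flat, zero_mul, add_zero]
  have := hlam.contDiffOn_of_flat_eq (c := 0) (X := fun _ ↦ Z) (β := fun _ ↦ lam) (x₀ := x₀)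
    (fun x v hv ↦ hnd x v fun w ↦ (hflat x v w).symm.trans (hv w))
    (fun _ x w ↦ (hflat x _ w).trans (hZ x w))
    ((hlam x₀).comp contDiffOn_snd fun q hq ↦ hq.2)
  exact ContDiffOn.comp (g := fun q : ℝ × E ↦ (fieldInChart I Z x₀ q.2 : E))
    (f := fun y ↦ ((0 : ℝ), y)) this (contDiffOn_const.prodMk contDiffOn_id)
    fun y hy ↦ ⟨mem_univ _, hy⟩

/-- Integral curves ending and starting at the same point can be concatenated. -/
theorem IsMIntegralCurveOn.exists_concat {v : ∀ x : V, TangentSpace I x} {γ₁ γ₂ : ℝ → V} {ε : ℝ}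
    (hε : 0 < ε) (h₁ : IsMIntegralCurveOn γ₁ v (Ioo (-ε) ε)) (h₂ : IsMIntegralCurveOn γ₂ v (Ici 0))
    (h : γ₁ 0 = γ₂ 0) :
    ∃ γ : ℝ → V, (∀ t, 0 ≤ t → γ t = γ₂ t) ∧ IsMIntegralCurveOn γ v (Ioi (-ε)) := by
  set γ : ℝ → V := fun t ↦ if t < 0 then γ₁ t else γ₂ t with hγ
  have hneg : ∀ t, t < 0 → γ t = γ₁ t := fun t ht ↦ if_pos ht
  have hpos : ∀ t, 0 ≤ t → γ t = γ₂ t := fun t ht ↦ if_neg ht.not_gt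
  have h0 : γ 0 = γ₁ 0 := (hpos 0 le_rfl).trans h.symm
  refine ⟨γ, hpos, fun t ht ↦ HasMFDerivAt.hasMFDerivWithinAt ?_⟩
  rcases lt_trichotomy t 0 with hlt | rfl | hgt
  · have h3 := (h₁ t ⟨ht, hlt.trans hε⟩).hasMFDerivAt (Ioo_mem_nhds ht (hlt.trans hε))
    rw [← hneg t hlt] at h3
    refine h3.congr_of_eventuallyEq ?_
    filter_upwards [Iio_mem_nhds hlt] with r hr using hneg r hr
  · have h3 := (h₁ 0 ⟨ht, hε⟩).hasMFDerivAt (Ioo_mem_nhds ht hε)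
    have h4 := h₂ 0 self_mem_Ici
    rw [← h0] at h3
    rw [← hpos 0 le_rfl] at h4
    have h5 := (h3.hasMFDerivWithinAt (s := Iic 0)).congr_of_eventuallyEq (f₁ := γ) (by
      filter_upwards [self_mem_nhdsWithin] with r hr
      rcases (mem_Iic.1 hr).lt_or_eq with h | rfl
      exacts [hneg r h, h0]) h0
    have h6 := h4.congr_of_eventuallyEq (f₁ := γ) (by
      filter_upwards [self_mem_nhdsWithin] with r hr using hpos r hr) (hpos 0 le_rfl)
    exact (h5.union h6).hasMFDerivAt (by rw [Iic_union_Ici]; exact Filter.univ_mem)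
  · have h3 := (h₂ t hgt.le).hasMFDerivAt (Ici_mem_nhds hgt)
    rw [← hpos t hgt.le] at h3
    refine h3.congr_of_eventuallyEq ?_
    filter_upwards [Ioi_mem_nhds hgt] with r hr using hpos r (le_of_lt hr)

variable [IsManifold I ∞ V] [I.Boundaryless] [FiniteDimensional ℝ E] [T2Space V]

/-- A vector field which is complete in positive time on the end of a manifold is complete. -/
theorem IsSmoothField.exists_flow_of_end {Z : ∀ x : V, TangentSpace I x} (hZ : IsSmoothField I Z)
    {W : Set V} (hW : IsCompact W) {κ : ℝ → V → V}
    (hκ : ∀ y ∈ frontier W, κ 0 y = y ∧ IsMIntegralCurveOn (fun r ↦ κ r y) Z (Ici 0))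
    (hend : ∀ x ∉ W, ∃ r : ℝ, 0 ≤ r ∧ ∃ y ∈ frontier W, κ r y = x) :
    ∃ ψ : ℝ → V → V, ContMDiff (𝓘(ℝ, ℝ).prod I) I ∞ (fun p : ℝ × V ↦ ψ p.1 p.2) ∧
      (∀ x, ψ 0 x = x) ∧ (∀ x, IsMIntegralCurve (fun t ↦ ψ t x) Z) ∧
      (∀ s t x, ψ (s + t) x = ψ s (ψ t x)) ∧
      ∀ y ∈ frontier W, ∀ r : ℝ, 0 ≤ r → ψ r y = κ r y := by
  have : IsManifold I 1 V := .of_le (n := ∞) (by simp)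
  obtain ⟨ε, hε, hεW⟩ := hZ.exists_uniform_time hW
  have hglue : ∀ y ∈ frontier W, ∃ γ : ℝ → V, (∀ t, 0 ≤ t → γ t = κ t y) ∧
      IsMIntegralCurveOn γ Z (Ioi (-ε)) := by
    intro y hy
    obtain ⟨γ, h0, hγ⟩ := hεW y (hW.isClosed.frontier_subset hy)
    exact IsMIntegralCurveOn.exists_concat hε hγ (hκ y hy).2 (h0.trans (hκ y hy).1.symm)
  have hc : ∀ x, ∃ γ : ℝ → V, γ 0 = x ∧ IsMIntegralCurve γ Z := by
    refine exists_isMIntegralCurve_of_isMIntegralCurveOn (hZ.of_le (by simp)) hε fun x ↦ ?_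
    by_cases hx : x ∈ W
    · exact hεW x hx
    · obtain ⟨r, hr, y, hy, rfl⟩ := hend x hx
      obtain ⟨γ, h0, hγ⟩ := hglue y hy
      refine ⟨_, ?_, (hγ.comp_add r).mono fun t ht ↦ ?_⟩
      · simpa using h0 r hr
      · change -ε < t + r
        linarith [ht.1]
  obtain ⟨ψ, hψ, hψ0, hψc, hψa⟩ := hZ.exists_flow hc
  refine ⟨ψ, hψ, hψ0, hψc, hψa, fun y hy r hr ↦ ?_⟩
  obtain ⟨γ, h0, hγ⟩ := hglue y hy
  have h1 := isMIntegralCurveOn_Ioo_eqOn_of_contMDiff_boundaryless (t₀ := 0) (a := -ε) (b := r + 1)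
    ⟨by linarith, by linarith⟩ (hZ.of_le (by simp)) ((hψc y).isMIntegralCurveOn _)
    (hγ.mono Ioo_subset_Ioi_self) (by rw [hψ0, h0 0 le_rfl, (hκ y hy).1])
  exact (h1 ⟨by linarith, by linarith⟩).trans (h0 r hr)

end Completion


/-! ### An exhausting function for the completion of a Liouville domain -/

/-- A smooth nondecreasing function which is equal to `1` on the nonpositive half-line and grows
exponentially. -/
def endProfile (r : ℝ) : ℝ := 1 + Real.smoothTransition r * Real.exp r

theorem contDiff_endProfile : ContDiff ℝ ∞ endProfile :=
  contDiff_const.add (Real.smoothTransition.contDiff.mul Real.contDiff_exp)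

theorem endProfile_of_nonpos {r : ℝ} (h : r ≤ 0) : endProfile r = 1 := by
  rw [endProfile, Real.smoothTransition.zero_of_nonpos h, zero_mul, add_zero]

theorem endProfile_of_one_le {r : ℝ} (h : 1 ≤ r) : endProfile r = 1 + Real.exp r := by
  rw [endProfile, Real.smoothTransition.one_of_one_le h, one_mul]

theorem one_le_endProfile (r : ℝ) : 1 ≤ endProfile r :=
  le_add_of_nonneg_right (mul_nonneg (Real.smoothTransition.nonneg r) (Real.exp_pos r).le)

theorem monotone_endProfile : Monotone endProfile := by
  intro r s hrs
  exact add_le_add_right (mul_le_mul (Real.smoothTransition.monotone hrs) (Real.exp_le_exp.2 hrs)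
    (Real.exp_pos r).le (Real.smoothTransition.nonneg s)) 1

theorem one_le_of_le_endProfile {r : ℝ} (h : 1 + Real.exp 1 ≤ endProfile r) : 1 ≤ r := by
  by_contra! hr
  have h1 := Real.exp_lt_exp.2 hr
  have h2 := mul_le_mul_of_nonneg_right (Real.smoothTransition.le_one r) (Real.exp_pos r).le
  rw [endProfile] at h
  linarith

theorem le_of_endProfile_le {r c : ℝ} (h : endProfile r ≤ c) : r ≤ max 1 c := by
  by_cases hr : 1 ≤ r
  · rw [endProfile_of_one_le hr] at h
    exact le_max_of_le_right (by linarith [Real.add_one_le_exp r])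
  · exact le_max_of_le_left (le_of_not_ge hr)

theorem endProfile_le_deriv {r : ℝ} (h : 1 + Real.exp 1 ≤ endProfile r) :
    1 / 2 * endProfile r ≤ deriv endProfile r := by
  have hr := one_le_of_le_endProfile h
  have h1 : HasDerivAt Real.smoothTransition (deriv Real.smoothTransition r) r :=
    ((Real.smoothTransition.contDiff (n := 1)).differentiable (by simp) r).hasDerivAt
  have h2 := (h1.mul (Real.hasDerivAt_exp r)).const_add 1
  have h3 : deriv endProfile r = deriv Real.smoothTransition r * Real.exp r +
      Real.smoothTransition r * Real.exp r := h2.deriv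
  have h4 : 0 ≤ deriv Real.smoothTransition r := Real.smoothTransition.monotone.deriv_nonneg
  rw [h3, endProfile_of_one_le hr, Real.smoothTransition.one_of_one_le hr]
  have h5 := mul_nonneg h4 (Real.exp_pos r).le
  linarith [Real.add_one_le_exp r]

section Completion

variable {E : Type*} [NormedAddCommGroup E] [NormedSpace ℝ E]
  {H : Type*} [TopologicalSpace H] (I : ModelWithCorners ℝ E H)
  {V : Type*} [TopologicalSpace V] [ChartedSpace H V]

/-- The flow `ψ` of `Z` crosses the level set `{f = 0}` transversally, each trajectory at most once,
and each trajectory through a point of `{f > 0}` exactly once. -/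
structure IsTransverseFlow (Z : ∀ x : V, TangentSpace I x) (f : V → ℝ) (ψ : ℝ → V → V) :
    Prop where
  contMDiff_flow : ContMDiff (𝓘(ℝ, ℝ).prod I) I ∞ (fun p : ℝ × V ↦ ψ p.1 p.2)
  flow_zero : ∀ x, ψ 0 x = x
  integralCurve : ∀ x, IsMIntegralCurve (fun t ↦ ψ t x) Z
  flow_add : ∀ s t x, ψ (s + t) x = ψ s (ψ t x)
  contMDiff_level : ContMDiff I 𝓘(ℝ, ℝ) ∞ f
  transverse : ∀ x, f x = 0 → 0 < differential I f x (Z x)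
  once : ∀ x s, f x = 0 → f (ψ s x) = 0 → s = 0
  reaches : ∀ x, 0 < f x → ∃ r : ℝ, f (ψ (-r) x) = 0

variable {I} {Z : ∀ x : V, TangentSpace I x} {f : V → ℝ} {ψ : ℝ → V → V}

theorem IsMIntegralCurve.hasDerivAt_comp {γ : ℝ → V} (h : IsMIntegralCurve γ Z)
    (hf : ContMDiff I 𝓘(ℝ, ℝ) ∞ f) (t : ℝ) :
    HasDerivAt (fun r ↦ f (γ r)) (differential I f (γ t) (Z (γ t))) t :=
  HasVelocityAt.hasDerivAt_comp (h t) (hf.mdifferentiableAt (by simp))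

/-- A function with positive derivative at its zero is positive shortly afterwards. -/
theorem eventually_pos_of_hasDerivAt {u : ℝ → ℝ} {a : ℝ} (h0 : u 0 = 0) (h : HasDerivAt u a 0)
    (ha : 0 < a) : (∀ᶠ s in 𝓝[>] 0, 0 < u s) ∧ ∀ᶠ s in 𝓝[<] 0, u s < 0 := by
  have h1 := (hasDerivAt_iff_tendsto_slope.1 h).eventually (lt_mem_nhds ha)
  constructor
  · filter_upwards [h1.filter_mono (nhdsWithin_mono _ fun s (hs : 0 < s) ↦ hs.ne'),
      self_mem_nhdsWithin] with s hs (hs0 : 0 < s)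
    rw [slope_def_field, h0, sub_zero, sub_zero] at hs
    exact (div_pos_iff_of_pos_right hs0).1 hs
  · filter_upwards [h1.filter_mono (nhdsWithin_mono _ fun s (hs : s < 0) ↦ hs.ne),
      self_mem_nhdsWithin] with s hs (hs0 : s < 0)
    rw [slope_def_field, h0, sub_zero, sub_zero] at hs
    by_contra! hu
    exact (div_nonpos_of_nonneg_of_nonpos hu hs0.le).not_gt hs

theorem IsTransverseFlow.hasDerivAt_level (h : IsTransverseFlow I Z f ψ) (x : V) (t : ℝ) :
    HasDerivAt (fun r ↦ f (ψ r x)) (differential I f (ψ t x) (Z (ψ t x))) t :=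
  IsMIntegralCurve.hasDerivAt_comp (h.integralCurve x) h.contMDiff_level t

theorem IsTransverseFlow.level_pos (h : IsTransverseFlow I Z f ψ) {x : V} (hx : f x = 0) {s : ℝ}
    (hs : 0 < s) : 0 < f (ψ s x) := by
  have h1 := h.hasDerivAt_level x 0
  rw [h.flow_zero] at h1
  have h2 := (eventually_pos_of_hasDerivAt (by rw [h.flow_zero, hx]) h1 (h.transverse x hx)).1
  obtain ⟨t, ht, ht0, hts⟩ := (h2.and (Ioo_mem_nhdsGT hs)).exists
  by_contra! hc
  obtain ⟨r, hr, hr0⟩ := intermediate_value_Icc' hts.le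
    (fun r _ ↦ (h.hasDerivAt_level x r).continuousAt.continuousWithinAt) ⟨hc, ht.le⟩
  exact (ht0.trans_le hr.1).ne' (h.once x r hx hr0)

theorem IsTransverseFlow.level_neg (h : IsTransverseFlow I Z f ψ) {x : V} (hx : f x = 0) {s : ℝ}
    (hs : s < 0) : f (ψ s x) < 0 := by
  have h1 := h.hasDerivAt_level x 0
  rw [h.flow_zero] at h1
  have h2 := (eventually_pos_of_hasDerivAt (by rw [h.flow_zero, hx]) h1 (h.transverse x hx)).2
  obtain ⟨t, ht, hts, ht0⟩ := (h2.and (Ioo_mem_nhdsLT hs)).exists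
  by_contra! hc
  obtain ⟨r, hr, hr0⟩ := intermediate_value_Icc' hts.le
    (fun r _ ↦ (h.hasDerivAt_level x r).continuousAt.continuousWithinAt) ⟨ht.le, hc⟩
  exact (hr.2.trans_lt ht0).ne (h.once x r hx hr0)

theorem IsTransverseFlow.flow_neg_flow (h : IsTransverseFlow I Z f ψ) (r : ℝ) (x : V) :
    ψ r (ψ (-r) x) = x := by
  rw [← h.flow_add, add_neg_cancel, h.flow_zero]

theorem IsTransverseFlow.crossing_unique (h : IsTransverseFlow I Z f ψ) {x : V} {r r' : ℝ}
    (hr : f (ψ (-r) x) = 0) (hr' : f (ψ (-r') x) = 0) : r = r' := by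
  have h1 : ψ (-r') x = ψ (r - r') (ψ (-r) x) := by
    rw [← h.flow_add]
    congr 1
    ring
  rw [h1] at hr'
  exact sub_eq_zero.1 (h.once _ _ hr hr')

theorem IsTransverseFlow.nonpos_of_level_nonpos (h : IsTransverseFlow I Z f ψ) {x : V} {r : ℝ}
    (hr : f (ψ (-r) x) = 0) (hx : f x ≤ 0) : r ≤ 0 := by
  by_contra! hr0
  have := h.level_pos hr hr0
  rw [h.flow_neg_flow] at this
  exact this.not_ge hx

theorem IsTransverseFlow.exists_crossing (h : IsTransverseFlow I Z f ψ) {x : V} (hx : 0 ≤ f x) :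
    ∃ r, 0 ≤ r ∧ f (ψ (-r) x) = 0 := by
  rcases hx.eq_or_lt with hx | hx
  · exact ⟨0, le_rfl, by rw [neg_zero, h.flow_zero, hx]⟩
  · obtain ⟨r, hr⟩ := h.reaches x hx
    refine ⟨r, ?_, hr⟩
    by_contra! hr0
    have := h.level_neg hr hr0
    rw [h.flow_neg_flow] at this
    exact this.not_gt hx

open Classical in
/-- The composition of `endProfile` with the time since the crossing of the level set `{f = 0}`. -/
def endFunction (f : V → ℝ) (ψ : ℝ → V → V) (x : V) : ℝ :=
  if h : ∃ r, f (ψ (-r) x) = 0 then endProfile h.choose else 1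

theorem IsTransverseFlow.endFunction_eq (h : IsTransverseFlow I Z f ψ) {x : V} {r : ℝ}
    (hr : f (ψ (-r) x) = 0) : endFunction f ψ x = endProfile r := by
  have h1 : ∃ r, f (ψ (-r) x) = 0 := ⟨r, hr⟩
  rw [endFunction, dif_pos h1, h.crossing_unique h1.choose_spec hr]

theorem IsTransverseFlow.endFunction_of_nonpos (h : IsTransverseFlow I Z f ψ) {x : V}
    (hx : f x ≤ 0) : endFunction f ψ x = 1 := by
  by_cases h1 : ∃ r, f (ψ (-r) x) = 0
  · obtain ⟨r, hr⟩ := h1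
    rw [h.endFunction_eq hr, endProfile_of_nonpos (h.nonpos_of_level_nonpos hr hx)]
  · rw [endFunction, dif_neg h1]

theorem one_le_endFunction {V : Type*} {f : V → ℝ} {ψ : ℝ → V → V} (x : V) : 1 ≤ endFunction f ψ x := by
  rw [endFunction]
  split_ifs
  exacts [one_le_endProfile _, le_rfl]

theorem IsTransverseFlow.isCompact_endFunction_le (h : IsTransverseFlow I Z f ψ)
    (hW : IsCompact {x | f x ≤ 0}) (hg : Continuous (endFunction f ψ)) (c : ℝ) :
    IsCompact {x | endFunction f ψ x ≤ c} := by
  have h0 : IsCompact {x | f x = 0} := hW.of_isClosed_subset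
    (isClosed_eq h.contMDiff_level.continuous continuous_const) fun x (hx : f x = 0) ↦ hx.le
  have h1 := ((isCompact_Icc (a := (0 : ℝ)) (b := max 1 c)).prod h0).image
    h.contMDiff_flow.continuous
  refine (hW.union h1).of_isClosed_subset (isClosed_le hg continuous_const) fun x hx ↦ ?_
  rcases le_or_gt (f x) 0 with hf | hf
  · exact Or.inl hf
  · obtain ⟨r, hr0, hr⟩ := h.exists_crossing hf.le
    have h2 : endProfile r ≤ c := (h.endFunction_eq hr).symm.trans_le hx
    exact Or.inr ⟨(r, ψ (-r) x), ⟨⟨hr0, le_of_endProfile_le h2⟩, hr⟩, h.flow_neg_flow r x⟩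

theorem IsTransverseFlow.differential_endFunction_of_neg
    (h : IsTransverseFlow I Z f ψ) {x : V} (hx : f x < 0) :
    differential I (endFunction f ψ) x (Z x) = 0 := by
  have h1 : endFunction f ψ =ᶠ[𝓝 x] fun _ ↦ 1 := by
    filter_upwards [h.contMDiff_level.continuous.continuousAt.eventually (gt_mem_nhds hx)] with z hz
    exact h.endFunction_of_nonpos (le_of_lt hz)
  rw [differential_congr h1]
  exact congrArg (fun L : TangentSpace I x →L[ℝ] ℝ ↦ L (Z x)) mfderiv_const

variable [IsManifold I ∞ V] [FiniteDimensional ℝ E]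

/-- The time since the crossing of the level set `{f = 0}` is locally a smooth function. -/
theorem IsTransverseFlow.exists_smooth_crossing [I.Boundaryless] [T2Space V]
    (h : IsTransverseFlow I Z f ψ) {x : V} {r : ℝ} (hr : f (ψ (-r) x) = 0) :
    ∃ ρ : V → ℝ, ContMDiffAt I 𝓘(ℝ, ℝ) ∞ ρ x ∧ ∀ᶠ z in 𝓝 x, f (ψ (-ρ z) z) = 0 := by
  set F : ℝ × V → ℝ := fun p ↦ f (ψ (-p.1) p.2) with hF
  have hneg : ContMDiff (𝓘(ℝ, ℝ).prod I) (𝓘(ℝ, ℝ).prod I) ∞ fun p : ℝ × V ↦ (-p.1, p.2) :=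
    contMDiff_fst.neg.prodMk contMDiff_snd
  have hFs : ContMDiff (𝓘(ℝ, ℝ).prod I) 𝓘(ℝ, ℝ) ∞ F :=
    h.contMDiff_level.comp (h.contMDiff_flow.comp hneg)
  set Θ : ℝ × V → ℝ × V := fun p ↦ (F p, p.2) with hΘ
  have hΘs : ContMDiff (𝓘(ℝ, ℝ).prod I) (𝓘(ℝ, ℝ).prod I) ∞ Θ := hFs.prodMk contMDiff_snd
  have hd := hFs.mdifferentiableAt (x := (r, x)) (by simp)
  have h1 : mfderiv (𝓘(ℝ, ℝ).prod I) (𝓘(ℝ, ℝ).prod I) Θ (r, x) =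
      (mfderiv (𝓘(ℝ, ℝ).prod I) 𝓘(ℝ, ℝ) F (r, x)).prod
        (mfderiv (𝓘(ℝ, ℝ).prod I) I Prod.snd (r, x)) :=
    mfderiv_prodMk hd (contMDiff_snd.mdifferentiableAt (n := ∞) (by simp))
  rw [mfderiv_snd] at h1
  have h2 : HasDerivAt (fun s ↦ F (s, x))
      (differential I f (ψ (-r) x) (Z (ψ (-r) x)) * -1) r :=
    (h.hasDerivAt_level x (-r)).comp r (hasDerivAt_neg r)
  have hpos := h.transverse _ hr
  have hinv : (mfderiv (𝓘(ℝ, ℝ).prod I) (𝓘(ℝ, ℝ).prod I) Θ (r, x)).IsInvertible := by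
    refine isInvertible_of_injective_endo (F := ℝ × E) ((injective_iff_map_eq_zero _).2 ?_)
    rintro ⟨a, w⟩ hv
    have h3 : ((mfderiv (𝓘(ℝ, ℝ).prod I) 𝓘(ℝ, ℝ) F (r, x) (a, w), w) : ℝ × E) = 0 :=
      (congrArg (fun L : ℝ × E →L[ℝ] ℝ × E ↦ L (a, w)) h1).symm.trans hv
    obtain ⟨h4, rfl⟩ := Prod.mk.inj h3
    have h5 := mfderiv_prod_eq_add_apply (v := ((a : ℝ), (0 : E))) hd
    have h6 : mfderiv I 𝓘(ℝ, ℝ) (fun z : V ↦ F (r, z)) x (0 : E) = (0 : ℝ) :=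
      map_zero (mfderiv I 𝓘(ℝ, ℝ) (fun z : V ↦ F (r, z)) x)
    have h7 : mfderiv 𝓘(ℝ, ℝ) 𝓘(ℝ, ℝ) (fun z : ℝ ↦ F (z, x)) r a =
        a * (differential I f (ψ (-r) x) (Z (ψ (-r) x)) * -1) := by
      rw [h2.hasFDerivAt.hasMFDerivAt.mfderiv]
      rfl
    have h8 : (0 : ℝ) = a * (differential I f (ψ (-r) x) (Z (ψ (-r) x)) * -1) + 0 :=
      h4.symm.trans (h5.trans (congrArg₂ (fun a b : ℝ ↦ a + b) h7 h6))
    have h9 : a = (0 : ℝ) := by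
      rw [add_zero, mul_neg_one, mul_neg] at h8
      exact (mul_eq_zero.1 (neg_eq_zero.1 h8.symm)).resolve_right hpos.ne'
    rw [h9]
    rfl
  obtain ⟨G, hG, -, hGev⟩ := exists_contMDiffAt_rightInverse hΘs.contMDiffAt hinv
  have hΘr : Θ (r, x) = (0, x) := Prod.ext hr rfl
  rw [hΘr] at hG hGev
  refine ⟨fun z ↦ (G (0, z)).1, ?_, ?_⟩
  · have h3 : ContMDiffAt I (𝓘(ℝ, ℝ).prod I) ∞ (fun z : V ↦ ((0 : ℝ), z)) x :=
      contMDiffAt_const.prodMk contMDiffAt_id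
    exact contMDiffAt_fst.comp x (hG.comp x h3)
  · have h3 : Filter.Tendsto (fun z : V ↦ ((0 : ℝ), z)) (𝓝 x) (𝓝 (0, x)) :=
      (Continuous.prodMk_right (0 : ℝ)).tendsto x
    filter_upwards [h3.eventually hGev] with z hz
    obtain ⟨h4, h5⟩ := Prod.mk.inj hz
    refine Eq.trans ?_ h4
    change f (ψ (-(G (0, z)).1) z) = f (ψ (-(G (0, z)).1) (G (0, z)).2)
    rw [h5]

theorem IsTransverseFlow.contMDiff_endFunction [I.Boundaryless] [T2Space V]
    (h : IsTransverseFlow I Z f ψ) : ContMDiff I 𝓘(ℝ, ℝ) ∞ (endFunction f ψ) := by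
  intro x
  rcases lt_or_ge (f x) 0 with hx | hx
  · refine (contMDiffAt_const (c := (1 : ℝ))).congr_of_eventuallyEq ?_
    filter_upwards [h.contMDiff_level.continuous.continuousAt.eventually (gt_mem_nhds hx)] with z hz
    exact h.endFunction_of_nonpos (le_of_lt hz)
  · obtain ⟨r, -, hr⟩ := h.exists_crossing hx
    obtain ⟨ρ, hρ, hρz⟩ := h.exists_smooth_crossing hr
    refine (contDiff_endProfile.contMDiff.contMDiffAt.comp x hρ).congr_of_eventuallyEq ?_
    filter_upwards [hρz] with z hz using h.endFunction_eq hz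

theorem IsTransverseFlow.differential_endFunction [I.Boundaryless] [T2Space V]
    (h : IsTransverseFlow I Z f ψ) {x : V} {r : ℝ} (hr : f (ψ (-r) x) = 0) :
    differential I (endFunction f ψ) x (Z x) = deriv endProfile r := by
  have h1 := IsMIntegralCurve.hasDerivAt_comp (h.integralCurve x) h.contMDiff_endFunction 0
  rw [h.flow_zero] at h1
  have h2 : (fun s ↦ endFunction f ψ (ψ s x)) = fun s ↦ endProfile (s + r) := by
    ext s
    refine h.endFunction_eq ?_
    rw [← h.flow_add, neg_add_rev, neg_add_cancel_right, hr]
  have h3 : HasDerivAt endProfile (deriv endProfile r) (0 + r) := by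
    rw [zero_add]
    exact (contDiff_endProfile.differentiable (by simp) r).hasDerivAt
  rw [h2] at h1
  exact h1.unique (h3.comp_add_const 0 r)

end Completion


section Completion

variable {E : Type*} [NormedAddCommGroup E] [NormedSpace ℝ E]
  {H : Type*} [TopologicalSpace H] {I : ModelWithCorners ℝ E H}
  {V : Type*} [TopologicalSpace V] [ChartedSpace H V] [IsManifold I ∞ V]
  [I.Boundaryless] [FiniteDimensional ℝ E] [T2Space V]

/-- The boundary of a Liouville domain is the zero level set of its defining function. -/
theorem frontier_sublevel_eq {Z : ∀ x : V, TangentSpace I x} (hZ : IsSmoothField I Z) {f : V → ℝ}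
    (hf : ContMDiff I 𝓘(ℝ, ℝ) ∞ f) (hfZ : ∀ x, f x = 0 → 0 < differential I f x (Z x)) :
    frontier {x | f x ≤ 0} = {x | f x = 0} := by
  refine (frontier_le_subset_eq hf.continuous continuous_const).antisymm fun x (hx : f x = 0) ↦ ?_
  refine ⟨subset_closure hx.le, fun hint ↦ ?_⟩
  obtain ⟨ε, hε, hεx⟩ := hZ.exists_uniform_time (isCompact_singleton (x := x))
  obtain ⟨γ, rfl, hγ⟩ := hεx x rfl
  have h0 := (hγ 0 ⟨neg_lt_zero.2 hε, hε⟩).hasMFDerivAt (Ioo_mem_nhds (neg_lt_zero.2 hε) hε)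
  have h1 := HasVelocityAt.hasDerivAt_comp h0 (hf.mdifferentiableAt (by simp))
  have h2 := (eventually_pos_of_hasDerivAt hx h1 (hfZ _ hx)).1
  have h3 := (h0.continuousAt.eventually (mem_interior_iff_mem_nhds.1 hint)).filter_mono
    (nhdsWithin_le_nhds (s := Ioi 0))
  obtain ⟨s, hs, hs'⟩ := (h2.and h3).exists
  exact hs.not_ge hs'

theorem IsCompletionOfLiouvilleDomain.nonOrderableUpToConjugation {lam : OneForm I V}
    (h : IsCompletionOfLiouvilleDomain I lam) :
    NonOrderableUpToConjugation (I.prod 𝓘(ℝ, ℝ)) (contactization I lam) := by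
  obtain ⟨hsmooth, hnd, Z, W, κ, hZ, ⟨hW, f, hf, rfl, hfZ⟩, hκ, hbij⟩ := h
  have hlam := hsmooth.isSmoothInCharts
  have hZs := hZ.isSmoothField hlam hnd
  have hfr := frontier_sublevel_eq hZs hf hfZ
  have hend : ∀ x, 0 < f x → ∃ r : ℝ, 0 ≤ r ∧ ∃ y ∈ frontier {x | f x ≤ 0}, κ r y = x := by
    intro x hx
    obtain ⟨p, hp, hpx⟩ := hbij.surjOn (show x ∈ (interior {x | f x ≤ 0})ᶜ from
      fun hint ↦ hx.not_ge (interior_subset (s := {x | f x ≤ 0}) hint))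
    exact ⟨p.1, hp.1, p.2, hp.2, hpx⟩
  obtain ⟨ψ, hψ, hψ0, hψc, hψa, hψκ⟩ := hZs.exists_flow_of_end hW hκ
    fun x hx ↦ hend x (not_le.1 hx)
  have hlt : ∀ x (s : ℝ), 0 ≤ s → f x = 0 → f (ψ s x) = 0 → s = 0 := by
    intro x s hs hx hsx
    have hx' : x ∈ frontier {x | f x ≤ 0} := hfr ▸ hx
    have hsx' : ψ s x ∈ frontier {x | f x ≤ 0} := hfr ▸ hsx
    have h1 := hbij.injOn (x₁ := (s, x)) (x₂ := (0, ψ s x)) ⟨hs, hx'⟩ ⟨self_mem_Ici, hsx'⟩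
      ((hψκ x hx' s hs).symm.trans (hκ _ hsx').1.symm)
    exact congrArg Prod.fst h1
  have ht : IsTransverseFlow I Z f ψ :=
    { contMDiff_flow := hψ
      flow_zero := hψ0
      integralCurve := hψc
      flow_add := hψa
      contMDiff_level := hf
      transverse := hfZ
      once := fun x s hx hsx ↦ by
        rcases le_total 0 s with hs | hs
        · exact hlt x s hs hx hsx
        · refine neg_eq_zero.1 (hlt (ψ s x) (-s) (neg_nonneg.2 hs) hsx ?_)
          rw [← hψa, neg_add_cancel, hψ0, hx]
      reaches := fun x hx ↦ by
        obtain ⟨r, hr, y, hy, rfl⟩ := hend x hx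
        refine ⟨r, ?_⟩
        rw [← hψκ y hy r hr, ← hψa, neg_add_cancel, hψ0]
        exact hfr.subset hy }
  refine nonOrderableUpToConjugation_contactization hlam hnd hZ ht.contMDiff_endFunction
    (ht.isCompact_endFunction_le hW ht.contMDiff_endFunction.continuous) one_le_endFunction
    (fun x ↦ ?_) (c := 1 / 2) (m := 1 + Real.exp 1) (by norm_num) (fun x hx ↦ ?_)
  · rcases lt_or_ge (f x) 0 with hx | hx
    · exact (ht.differential_endFunction_of_neg hx).ge
    · obtain ⟨r, -, hr⟩ := ht.exists_crossing hx
      rw [ht.differential_endFunction hr]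
      exact monotone_endProfile.deriv_nonneg
  · have hx0 : 0 ≤ f x := by
      by_contra! hc
      rw [ht.endFunction_of_nonpos hc.le] at hx
      linarith [Real.exp_pos 1]
    obtain ⟨r, -, hr⟩ := ht.exists_crossing hx0
    rw [ht.endFunction_eq hr] at hx ⊢
    rw [ht.differential_endFunction hr]
    exact endProfile_le_deriv hx

end Completion

end ContactCone

end

theorem proposition1p7 :
    -- The standard contact structure on `ℝ^{2n+1}`.
    (∀ n : ℕ, ContactCone.NonOrderableUpToConjugation
      (𝓘(ℝ, EuclideanSpace ℝ (Fin n ⊕ Fin n)).prod 𝓘(ℝ, ℝ))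
      (ContactCone.contactization 𝓘(ℝ, EuclideanSpace ℝ (Fin n ⊕ Fin n))
        (ContactCone.standardForm n))) ∧
    -- The one-jet space of a closed manifold `M`.
    (∀ (E : Type*) [NormedAddCommGroup E] [NormedSpace ℝ E] [FiniteDimensional ℝ E]
      (H : Type*) [TopologicalSpace H] (I : ModelWithCorners ℝ E H) [I.Boundaryless]
      (M : Type*) [TopologicalSpace M] [ChartedSpace H M] [IsManifold I ∞ M]
      [T2Space M] [CompactSpace M],
      ContactCone.NonOrderableUpToConjugation
        ((I.prod 𝓘(ℝ, E →L[ℝ] ℝ)).prod 𝓘(ℝ, ℝ))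
        (ContactCone.contactization (I.prod 𝓘(ℝ, E →L[ℝ] ℝ))
          (ContactCone.canonicalForm I M))) ∧
    -- The contactization of the completion of a Liouville domain.
    (∀ (E : Type*) [NormedAddCommGroup E] [NormedSpace ℝ E] [FiniteDimensional ℝ E]
      (H : Type*) [TopologicalSpace H] (I : ModelWithCorners ℝ E H) [I.Boundaryless]
      (V : Type*) [TopologicalSpace V] [ChartedSpace H V] [IsManifold I ∞ V]
      [T2Space V] [SecondCountableTopology V] (lam : ContactCone.OneForm I V),
      ContactCone.IsCompletionOfLiouvilleDomain I lam →
      ContactCone.NonOrderableUpToConjugation (I.prod 𝓘(ℝ, ℝ))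
        (ContactCone.contactization I lam)) := by
  refine ⟨fun n ↦ ?_, ?_, ?_⟩
  · exact ContactCone.nonOrderableUpToConjugation_standardForm n
  · intro E _ _ _ H _ I _ M _ _ _ _ _
    exact ContactCone.nonOrderableUpToConjugation_canonicalForm
  · intro E _ _ _ H _ I _ V _ _ _ _ _ lam h
    exact h.nonOrderableUpToConjugation
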